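/- Let $p$ be a prime number and let $G$ be a profinite abelian group having an open subgroup $G'$ isomorphic (as a topological group) to $\mathbb{Z}_p^d$ for some $d \ge 0$. Let $R = \mathbb{Z}_p[[G]] = \varprojlim_U \mathbb{Z}_p[G/U]$ and $R' = \mathbb{Z}_p[[G']]$, and call an $R$-module torsion if it is torsion as an $R'$-module. Let $\mathcal{I}_R$ be the commutative group of invertible fractional ideals of $R$ in its total ring of fractions $\mathrm{Frac}(R)$. Let $\mathcal{P}_R$ (resp. $\mathcal{Q}_R$) be the exact category of finitely generated torsion $R$-modules of projective dimension $\le 1$ (resp. of finite projective dimension). Let $D^{\mathrm{perf}}_{\mathrm{tor}}(R)$ be the triangulated category of perfect complexes of $R$-modules (bounded complexes of finitely generated projective modules) with torsion cohomology groups, inside the derived category of $R$-modules. $K_0$ denotes the Grothendieck group, with relations $[X] = [X'] + [X'']$ for short exact sequences $0 \to X' \to X \to X'' \to 0$ (resp. distinguished triangles $X' \to X \to X'' \to X'[1]$). For a perfect complex $F^\bullet$ with torsion cohomology, $\mathrm{Frac}(R)\otimes_R F^\bullet$ is acyclic, and $\mathrm{Det}_R(F^\bullet) = \bigotimes_i \big(\bigwedge_R^{\mathrm{rank}(F^i)}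 F^i\big)^{\otimes (-1)^i}$ is regarded as an $R$-submodule of $\mathrm{Frac}(R)$ through the natural trivialization $\mathrm{Det}_{\mathrm{Frac}(R)}(\mathrm{Frac}(R)\otimes_R F^\bullet) \simeq \mathrm{Frac}(R)$ of the determinant of an acyclic complex. Then the following are well-defined group homomorphisms: 1. $\mathrm{Fitt}_R : K_0(\mathcal{P}_R) \to \mathcal{I}_R$, sending $[P]$ to the initial Fitting ideal of $P$; 2. $\iota : K_0(\mathcal{P}_R) \to K_0(\mathcal{Q}_R)$, induced by the inclusion; 3. $\varphi : K_0(\mathcal{Q}_R) \to K_0(D^{\mathrm{perf}}_{\mathrm{tor}}(R))$, sending $[Q]$ to $[F_Q^\bullet]$ for any resolution $F_Q^\bullet \to Q[0]$ by a perfect complex with torsion cohomology that vanishes in degrees $\ge 1$ (such a resolution exists for every $Q$ in $\mathcal{Q}_R$); 4. $\mathrm{Det}_R : K_0(D^{\mathrm{perf}}_{\mathrm{tor}}(R)) \to \mathcal{I}_R$, sending $[F^\bullet]$ to $\mathrm{Det}_R(F^\bullet) \subset \mathrm{Frac}(R)$. All four are isomorphisms, and, writing $\mathcal{I}_R$ additively,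 $$\mathrm{Det}_R \circ \varphi \circ \iota = -\mathrm{Fitt}_R.$$ -/

import Mathlib

open CategoryTheory
open scoped TensorProduct DirectSum

universe w u

noncomputable section

/-! ### Completed group rings -/

section CompletedGroupRing

variable (p : ℕ) [Fact p.Prime]

/-- The transition map `ℤ_p[G/U] → ℤ_p[G/V]` for open subgroups `U ≤ V` of an abelian
topological group `G`. -/
def groupRingTransition (G : Type u) [CommGroup G] [TopologicalSpace G]
    {U V : OpenSubgroup G} (h : U ≤ V) :
    MonoidAlgebra ℤ_[p] (G ⧸ (U : Subgroup G)) →+* MonoidAlgebra ℤ_[p] (G ⧸ (V : Subgroup G)) :=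
  MonoidAlgebra.mapDomainRingHom ℤ_[p]
    (QuotientGroup.map (U : Subgroup G) (V : Subgroup G) (MonoidHom.id G) h)

/-- The completed group ring `ℤ_p[[G]] = lim_U ℤ_p[G/U]` of an abelian topological group `G`,
where `U` runs over the open subgroups, realised as the subring of compatible families in the
product of the `ℤ_p[G/U]`. -/
def completedGroupSubring (G : Type u) [CommGroup G] [TopologicalSpace G] :
    Subring (∀ U : OpenSubgroup G, MonoidAlgebra ℤ_[p] (G ⧸ (U : Subgroup G))) where
  carrier := {x | ∀ (U V : OpenSubgroup G) (h : U ≤ V), groupRingTransition p G h (x U) = x V}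
  mul_mem' {x y} hx hy U V h := by
    rw [Pi.mul_apply, map_mul, hx U V h, hy U V h, Pi.mul_apply]
  one_mem' U V h := by rw [Pi.one_apply, map_one, Pi.one_apply]
  add_mem' {x y} hx hy U V h := by
    rw [Pi.add_apply, map_add, hx U V h, hy U V h, Pi.add_apply]
  zero_mem' U V h := by rw [Pi.zero_apply, map_zero, Pi.zero_apply]
  neg_mem' {x} hx U V h := by rw [Pi.neg_apply, map_neg, hx U V h, Pi.neg_apply]

/-- The completed group ring `ℤ_p[[G]]` of an abelian topological group, as a type. -/
abbrev CompletedGroupRing (G : Type u) [CommGroup G] [TopologicalSpace G] : Type u :=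
  completedGroupSubring p G

/-- The ring homomorphism `ℤ_p[[H]] → ℤ_p[[G]]` induced by a continuous homomorphism
`f : H → G`: its component at `U` is `ℤ_p[[H]] → ℤ_p[H/f⁻¹U] → ℤ_p[G/U]`. -/
def CompletedGroupRing.map {H G : Type u} [CommGroup H] [TopologicalSpace H]
    [CommGroup G] [TopologicalSpace G] (f : H →* G) (hf : Continuous f) :
    CompletedGroupRing p H →+* CompletedGroupRing p G :=
  RingHom.codRestrict
    (RingHom.pi fun U : OpenSubgroup G =>
      ((MonoidAlgebra.mapDomainRingHom ℤ_[p]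
          (QuotientGroup.map ((U.comap f hf : OpenSubgroup H) : Subgroup H) (U : Subgroup G) f
            (fun _ ha => ha))).comp
        (Pi.evalRingHom _ (U.comap f hf))).comp (completedGroupSubring p H).subtype)
    (completedGroupSubring p G)
    (by
      intro x U V h
      have hx := x.2 (U.comap f hf) (V.comap f hf) (fun a ha => h ha)
      change groupRingTransition p G h (MonoidAlgebra.mapDomainRingHom ℤ_[p] _
        (x.1 (U.comap f hf))) = MonoidAlgebra.mapDomainRingHom ℤ_[p] _ (x.1 (V.comap f hf))
      rw [← hx]
      unfold groupRingTransition
      rw [← RingHom.comp_apply, ← RingHom.comp_apply, ← MonoidAlgebra.mapDomainRingHom_comp,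
        ← MonoidAlgebra.mapDomainRingHom_comp]
      congr 2
      ext a
      rfl)

/-- The natural map `ℤ_p[[G']] → ℤ_p[[G]]` for a subgroup `G'` of `G`. -/
def CompletedGroupRing.ofSubgroup {G : Type u} [CommGroup G] [TopologicalSpace G]
    (G' : Subgroup G) : CompletedGroupRing p G' →+* CompletedGroupRing p G :=
  CompletedGroupRing.map p G'.subtype continuous_subtype_val

end CompletedGroupRing

/-! ### Grothendieck groups -/

section GrothendieckGroups

/-- The relations `[X] = [X'] + [X'']` for the short exact sequences `0 → X' → X → X'' → 0` with
all terms in the full subcategory `P` of an abelian category. -/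
def exactRelations {C : Type*} [Category C] [Abelian C] (P : ObjectProperty C) :
    Set (FreeAbelianGroup {X : C // P X}) :=
  {r | ∃ (S : ShortComplex C) (h₁ : P S.X₁) (h₂ : P S.X₂) (h₃ : P S.X₃), S.ShortExact ∧
    r = FreeAbelianGroup.of ⟨S.X₂, h₂⟩ -
      (FreeAbelianGroup.of ⟨S.X₁, h₁⟩ + FreeAbelianGroup.of ⟨S.X₃, h₃⟩)}

/-- The Grothendieck group `K₀` of a full subcategory `P` of an abelian category (closed under
extensions in the cases of interest), with its induced exact structure. -/
abbrev ExactK0 {C : Type*} [Category C] [Abelian C] (P : ObjectProperty C) :=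
  FreeAbelianGroup {X : C // P X} ⧸ AddSubgroup.closure (exactRelations P)

/-- The class `[X]` in the Grothendieck group of an exact category. -/
def ExactK0.of {C : Type*} [Category C] [Abelian C] (P : ObjectProperty C) (X : C) (h : P X) :
    ExactK0 P :=
  QuotientAddGroup.mk (FreeAbelianGroup.of ⟨X, h⟩)

/-- The homomorphism `K₀(P) → K₀(P')`, `[X] ↦ [X]`, induced by an inclusion `P ≤ P'` of full
subcategories. -/
def ExactK0.incl {C : Type*} [Category C] [Abelian C] {P P' : ObjectProperty C} (h : P ≤ P') :
    ExactK0 P →+ ExactK0 P' :=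
  QuotientAddGroup.map _ _
    (FreeAbelianGroup.map fun X : {X : C // P X} => (⟨X.1, h X.1 X.2⟩ : {X : C // P' X}))
    (by
      rw [AddSubgroup.closure_le]
      rintro _ ⟨S, h₁, h₂, h₃, hS, rfl⟩
      refine AddSubgroup.subset_closure ⟨S, h _ h₁, h _ h₂, h _ h₃, hS, ?_⟩
      simp)

open Limits Pretriangulated in
/-- The relations `[X] = [X'] + [X'']` for the distinguished triangles `X' → X → X'' → X'[1]`
with all terms in the full subcategory `P` of a triangulated category. -/
def triangleRelations {C : Type*} [Category C] [HasZeroObject C] [HasShift C ℤ]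
    [Preadditive C] [∀ n : ℤ, (shiftFunctor C n).Additive] [Pretriangulated C]
    (P : ObjectProperty C) : Set (FreeAbelianGroup {X : C // P X}) :=
  {r | ∃ (T : Triangle C) (h₁ : P T.obj₁) (h₂ : P T.obj₂) (h₃ : P T.obj₃),
    T ∈ distTriang C ∧
    r = FreeAbelianGroup.of ⟨T.obj₂, h₂⟩ -
      (FreeAbelianGroup.of ⟨T.obj₁, h₁⟩ + FreeAbelianGroup.of ⟨T.obj₃, h₃⟩)}

/-- The Grothendieck group `K₀` of a full (triangulated) subcategory `P` of a triangulated
category. -/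
abbrev TriangulatedK0 {C : Type*} [Category C] [Limits.HasZeroObject C] [HasShift C ℤ]
    [Preadditive C] [∀ n : ℤ, (shiftFunctor C n).Additive] [Pretriangulated C]
    (P : ObjectProperty C) :=
  FreeAbelianGroup {X : C // P X} ⧸ AddSubgroup.closure (triangleRelations P)

/-- The class `[X]` in the Grothendieck group of a triangulated category. -/
def TriangulatedK0.of {C : Type*} [Category C] [Limits.HasZeroObject C] [HasShift C ℤ]
    [Preadditive C] [∀ n : ℤ, (shiftFunctor C n).Additive] [Pretriangulated C]
    (P : ObjectProperty C) (X : C) (h : P X) : TriangulatedK0 P :=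
  QuotientAddGroup.mk (FreeAbelianGroup.of ⟨X, h⟩)

end GrothendieckGroups

/-! ### Torsion modules, Fitting ideals, invertible ideals -/

section Modules

/-- An `R`-module is torsion along `ι : S → R` if it is torsion as an `S`-module. -/
def IsTorsionAlong {S R : Type*} [CommRing S] [CommRing R] (ι : S →+* R) (M : Type*)
    [AddCommGroup M] [Module R M] : Prop :=
  letI : Module S M := Module.compHom M ι
  Module.IsTorsion S M

variable {S R : Type u} [CommRing S] [CommRing R]

/-- The category `𝒫_R`: finitely generated torsion `R`-modules of projective dimension `≤ 1`. -/
def catP (ι : S →+* R) : ObjectProperty (ModuleCat.{u} R) := fun M =>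
  Module.Finite R M ∧ IsTorsionAlong ι M ∧ HasProjectiveDimensionLE M 1

/-- The category `𝒬_R`: finitely generated torsion `R`-modules of finite projective dimension. -/
def catQ (ι : S →+* R) : ObjectProperty (ModuleCat.{u} R) := fun M =>
  Module.Finite R M ∧ IsTorsionAlong ι M ∧ ∃ n : ℕ, HasProjectiveDimensionLE M n

theorem catP_le_catQ (ι : S →+* R) : catP ι ≤ catQ ι := fun _ h => ⟨h.1, h.2.1, 1, h.2.2⟩

/-- The (initial) Fitting ideal of a finitely generated module `M`: the ideal generated by the
determinants of all square matrices `A` whose rows are relations between the members of a finite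
generating family `v` of `M`. (By Fitting's lemma each single `v` gives the same ideal.) -/
def fittingIdeal (R : Type*) [CommRing R] (M : Type*) [AddCommGroup M] [Module R M] : Ideal R :=
  Ideal.span {a | ∃ (n : ℕ) (v : Fin n → M) (A : Matrix (Fin n) (Fin n) R),
    Submodule.span R (Set.range v) = ⊤ ∧ (∀ i, ∑ j, A i j • v j = 0) ∧ A.det = a}

/-- The commutative group `ℐ_R` of invertible ideals of `R`, i.e. of invertible fractional ideals
in the total ring of fractions `Frac(R)`. -/
abbrev InvertibleIdeals (R : Type*) [CommRing R] :=
  (FractionalIdeal (nonZeroDivisors R) (FractionRing R))ˣ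

end Modules

/-! ### Perfect complexes with torsion cohomology -/

section Complexes

variable {S R : Type u} [CommRing S] [CommRing R]

/-- A perfect complex: a bounded cochain complex of finitely generated projective modules. -/
structure IsPerfectComplex (F : CochainComplex (ModuleCat.{u} R) ℤ) : Prop where
  bounded : ∃ a b : ℤ, ∀ i, i < a ∨ b < i → Limits.IsZero (F.X i)
  finite : ∀ i, Module.Finite R (F.X i)
  projective : ∀ i, Module.Projective R (F.X i)

/-- The objects of `Ch^perf_tor(R)`: perfect complexes with torsion cohomology groups. -/
def IsPerfectTorsion (ι : S →+* R) (F : CochainComplex (ModuleCat.{u} R) ℤ) : Prop :=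
  IsPerfectComplex F ∧ ∀ i, IsTorsionAlong ι (F.homology i)

/-- `D^perf_tor(R)`, as the full triangulated subcategory of the derived category of `R`-modules
on the objects represented by complexes in `Ch^perf_tor(R)`. -/
def derivedPerfTor (ι : S →+* R) [HasDerivedCategory.{w} (ModuleCat.{u} R)] :
    ObjectProperty (DerivedCategory.{w} (ModuleCat.{u} R)) := fun X =>
  ∃ F : CochainComplex (ModuleCat.{u} R) ℤ, IsPerfectTorsion ι F ∧
    Nonempty (DerivedCategory.Q.obj F ≅ X)

/-- The class in `K₀(D^perf_tor(R))` of a complex in `Ch^perf_tor(R)`. -/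
def complexClass (ι : S →+* R) [HasDerivedCategory.{w} (ModuleCat.{u} R)]
    (F : CochainComplex (ModuleCat.{u} R) ℤ) (hF : IsPerfectTorsion ι F) :
    TriangulatedK0 (derivedPerfTor.{w} ι) :=
  TriangulatedK0.of _ (DerivedCategory.Q.obj F) ⟨F, hF, ⟨Iso.refl _⟩⟩

/-- `F` (in `Ch^perf_tor(R)`) is a projective resolution of the module `M`: it vanishes in degrees
`≥ 1` and there is a quasi-isomorphism `F → M[0]`. -/
def IsPerfectResolution (ι : S →+* R) (F : CochainComplex (ModuleCat.{u} R) ℤ)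
    (M : ModuleCat.{u} R) : Prop :=
  IsPerfectTorsion ι F ∧ (∀ i : ℤ, 1 ≤ i → Limits.IsZero (F.X i)) ∧
    ∃ π : F ⟶ (HomologicalComplex.single (ModuleCat.{u} R) (ComplexShape.up ℤ) 0).obj M,
      QuasiIso π

end Complexes

/-! ### Determinants -/

section Determinants

/-- The determinant `Λ^{rank F} F` of a finitely generated projective module `F`, where `rank F`
is the locally constant rank: the submodule of the exterior algebra generated by the `e • Λⁿ F`,
for `e` an idempotent such that `F` has constant rank `n` on the open and closed set where `e` is
invertible. -/
def detModule (R : Type*) [CommRing R] (F : Type*) [AddCommGroup F] [Module R F] :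
    Submodule R (ExteriorAlgebra R F) :=
  Submodule.span R {y | ∃ (n : ℕ) (e : R) (x : ExteriorAlgebra R F), IsIdempotentElem e ∧
    (∀ 𝔭 : PrimeSpectrum R, e ∉ 𝔭.asIdeal → Module.rankAtStalk F 𝔭 = n) ∧
    x ∈ ⋀[R]^n F ∧ y = e • x}

/-- The map `Λ_R F → Λ_K V` induced by an `R`-linear map from an `R`-module `F` to a `K`-module
`V`, for an `R`-algebra `K`. -/
def exteriorMap {R K : Type*} [CommRing R] [CommRing K] [Algebra R K] {F V : Type*}
    [AddCommGroup F] [Module R F] [AddCommGroup V] [Module K V] [Module R V]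
    [IsScalarTower R K V] (f : F →ₗ[R] V) : ExteriorAlgebra R F →ₐ[R] ExteriorAlgebra K V :=
  ExteriorAlgebra.lift R
    ⟨((ExteriorAlgebra.ι K : V →ₗ[K] ExteriorAlgebra K V).restrictScalars R).comp f,
      fun _ => ExteriorAlgebra.ι_sq_zero _⟩

/-- For `R`-linear maps `f : M → W` and `g : N → W` to a `K`-module `W`, the `R`-submodule of the
`a` in `K` such that `a • Λ(f)` maps `Det_R(M)` into the image of `Det_R(N)` under `Λ(g)`. -/
def detTransporter {R : Type*} (K : Type*) [CommRing R] [CommRing K] [Algebra R K]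
    {M N W : Type*} [AddCommGroup M] [Module R M] [AddCommGroup N] [Module R N]
    [AddCommGroup W] [Module K W] [Module R W] [IsScalarTower R K W]
    (f : M →ₗ[R] W) (g : N →ₗ[R] W) : Submodule R K where
  carrier := {a | ∀ x ∈ detModule R M,
    a • (exteriorMap f x : ExteriorAlgebra K W) ∈
      (detModule R N).map (exteriorMap (K := K) g).toLinearMap}
  add_mem' {a b} ha hb x hx := by
    rw [add_smul]
    exact Submodule.add_mem _ (ha x hx) (hb x hx)
  zero_mem' x hx := by
    rw [zero_smul]
    exact Submodule.zero_mem _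
  smul_mem' r a ha x hx := by
    rw [smul_assoc]
    exact Submodule.smul_mem _ r (ha x hx)

variable {R : Type u} [CommRing R]

/-- The degree `i` term of `Frac(R) ⊗_R F`. -/
abbrev FracTerm (F : CochainComplex (ModuleCat.{u} R) ℤ) (i : ℤ) : Type u :=
  FractionRing R ⊗[R] (F.X i)

/-- The component of degree `i → j` of the differential of `Frac(R) ⊗_R F`. -/
def fracDiff (F : CochainComplex (ModuleCat.{u} R) ℤ) (i j : ℤ) :
    FracTerm F i →ₗ[FractionRing R] FracTerm F j :=
  (F.d i j).hom.baseChange (FractionRing R)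

/-- A contracting homotopy of `Frac(R) ⊗_R F`: maps `h` of degree `-1` with `d h + h d = 1`.
(Only the components `h j i` with `j = i + 1` are relevant.) -/
structure FracContraction (F : CochainComplex (ModuleCat.{u} R) ℤ) where
  h : ∀ j i : ℤ, FracTerm F j →ₗ[FractionRing R] FracTerm F i
  comm : ∀ i j k : ℤ, i + 1 = j → j + 1 = k →
    (fracDiff F i j).comp (h j i) + (h k j).comp (fracDiff F j k) = LinearMap.id

/-- The sum of the terms of even degree of a complex. -/
abbrev EvenPart (F : CochainComplex (ModuleCat.{u} R) ℤ) : Type u := ⨁ i : ℤ, F.X (2 * i)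

/-- The sum of the terms of odd degree of a complex. -/
abbrev OddPart (F : CochainComplex (ModuleCat.{u} R) ℤ) : Type u := ⨁ i : ℤ, F.X (2 * i + 1)

/-- The sum of the terms of even degree of `Frac(R) ⊗_R F`. -/
abbrev FracEvenPart (F : CochainComplex (ModuleCat.{u} R) ℤ) : Type u :=
  ⨁ i : ℤ, FracTerm F (2 * i)

/-- The sum of the terms of odd degree of `Frac(R) ⊗_R F`. -/
abbrev FracOddPart (F : CochainComplex (ModuleCat.{u} R) ℤ) : Type u :=
  ⨁ i : ℤ, FracTerm F (2 * i + 1)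

/-- The natural map `F^even → Frac(R) ⊗ F^even`, `x ↦ 1 ⊗ x`. -/
def evenToFrac (F : CochainComplex (ModuleCat.{u} R) ℤ) : EvenPart F →ₗ[R] FracEvenPart F :=
  DirectSum.lmap fun i => TensorProduct.mk R (FractionRing R) (F.X (2 * i)) 1

/-- The natural map `F^odd → Frac(R) ⊗ F^odd`, `x ↦ 1 ⊗ x`. -/
def oddToFrac (F : CochainComplex (ModuleCat.{u} R) ℤ) : OddPart F →ₗ[R] FracOddPart F :=
  DirectSum.lmap fun i => TensorProduct.mk R (FractionRing R) (F.X (2 * i + 1)) 1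

/-- The map `d + h : Frac(R) ⊗ F^odd → Frac(R) ⊗ F^even`, an isomorphism when `F` is bounded. -/
def FracContraction.oddToEven {F : CochainComplex (ModuleCat.{u} R) ℤ}
    (c : FracContraction F) : FracOddPart F →ₗ[FractionRing R] FracEvenPart F :=
  DirectSum.toModule (FractionRing R) ℤ _ fun i =>
    (DirectSum.lof (FractionRing R) ℤ (fun i => FracTerm F (2 * i)) (i + 1)).comp
        (fracDiff F (2 * i + 1) (2 * (i + 1))) +
      (DirectSum.lof (FractionRing R) ℤ (fun i => FracTerm F (2 * i)) i).comp
        (c.h (2 * i + 1) (2 * i))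

/-- The determinant `Det_R(F) = ⨂ᵢ Det_R(Fⁱ)^{(-1)ⁱ}` of a perfect complex `F` such that
`V = Frac(R) ⊗_R F` is acyclic, as an `R`-submodule of `Frac(R)`.

One has `Det_R(F) = Det_R(F^even) ⊗ Det_R(F^odd)⁻¹ = Hom_R(Det_R(F^odd), Det_R(F^even))`. The
trivialisation `Det(V) ≃ Frac(R)` of the determinant of the acyclic complex `V` with contracting
homotopy `h` comes from the isomorphism `Det(V^odd) ≃ Det(V^even)` induced by
`u = d + h : V^odd ≃ V^even`; up to sign it does not depend on `h`. Under it, an element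
`f` of `Hom_R(Det_R(F^odd), Det_R(F^even))` corresponds to the `c` in `Frac(R)` such that
`f = c • Λ(u)` after extension of scalars. So the image of `Det_R(F)` in `Frac(R)` consists of the
`c` such that `c • Λ(u)` maps `Det_R(F^odd)` into `Det_R(F^even)`. -/
def FracContraction.det {F : CochainComplex (ModuleCat.{u} R) ℤ} (c : FracContraction F) :
    Submodule R (FractionRing R) :=
  detTransporter (FractionRing R) (M := OddPart F) (N := EvenPart F) (W := FracEvenPart F)
    ((c.oddToEven.restrictScalars R).comp (oddToFrac F)) (evenToFrac F)

end Determinants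

end

/-! ### Determinants of endomorphisms of finitely generated projective modules -/

namespace LinearMap

/-! Three properties of `R = ℤ_p[[G]]` carry the theorem: it is noetherian, it is semilocal, and its
torsion modules are those of `R'`. The first two hold because `R` is compact and becomes finite
modulo the topologically nilpotent elements `p` and `γ - 1`, with `γ` running over a basis of `G' ≅
ℤ_p^d` (`CompletedGroupRing.exists_finset`). The third holds because `R` is free over `R'` on coset
representatives of `G'`. Over such a ring, finitely generated projective modules are classified by
their rank functions, invertible ideals are principal, and `Frac(R)` is again semilocal.

Determinants. For a perfect complex `F` with torsion cohomology, `d + h` identifies the odd and even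
parts over `Frac(R)`. Their ranks therefore agree, and there is an isomorphism `θ : F^odd ≃ F^even`
over `R`. Let `x` be the determinant of `(d + h) ∘ θ⁻¹`; then `Det_R(F) = x⁻¹ R`. Up to a unit of
`R`, the element `x` depends neither on `θ` nor on `h`: the endomorphism `(d + h)(d + h')` is `1`
plus a map that is triangular for the degree, and it has determinant `1` (`pdet_parityMap_comp`).
Moreover `x` is multiplicative in termwise split extensions and trivial for exact complexes. As
perfect complexes are K-projective, mapping cones turn this into additivity on distinguished
triangles.

Bijectivity. The map `ι` is surjective by dimension shifting along quotients of `Rᵐ / s Rᵐ`, and `φ`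
is surjective by killing the top cohomology with such modules. Hence it suffices that `Det ∘ φ ∘ ι`
is bijective. A module in `𝒫_R` is the cokernel of a square matrix `A` whose determinant is a
nonzerodivisor, and elimination over the semilocal ring `Frac(R)` gives `[coker A] = [R / det A]`
(`matrixClass_eq_scalarClass`). So `K₀(𝒫_R)` consists of differences `[R/a] - [R/b]`. The complex `R
→ R` given by `a` has determinant `a⁻¹ R`, so the composite sends `[R/a]` to `-(a)`. It is injective
because units have trivial class, and surjective because invertible ideals are principal. Since the
Fitting ideal of `coker A` is `(det A)`, minus the composite is `Fitt`. -/

theorem det_one_add_comp_comm_pi {A : Type*} [CommRing A] {m n : ℕ}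
    (f : (Fin m → A) →ₗ[A] (Fin n → A)) (g : (Fin n → A) →ₗ[A] (Fin m → A)) :
    LinearMap.det (1 + g ∘ₗ f) = LinearMap.det (1 + f ∘ₗ g) := by
  rw [← LinearMap.det_toMatrix', ← LinearMap.det_toMatrix', map_add, map_add,
    LinearMap.toMatrix'_comp, LinearMap.toMatrix'_comp, LinearMap.toMatrix'_one,
    LinearMap.toMatrix'_one, Matrix.det_one_add_mul_comm]

variable {A : Type*} [CommRing A]

section pdet

variable (W : Type*) [AddCommGroup W] [Module A W]

theorem exists_retraction_pi [Module.Finite A W] [Module.Projective A W] :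
    ∃ (n : ℕ) (s : W →ₗ[A] (Fin n → A)) (π : (Fin n → A) →ₗ[A] W), π ∘ₗ s = LinearMap.id := by
  obtain ⟨n, π, hπ⟩ := Module.Finite.exists_fin' A W
  obtain ⟨s, hs⟩ := Module.projective_lifting_property π LinearMap.id hπ
  exact ⟨n, s, π, hs⟩

variable {W}
variable [Module.Finite A W] [Module.Projective A W]

/-- The determinant of an endomorphism of a finitely generated projective module: the determinant
of its extension by the identity to a free module having the given one as a direct summand. -/
noncomputable def pdet (f : W →ₗ[A] W) : A :=
  LinearMap.det (1 + (exists_retraction_pi (A := A) W).choose_spec.choose ∘ₗ (f - 1) ∘ₗ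
    (exists_retraction_pi (A := A) W).choose_spec.choose_spec.choose)

/-- Sylvester's identity `det (1 + fg) = det (1 + gf)` moves the chosen retraction to a place where
`π ∘ s = 1` cancels it. With `c = s ∘ (f - 1)` and `b = π` for another retraction, this shows that
`pdet` does not depend on the choice. -/
theorem pdet_one_add_comp_pi {n : ℕ} (c : W →ₗ[A] (Fin n → A)) (b : (Fin n → A) →ₗ[A] W) :
    pdet (1 + b ∘ₗ c) = LinearMap.det (1 + c ∘ₗ b) := by
  unfold pdet
  set s := (exists_retraction_pi (A := A) W).choose_spec.choose
  set π := (exists_retraction_pi (A := A) W).choose_spec.choose_spec.choose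
  have h : π ∘ₗ s = LinearMap.id :=
    (exists_retraction_pi (A := A) W).choose_spec.choose_spec.choose_spec
  rw [show s ∘ₗ (1 + b ∘ₗ c - 1) ∘ₗ π = (s ∘ₗ b) ∘ₗ (c ∘ₗ π) by
    rw [add_sub_cancel_left]; rfl, det_one_add_comp_comm_pi]
  congr 2
  rw [LinearMap.comp_assoc, ← LinearMap.comp_assoc b s π, h, LinearMap.id_comp]

theorem pdet_eq_det_of_retraction {n : ℕ} (s : W →ₗ[A] (Fin n → A)) (π : (Fin n → A) →ₗ[A] W)
    (h : π ∘ₗ s = LinearMap.id) (f : W →ₗ[A] W) :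
    pdet f = LinearMap.det (1 + s ∘ₗ (f - 1) ∘ₗ π) := by
  rw [← LinearMap.comp_assoc, ← pdet_one_add_comp_pi (s ∘ₗ (f - 1)) π, ← LinearMap.comp_assoc, h,
    LinearMap.id_comp, add_sub_cancel]

@[simp]
theorem pdet_one : pdet (1 : W →ₗ[A] W) = 1 := by
  unfold pdet
  rw [sub_self, LinearMap.zero_comp, LinearMap.comp_zero, add_zero]
  exact LinearMap.det_id

/-- Since `π ∘ s = 1`, the extension `f ↦ 1 + s (f - 1) π` is multiplicative. -/
theorem pdet_comp (f g : W →ₗ[A] W) : pdet (f ∘ₗ g) = pdet f * pdet g := by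
  obtain ⟨n, s, π, h⟩ := exists_retraction_pi (A := A) W
  rw [pdet_eq_det_of_retraction s π h, pdet_eq_det_of_retraction s π h,
    pdet_eq_det_of_retraction s π h, ← LinearMap.det_comp]
  congr 1
  have h' : ∀ y, π (s y) = y := fun y => LinearMap.congr_fun h y
  refine LinearMap.ext fun x => ?_
  simp only [LinearMap.comp_apply, LinearMap.add_apply, Module.End.one_apply, LinearMap.sub_apply,
    map_add, map_sub, h']
  abel

variable {W' : Type*} [AddCommGroup W'] [Module A W'] [Module.Finite A W'] [Module.Projective A W']

/-- Inserting `π ∘ s = 1` on `W'` reduces both sides to `pdet_one_add_comp_pi`. Most later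
determinants are computed by this exchange. -/
theorem pdet_one_add_comp_comm (f : W →ₗ[A] W') (g : W' →ₗ[A] W) :
    pdet (1 + g ∘ₗ f) = pdet (1 + f ∘ₗ g) := by
  obtain ⟨n, s, π, h⟩ := exists_retraction_pi (A := A) W'
  have h1 : g ∘ₗ f = (g ∘ₗ π) ∘ₗ (s ∘ₗ f) := by
    rw [LinearMap.comp_assoc, ← LinearMap.comp_assoc f, h, LinearMap.id_comp]
  have h2 : f ∘ₗ g = π ∘ₗ (s ∘ₗ (f ∘ₗ g)) := by
    rw [← LinearMap.comp_assoc, h, LinearMap.id_comp]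
  rw [h1, h2, pdet_one_add_comp_pi, pdet_one_add_comp_pi]
  rfl

theorem pdet_conj (e : W ≃ₗ[A] W') (f : W →ₗ[A] W) :
    pdet (e.toLinearMap ∘ₗ f ∘ₗ e.symm.toLinearMap) = pdet f := by
  have h : pdet f = pdet (1 + e.symm.toLinearMap ∘ₗ (e.toLinearMap ∘ₗ (f - 1))) := by
    congr 1
    ext x
    simp
  rw [h, pdet_one_add_comp_comm]
  congr 1
  ext x
  simp

theorem pdet_pi {n : ℕ} (f : (Fin n → A) →ₗ[A] (Fin n → A)) : pdet f = LinearMap.det f := by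
  rw [pdet_eq_det_of_retraction LinearMap.id LinearMap.id rfl]
  simp

theorem pdet_eq_det [Module.Free A W] (f : W →ₗ[A] W) : pdet f = LinearMap.det f := by
  nontriviality A
  have e := (Module.finBasis A W).equivFun
  rw [← pdet_conj e, pdet_pi, LinearMap.det_conj]

theorem pdet_eq_of_semiconj (e : W ≃ₗ[A] W') (f : W →ₗ[A] W) (f' : W' →ₗ[A] W')
    (h : f' ∘ₗ e.toLinearMap = e.toLinearMap ∘ₗ f) : pdet f' = pdet f := by
  rw [← pdet_conj e, ← LinearMap.comp_assoc, ← h, LinearMap.comp_assoc]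
  simp

/-- The extension `1 + s (f - 1) π` is `f` on the image of `s` and the identity on the kernel of
`π`, so its bijectivity gives that of `f`. -/
theorem bijective_of_isUnit_pdet {f : W →ₗ[A] W} (hf : IsUnit (pdet f)) :
    Function.Bijective f := by
  obtain ⟨n, s, π, h⟩ := exists_retraction_pi (A := A) W
  have h' : ∀ y, π (s y) = y := fun y => LinearMap.congr_fun h y
  rw [pdet_eq_det_of_retraction s π h] at hf
  have hb := (LinearEquiv.ofIsUnitDet (v := Pi.basisFun A (Fin n)) (v' := Pi.basisFun A (Fin n))
    (f := 1 + s ∘ₗ (f - 1) ∘ₗ π) (by rwa [LinearMap.det_toMatrix])).bijective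
  constructor
  · rw [injective_iff_map_eq_zero]
    intro x hx
    have : s x = 0 := by
      apply hb.1
      simp [h', hx]
    rw [← h' x, this, map_zero]
  · intro y
    obtain ⟨z, hz⟩ := hb.2 (s y)
    refine ⟨π z, ?_⟩
    have := congrArg π hz
    simpa [h'] using this

end pdet

section exact

variable {W' W W'' : Type*} [AddCommGroup W'] [Module A W'] [Module.Finite A W']
  [Module.Projective A W'] [AddCommGroup W] [Module A W] [Module.Finite A W]
  [Module.Projective A W] [AddCommGroup W''] [Module A W''] [Module.Finite A W'']
  [Module.Projective A W'']

/-- Determinants are multiplicative along split exact sequences `W' → W → W''`. -/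
theorem pdet_eq_mul_of_split (i : W' →ₗ[A] W) (q : W →ₗ[A] W') (p : W →ₗ[A] W'') (j : W'' →ₗ[A] W)
    (hqi : q ∘ₗ i = LinearMap.id) (hpj : p ∘ₗ j = LinearMap.id) (hpi : p ∘ₗ i = 0)
    (hid : i ∘ₗ q + j ∘ₗ p = LinearMap.id) (f' : W' →ₗ[A] W') (f : W →ₗ[A] W)
    (f'' : W'' →ₗ[A] W'') (h' : f ∘ₗ i = i ∘ₗ f') (h'' : p ∘ₗ f = f'' ∘ₗ p) :
    pdet f = pdet f' * pdet f'' := by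
  have e1 : ∀ x, q (i x) = x := fun x => LinearMap.congr_fun hqi x
  have e2 : ∀ x, p (j x) = x := fun x => LinearMap.congr_fun hpj x
  have e3 : ∀ x, p (i x) = 0 := fun x => LinearMap.congr_fun hpi x
  have e4 : ∀ x, i (q x) + j (p x) = x := fun x => LinearMap.congr_fun hid x
  have e5 : ∀ x, f (i x) = i (f' x) := fun x => LinearMap.congr_fun h' x
  have e6 : ∀ x, p (f x) = f'' (p x) := fun x => LinearMap.congr_fun h'' x
  -- For `W = W' ⊕ W''` the map `f` is block triangular. It is the product of two block diagonal
  -- maps and a unipotent one, each of the form `1 +` a map through a summand, so that the exchange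
  -- identity computes its determinant.
  have key : f = (1 + j ∘ₗ ((f'' - 1) ∘ₗ p)) ∘ₗ (1 + i ∘ₗ (q ∘ₗ f ∘ₗ j ∘ₗ p)) ∘ₗ
      (1 + i ∘ₗ ((f' - 1) ∘ₗ q)) := by
    ext x
    have hx : f x = i (f' (q x)) + (i (q (f (j (p x)))) + j (f'' (p x))) := by
      conv_lhs => rw [← e4 x, map_add, e5, ← e4 (f (j (p x))), e6, e2]
    have hx' := e4 x
    simp only [LinearMap.comp_apply, LinearMap.add_apply, Module.End.one_apply,
      LinearMap.sub_apply, map_add, map_sub, e3, hx, map_zero,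
      add_zero]
    rw [← sub_eq_zero, ← sub_eq_zero.mpr hx']
    abel
  rw [key, pdet_comp, pdet_comp, pdet_one_add_comp_comm _ j, pdet_one_add_comp_comm _ i,
    pdet_one_add_comp_comm _ i]
  have t1 : (f'' - 1) ∘ₗ p ∘ₗ j = f'' - 1 := by rw [hpj]; rfl
  have t2 : (q ∘ₗ f ∘ₗ j ∘ₗ p) ∘ₗ i = 0 := by ext x; simp [e3]
  have t3 : (f' - 1) ∘ₗ q ∘ₗ i = f' - 1 := by rw [hqi]; rfl
  rw [LinearMap.comp_assoc, t1, t2, LinearMap.comp_assoc, t3, add_sub_cancel, add_sub_cancel,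
    add_zero, pdet_one, one_mul, mul_comm]

end exact

section baseChange

variable {B : Type*} [CommRing B] [Algebra A B]

theorem pdet_baseChange {W : Type*} [AddCommGroup W] [Module A W] [Module.Finite A W]
    [Module.Projective A W] (f : W →ₗ[A] W) :
    pdet (f.baseChange B) = algebraMap A B (pdet f) := by
  obtain ⟨n, s, π, h⟩ := exists_retraction_pi (A := A) W
  have h1 : f.baseChange B = 1 + (π.baseChange B) ∘ₗ ((s ∘ₗ (f - 1)).baseChange B) := by
    rw [← LinearMap.baseChange_comp, ← LinearMap.comp_assoc, h, LinearMap.id_comp,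
      LinearMap.baseChange_sub]
    have : (1 : W →ₗ[A] W).baseChange B = 1 := LinearMap.baseChange_id
    rw [this]
    abel
  rw [h1, pdet_one_add_comp_comm, pdet_eq_det_of_retraction s π h, ← LinearMap.baseChange_comp,
    ← LinearMap.det_baseChange, LinearMap.baseChange_add, pdet_eq_det]
  congr 2
  exact LinearMap.baseChange_id.symm

theorem pdet_isBaseChange {W V : Type*} [AddCommGroup W] [Module A W] [Module.Finite A W]
    [Module.Projective A W] [AddCommGroup V] [Module A V] [Module B V] [IsScalarTower A B V]
    [Module.Finite B V] [Module.Projective B V] {g : W →ₗ[A] V} (hg : IsBaseChange B g)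
    (f : W →ₗ[A] W) (f' : V →ₗ[B] V) (h : ∀ x, f' (g x) = g (f x)) :
    pdet f' = algebraMap A B (pdet f) := by
  rw [← pdet_baseChange, pdet_eq_of_semiconj hg.equiv (f.baseChange B) f']
  apply TensorProduct.AlgebraTensorModule.curry_injective
  ext x
  simp [h, IsBaseChange.equiv_tmul]

end baseChange

end LinearMap

/-! ### Projective modules over semilocal rings -/

section Semilocal

variable {R : Type*} [CommRing R]

theorem eq_one_of_forall_notMem_prime {e : R} (he : IsIdempotentElem e)
    (h : ∀ 𝔭 : PrimeSpectrum R, e ∉ 𝔭.asIdeal) : e = 1 := by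
  refine (IsIdempotentElem.iff_eq_one_of_isUnit ?_).mp he
  by_contra hu
  obtain ⟨m, hm, hem⟩ := exists_max_ideal_of_mem_nonunits hu
  exact h ⟨m, hm.isPrime⟩ hem

theorem eq_zero_of_forall_mem_prime {e : R} (he : IsIdempotentElem e)
    (h : ∀ 𝔭 : PrimeSpectrum R, e ∈ 𝔭.asIdeal) : e = 0 := by
  have := eq_one_of_forall_notMem_prime he.one_sub fun 𝔭 h1 => 𝔭.isPrime.ne_top
    ((Ideal.eq_top_iff_one _).mpr (by simpa using Ideal.add_mem _ h1 (h 𝔭)))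
  simpa using this

/-- The idempotents cutting out the loci of constant rank of a projective module. -/
theorem exists_rank_idempotents (M : Type*) [AddCommGroup M] [Module R M] [Module.Finite R M]
    [Module.Projective R M] :
    ∃ (N : ℕ) (e : ℕ → R), (∀ n, IsIdempotentElem (e n)) ∧ (∀ n m, n ≠ m → e n * e m = 0) ∧
      ∑ n ∈ Finset.range N, e n = 1 ∧
      ∀ n (𝔭 : PrimeSpectrum R), e n ∉ 𝔭.asIdeal ↔ Module.rankAtStalk M 𝔭 = n := by
  have := Module.finitePresentation_of_projective R M
  have hlc := Module.isLocallyConstant_rankAtStalk (R := R) (M := M)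
  have h1 : ∀ n : ℕ, ∃ e : R, IsIdempotentElem e ∧
      ∀ 𝔭 : PrimeSpectrum R, e ∉ 𝔭.asIdeal ↔ Module.rankAtStalk M 𝔭 = n := by
    intro n
    obtain ⟨e, he, h⟩ := PrimeSpectrum.exists_idempotent_basicOpen_eq_of_isClopen
      (hlc.isClopen_fiber n)
    refine ⟨e, he, fun 𝔭 => ?_⟩
    have : 𝔭 ∈ {x | Module.rankAtStalk M x = n} ↔ 𝔭 ∈ (PrimeSpectrum.basicOpen e : Set _) := by
      rw [← h]
    exact this.symm
  choose e he hr using h1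
  have horth : ∀ n m, n ≠ m → e n * e m = 0 := by
    intro n m hnm
    refine eq_zero_of_forall_mem_prime ((he n).mul (he m)) fun 𝔭 => ?_
    by_contra hc
    have h1 : e n ∉ 𝔭.asIdeal := fun h => hc (Ideal.mul_mem_right _ _ h)
    have h2 : e m ∉ 𝔭.asIdeal := fun h => hc (Ideal.mul_mem_left _ _ h)
    exact hnm (((hr n 𝔭).mp h1).symm.trans ((hr m 𝔭).mp h2))
  obtain ⟨N, hN⟩ := hlc.range_finite.bddAbove
  refine ⟨N + 1, e, he, horth, ?_, hr⟩
  refine eq_one_of_forall_notMem_prime ?_ fun 𝔭 hmem => ?_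
  · unfold IsIdempotentElem
    rw [Finset.sum_mul_sum]
    refine Finset.sum_congr rfl fun n hn => ?_
    rw [Finset.sum_eq_single n (fun m _ hm => horth _ _ hm.symm) (fun h => absurd hn h)]
    exact he n
  · have hn : Module.rankAtStalk M 𝔭 ∈ Finset.range (N + 1) :=
      Finset.mem_range.mpr (Nat.lt_succ_of_le (hN ⟨𝔭, rfl⟩))
    have h3 := (hr _ 𝔭).mpr rfl
    refine h3 ?_
    have := Ideal.mul_mem_left _ (e (Module.rankAtStalk M 𝔭)) hmem
    rwa [Finset.mul_sum, Finset.sum_eq_single _ (fun m _ hm => horth _ _ hm.symm)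
      (fun h => absurd hn h), he] at this

/-- The tensor product is `M / (1 - e) M`, and `e` kills `(1 - e) M`. -/
theorem smul_eq_zero_of_one_tmul_quotient {M : Type*} [AddCommGroup M] [Module R M] {e : R}
    (he : IsIdempotentElem e) (x : M)
    (hx : (1 : R ⧸ Ideal.span {1 - e}) ⊗ₜ[R] x = 0) : e • x = 0 := by
  have h := congrArg (TensorProduct.quotTensorEquivQuotSMul M (Ideal.span {1 - e})) hx
  rw [map_zero, ← map_one (Ideal.Quotient.mk (Ideal.span {1 - e})),
    TensorProduct.quotTensorEquivQuotSMul_mk_tmul, one_smul,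
    Submodule.Quotient.mk_eq_zero, Submodule.ideal_span_singleton_smul] at h
  obtain ⟨y, -, rfl⟩ := h
  change e • (1 - e) • y = 0
  rw [smul_smul, mul_sub, he, mul_one, sub_self, zero_smul]

/-- This glues isomorphisms over the pieces `R e_n`: both modules have coordinates in `e_n Rⁿ`
there, and orthogonality removes the mixed terms. -/
theorem sum_comp_sum_eq_id {k : ℕ} {e : ℕ → R} (he : ∀ n, IsIdempotentElem (e n))
    (horth : ∀ n m, n ≠ m → e n * e m = 0) (hsum : ∑ n ∈ Finset.range k, e n = 1)
    {X Y : Type*} [AddCommGroup X] [Module R X] [AddCommGroup Y] [Module R Y]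
    {sX : ∀ n, X →ₗ[R] (Fin n → R)} {πX : ∀ n, (Fin n → R) →ₗ[R] X}
    {sY : ∀ n, Y →ₗ[R] (Fin n → R)} {πY : ∀ n, (Fin n → R) →ₗ[R] Y}
    (hX : ∀ n, πX n ∘ₗ sX n = e n • LinearMap.id) (hY : ∀ n, sY n ∘ₗ πY n = e n • LinearMap.id) :
    (∑ n ∈ Finset.range k, e n • (πX n ∘ₗ sY n)) ∘ₗ (∑ n ∈ Finset.range k, e n • (πY n ∘ₗ sX n))
      = LinearMap.id := by
  refine LinearMap.ext fun x => ?_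
  have hX' : ∀ n x, πX n (sX n x) = e n • x := fun n x => LinearMap.congr_fun (hX n) x
  have hY' : ∀ n x, sY n (πY n x) = e n • x := fun n x => LinearMap.congr_fun (hY n) x
  simp only [LinearMap.comp_apply, LinearMap.sum_apply, LinearMap.smul_apply, map_sum, map_smul,
    LinearMap.id_apply, Finset.smul_sum]
  conv_rhs => rw [← one_smul R x, ← hsum, Finset.sum_smul]
  refine Finset.sum_congr rfl fun n hn => ?_
  rw [Finset.sum_eq_single n]
  · rw [hY', map_smul, hX']
    simp only [smul_smul, (he n).eq]
  · intro m _ hm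
    rw [smul_smul, horth _ _ hm.symm, zero_smul]
  · exact fun h => absurd hn h

variable [Finite (MaximalSpectrum R)]

instance finite_maximalSpectrum_quotient (I : Ideal R) : Finite (MaximalSpectrum (R ⧸ I)) := by
  refine Finite.of_injective (β := MaximalSpectrum R) (fun m => ⟨m.asIdeal.comap
    (Ideal.Quotient.mk I), ?_⟩) ?_
  · have := m.isMaximal
    exact Ideal.comap_isMaximal_of_surjective _ Ideal.Quotient.mk_surjective
  · intro m m' h
    ext1
    exact Ideal.comap_injective_of_surjective _ Ideal.Quotient.mk_surjective
      (congrArg MaximalSpectrum.asIdeal h)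

/-- Over a semilocal ring, freeness of a flat finite module can be tested by equality of the
dimensions over the residue fields. These are ranks at stalks after base change to the field. -/
theorem nonempty_basis_of_rankAtStalk_eq (M : Type*) [AddCommGroup M] [Module R M]
    [Module.Finite R M] [Module.Projective R M] (n : ℕ)
    (h : ∀ 𝔭 : PrimeSpectrum R, Module.rankAtStalk M 𝔭 = n) :
    Nonempty (Module.Basis (Fin n) R M) := by
  refine Module.nonempty_basis_of_flat_of_finrank_eq R M n fun P => ?_
  have := P.isMaximal
  let := Ideal.Quotient.field P.asIdeal
  rw [← h (PrimeSpectrum.comap (algebraMap R (R ⧸ P.asIdeal)) ⟨⊥, Ideal.isPrime_bot⟩),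
    ← Module.rankAtStalk_baseChange, Module.rankAtStalk_eq_finrank_of_free]
  rfl

/-- Over a semilocal ring, a projective module is free of rank `n` on its locus of rank `n`. -/
theorem exists_local_coordinates (M : Type*) [AddCommGroup M] [Module R M]
    [Module.Finite R M] [Module.Projective R M] (n : ℕ) (e : R) (he : IsIdempotentElem e)
    (h : ∀ 𝔭 : PrimeSpectrum R, e ∉ 𝔭.asIdeal → Module.rankAtStalk M 𝔭 = n) :
    ∃ (s : M →ₗ[R] (Fin n → R)) (π : (Fin n → R) →ₗ[R] M),
      π ∘ₗ s = e • LinearMap.id ∧ s ∘ₗ π = e • LinearMap.id := by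
  -- This quotient is the factor `R e` of `R`; over it `M` has constant rank `n` and is free.
  -- Coordinates are then lifted to `R`.
  let A := R ⧸ Ideal.span {1 - e}
  have hrank : ∀ 𝔭 : PrimeSpectrum A, Module.rankAtStalk (A ⊗[R] M) 𝔭 = n := by
    intro 𝔭
    rw [Module.rankAtStalk_baseChange]
    refine h _ fun hmem => 𝔭.isPrime.ne_top ((Ideal.eq_top_iff_one _).mpr ?_)
    have h1 : algebraMap R A (1 - e) = 0 :=
      Ideal.Quotient.eq_zero_iff_mem.mpr (Ideal.mem_span_singleton_self _)
    rw [map_sub, map_one, sub_eq_zero] at h1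
    rw [h1]
    exact hmem
  obtain ⟨b⟩ := nonempty_basis_of_rankAtStalk_eq (A ⊗[R] M) n hrank
  have hsurjM : Function.Surjective (TensorProduct.mk R A M 1) := by
    intro y
    induction y with
    | zero => exact ⟨0, map_zero _⟩
    | add x y hx hy =>
      obtain ⟨x', rfl⟩ := hx
      obtain ⟨y', rfl⟩ := hy
      exact ⟨x' + y', map_add _ _ _⟩
    | tmul a m =>
      obtain ⟨r, rfl⟩ := Ideal.Quotient.mk_surjective a
      refine ⟨r • m, ?_⟩
      rw [TensorProduct.mk_apply, ← TensorProduct.smul_tmul]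
      congr 1
      rw [Algebra.smul_def, mul_one]
      rfl
  let ρ : (Fin n → R) →ₗ[R] (Fin n → A) := (Algebra.linearMap R A).compLeft (Fin n)
  have hρ : Function.Surjective ρ := by
    intro y
    choose x hx using fun i => Ideal.Quotient.mk_surjective (y i)
    exact ⟨x, funext hx⟩
  let b' : (A ⊗[R] M) ≃ₗ[R] (Fin n → A) := b.equivFun.restrictScalars R
  obtain ⟨s, hs⟩ := Module.projective_lifting_property ρ
    (b'.toLinearMap ∘ₗ TensorProduct.mk R A M 1) hρ
  obtain ⟨π, hπ⟩ := Module.projective_lifting_property (TensorProduct.mk R A M 1)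
    (b'.symm.toLinearMap ∘ₗ ρ) hsurjM
  have hs' : ∀ x, ρ (s x) = b' (1 ⊗ₜ x) := fun x => LinearMap.congr_fun hs x
  have hπ' : ∀ x, (1 : A) ⊗ₜ[R] (π x) = b'.symm (ρ x) := fun x => LinearMap.congr_fun hπ x
  -- The lifts are mutually inverse only modulo `1 - e`; multiplying one of them by `e` removes the
  -- error.
  refine ⟨e • s, π, ?_, ?_⟩
  · ext x
    simp only [LinearMap.comp_apply, LinearMap.smul_apply, LinearMap.id_apply, map_smul]
    rw [← sub_eq_zero, ← smul_sub]
    refine smul_eq_zero_of_one_tmul_quotient he _ ?_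
    rw [TensorProduct.tmul_sub]
    change (1 : A) ⊗ₜ[R] _ - (1 : A) ⊗ₜ[R] _ = 0
    rw [hπ', hs', LinearEquiv.symm_apply_apply, sub_self]
  · refine LinearMap.ext fun x => ?_
    simp only [LinearMap.comp_apply, LinearMap.smul_apply, LinearMap.id_apply]
    rw [← sub_eq_zero, ← smul_sub]
    have h0 : ρ (s (π x) - x) = 0 := by
      rw [map_sub, hs', hπ', LinearEquiv.apply_symm_apply, sub_self]
    funext i
    have hi : Ideal.Quotient.mk (Ideal.span {1 - e}) ((s (π x) - x) i) = 0 := congrFun h0 i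
    rw [Ideal.Quotient.eq_zero_iff_mem, Ideal.mem_span_singleton] at hi
    obtain ⟨r, hr⟩ := hi
    change e * (s (π x) - x) i = 0
    rw [hr, ← mul_assoc, mul_sub, he, mul_one, sub_self, zero_mul]

/-- Over a semilocal ring, projective modules with the same rank function are isomorphic. -/
theorem nonempty_linearEquiv_of_rankAtStalk_eq (M N : Type*) [AddCommGroup M] [Module R M]
    [Module.Finite R M] [Module.Projective R M] [AddCommGroup N] [Module R N]
    [Module.Finite R N] [Module.Projective R N]
    (h : ∀ 𝔭 : PrimeSpectrum R, Module.rankAtStalk M 𝔭 = Module.rankAtStalk N 𝔭) :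
    Nonempty (M ≃ₗ[R] N) := by
  obtain ⟨k, e, he, horth, hsum, hr⟩ := exists_rank_idempotents (R := R) M
  choose s π h1 h2 using fun n =>
    exists_local_coordinates M n (e n) (he n) fun 𝔭 h => (hr n 𝔭).mp h
  choose s' π' h1' h2' using fun n =>
    exists_local_coordinates N n (e n) (he n) fun 𝔭 h' => (h 𝔭).symm.trans ((hr n 𝔭).mp h')
  exact ⟨LinearEquiv.ofLinearMap _ _
    (sum_comp_sum_eq_id he horth hsum h1' h2) (sum_comp_sum_eq_id he horth hsum h1 h2')⟩

end Semilocal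

/-! ### Unimodular columns over semilocal rings -/

section StableRange

/-- A column over a semilocal ring whose entries generate the unit ideal can be transformed by
elementary operations so that its first entry is a unit. -/
theorem exists_isUnit_add_sum {K : Type*} [CommRing K] [Finite (MaximalSpectrum K)] {ι : Type*}
    [Fintype ι] (b : K) (c : ι → K)
    (h : ∀ m : Ideal K, m.IsMaximal → b ∉ m ∨ ∃ i, c i ∉ m) :
    ∃ t : ι → K, IsUnit (b + ∑ i, t i * c i) := by
  classical
  have h1 : ∀ m : MaximalSpectrum K, ∃ t : ι → K, b + ∑ i, t i * c i ∉ m.asIdeal := by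
    intro m
    by_cases hb : b ∈ m.asIdeal
    · obtain ⟨i, hi⟩ := (h m.asIdeal m.isMaximal).resolve_left (not_not.mpr hb)
      refine ⟨Pi.single i 1, fun hc => hi ?_⟩
      simpa [Pi.single_apply] using (Ideal.add_mem_iff_right _ hb).mp hc
    · exact ⟨0, by simpa using hb⟩
  choose t ht using h1
  -- Chinese remainder theorem: the coefficients found at each maximal ideal are realised
  -- simultaneously.
  have h2 : ∀ i, ∃ x : K, ∀ m : MaximalSpectrum K, x - t m i ∈ m.asIdeal := fun i =>
    Ideal.exists_forall_sub_mem_ideal (I := fun m : MaximalSpectrum K => m.asIdeal)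
      (fun m m' hne => Ideal.isCoprime_of_isMaximal (MaximalSpectrum.ext_iff.ne.mp hne))
      (fun m => t m i)
  choose x hx using h2
  refine ⟨x, ?_⟩
  by_contra hu
  obtain ⟨m, hm, hmem⟩ := exists_max_ideal_of_mem_nonunits hu
  refine ht ⟨m, hm⟩ ?_
  have : b + ∑ i, t ⟨m, hm⟩ i * c i =
      b + ∑ i, x i * c i - ∑ i, (x i - t ⟨m, hm⟩ i) * c i := by
    simp only [sub_mul, Finset.sum_sub_distrib]
    ring
  rw [this]
  exact Ideal.sub_mem _ hmem (Ideal.sum_mem _ fun i _ => Ideal.mul_mem_right _ _ (hx i ⟨m, hm⟩))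

end StableRange

/-! ### Ranks over the total ring of fractions -/

section Generic

/-- Projective modules which become isomorphic over the total ring of fractions have the same
rank. -/
theorem rankAtStalk_eq_of_isBaseChange_fractionRing {R K : Type*} [CommRing R] [CommRing K]
    [Algebra R K] [IsFractionRing R K] {M N V W : Type*} [AddCommGroup M] [Module R M]
    [Module.Finite R M] [Module.Projective R M] [AddCommGroup N] [Module R N] [Module.Finite R N]
    [Module.Projective R N] [AddCommGroup V] [Module R V] [Module K V] [IsScalarTower R K V]
    [AddCommGroup W] [Module R W] [Module K W] [IsScalarTower R K W] {f : M →ₗ[R] V}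
    {g : N →ₗ[R] W} (hf : IsBaseChange K f) (hg : IsBaseChange K g) (e : V ≃ₗ[K] W)
    (𝔭 : PrimeSpectrum R) : Module.rankAtStalk M 𝔭 = Module.rankAtStalk N 𝔭 := by
  -- The rank does not change along a specialisation, so it can be read off at a minimal prime below
  -- `𝔭`. Such a prime contains no nonzerodivisor, so it comes from a prime of `K`.
  obtain ⟨q, hq, hqp⟩ := Ideal.exists_minimalPrimes_le (I := (⊥ : Ideal R)) (J := 𝔭.asIdeal) bot_le
  have := hq.isPrime
  have hd := Ideal.disjoint_nonZeroDivisors_of_mem_minimalPrimes hq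
  have hq' : (⟨q, inferInstance⟩ : PrimeSpectrum R) ∈
      Set.range (PrimeSpectrum.comap (algebraMap R K)) := by
    rw [PrimeSpectrum.localization_comap_range K (nonZeroDivisors R)]
    exact hd.symm
  obtain ⟨Q, hQ⟩ := hq'
  have hle : (⟨q, inferInstance⟩ : PrimeSpectrum R) ≤ 𝔭 := hqp
  rw [← Module.rankAtStalk_eq_of_le_of_finite_of_flat M hle,
    ← Module.rankAtStalk_eq_of_le_of_finite_of_flat N hle, ← hQ,
    ← Module.rankAtStalk_isBaseChange hf, ← Module.rankAtStalk_isBaseChange hg,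
    Module.rankAtStalk_eq_of_equiv e]

end Generic

/-! ### Contractions of bounded complexes of projective modules -/

section BoundedFamily

/-- A family of modules indexed by `ℤ` is bounded if all but finitely many members vanish. -/
def BoundedFamily (V : ℤ → Type*) : Prop :=
  ∃ a b : ℤ, ∀ i, i < a ∨ b < i → Subsingleton (V i)

theorem BoundedFamily.comp_two_mul_add {V : ℤ → Type*} (hV : BoundedFamily V) {a : ℤ → ℤ} {c : ℤ}
    (ha : ∀ i, a i = 2 * i + c) : BoundedFamily fun i => V (a i) := by
  obtain ⟨m, n, h⟩ := hV
  -- The zero in the bounds fixes the sign of `i`, so that `2 * i` lies beyond `i` on the same side.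
  refine ⟨min (m - c) 0, max (n - c) 0, fun i hi => h _ ?_⟩
  rw [ha]
  omega

variable {A : Type*} [CommRing A] {V : ℤ → Type*} [∀ i, AddCommGroup (V i)] [∀ i, Module A (V i)]

theorem BoundedFamily.sum_lof_component (hV : BoundedFamily V) :
    ∃ a b : ℤ, a ≤ b ∧ ∑ i ∈ Finset.Ico a b, DirectSum.lof A ℤ V i ∘ₗ DirectSum.component A ℤ V i =
      LinearMap.id := by
  obtain ⟨a, b, h⟩ := hV
  refine ⟨a, max a (b + 1), le_max_left _ _,
    DirectSum.linearMap_ext _ fun j => LinearMap.ext fun x => ?_⟩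
  simp only [LinearMap.comp_apply, LinearMap.sum_apply, LinearMap.id_apply]
  by_cases hj : j ∈ Finset.Ico a (max a (b + 1))
  · rw [Finset.sum_eq_single j]
    · rw [DirectSum.component.lof_self]
    · intro i _ hi
      rw [DirectSum.component.of, dif_neg hi.symm, map_zero]
    · exact fun h => absurd hj h
  · have : Subsingleton (V j) := h j (by
      rw [Finset.mem_Ico] at hj
      omega)
    rw [Subsingleton.elim x 0]
    simp

theorem BoundedFamily.finite_directSum (hV : BoundedFamily V) [∀ i, Module.Finite A (V i)] :
    Module.Finite A (⨁ i, V i) := by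
  obtain ⟨a, b, -, h⟩ := hV.sum_lof_component (A := A)
  refine Module.Finite.of_surjective
    (∑ i : Finset.Ico a b, DirectSum.lof A ℤ V i ∘ₗ
      LinearMap.proj (R := A) (φ := fun i : Finset.Ico a b => V i) i) ?_
  intro x
  refine ⟨fun i => DirectSum.component A ℤ V i x, ?_⟩
  have := LinearMap.congr_fun h x
  rw [← Finset.sum_coe_sort] at this
  simpa using this

theorem projective_directSum [∀ i, Module.Projective A (V i)] :
    Module.Projective A (⨁ i, V i) :=
  inferInstanceAs (Module.Projective A (Π₀ i, V i))

variable [∀ i, Module.Finite A (V i)] [∀ i, Module.Projective A (V i)]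
  [Module.Finite A (⨁ i, V i)] [Module.Projective A (⨁ i, V i)]

/-- The determinant of a triangular endomorphism of a direct sum. -/
theorem pdet_one_add_eq_one_of_triangular (hV : BoundedFamily V)
    (X : (⨁ i, V i) →ₗ[A] ⨁ i, V i)
    (hX : ∀ (j i : ℤ) (x : V j), j < i →
      DirectSum.component A ℤ V i (X (DirectSum.lof A ℤ V j x)) = 0)
    (hdiag : ∀ i, LinearMap.pdet
      (1 + DirectSum.component A ℤ V i ∘ₗ X ∘ₗ DirectSum.lof A ℤ V i) = 1) :
    LinearMap.pdet (1 + X) = 1 := by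
  obtain ⟨a, b, hab, h⟩ := hV.sum_lof_component (A := A)
  -- The columns of `X` are added one at a time. Earlier columns have no component in degree `n`, so
  -- adding column `n` is composition with a map whose determinant is that of the diagonal block.
  have key : ∀ n, a ≤ n → LinearMap.pdet (1 + X ∘ₗ
      ∑ i ∈ Finset.Ico a n, DirectSum.lof A ℤ V i ∘ₗ DirectSum.component A ℤ V i) = 1 := by
    intro n hn
    induction n, hn using Int.leInduction with
    | base => simp
    | succ n hn ih =>
      have hsplit : Finset.Ico a (n + 1) = insert n (Finset.Ico a n) := by
        ext i
        simp only [Finset.mem_Ico, Finset.mem_insert]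
        omega
      have hnot : n ∉ Finset.Ico a n := by simp
      have hfac : (1 + X ∘ₗ ∑ i ∈ Finset.Ico a (n + 1),
            DirectSum.lof A ℤ V i ∘ₗ DirectSum.component A ℤ V i) =
          (1 + (X ∘ₗ DirectSum.lof A ℤ V n) ∘ₗ DirectSum.component A ℤ V n) ∘ₗ
          (1 + X ∘ₗ ∑ i ∈ Finset.Ico a n,
            DirectSum.lof A ℤ V i ∘ₗ DirectSum.component A ℤ V i) := by
        rw [hsplit, Finset.sum_insert hnot]
        refine LinearMap.ext fun x => ?_
        have hz : DirectSum.component A ℤ V n (X (∑ i ∈ Finset.Ico a n,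
            DirectSum.lof A ℤ V i (DirectSum.component A ℤ V i x))) = 0 := by
          rw [map_sum, map_sum]
          exact Finset.sum_eq_zero fun i hi => hX i n _ (Finset.mem_Ico.mp hi).2
        simp only [LinearMap.comp_apply, LinearMap.add_apply, Module.End.one_apply,
          LinearMap.sum_apply, map_add, hz, map_zero, add_zero]
        abel
      rw [hfac, LinearMap.pdet_comp, ih, mul_one, LinearMap.pdet_one_add_comp_comm]
      exact hdiag n
  have := key b hab
  rwa [h, LinearMap.comp_id] at this

end BoundedFamily

section Contraction

variable {A : Type*} [CommRing A] {V : ℤ → Type*} [∀ i, AddCommGroup (V i)] [∀ i, Module A (V i)]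

/-- The maps `h` of degree `-1` form a contracting homotopy for the maps `d` of degree `1`. -/
def IsContraction (d h : ∀ i j : ℤ, V i →ₗ[A] V j) : Prop :=
  ∀ i j k : ℤ, i + 1 = j → j + 1 = k → d i j ∘ₗ h j i + h k j ∘ₗ d j k = LinearMap.id

/-- The map `d + h` between two direct sums of terms of a complex. -/
noncomputable def parityMap (d h : ∀ i j : ℤ, V i →ₗ[A] V j) (a b s t : ℤ → ℤ) :
    (⨁ i, V (a i)) →ₗ[A] ⨁ i, V (b i) :=
  DirectSum.toModule A ℤ _ fun i =>
    DirectSum.lof A ℤ (fun i => V (b i)) (s i) ∘ₗ d (a i) (b (s i)) +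
      DirectSum.lof A ℤ (fun i => V (b i)) (t i) ∘ₗ h (a i) (b (t i))

theorem parityMap_lof (d h : ∀ i j : ℤ, V i →ₗ[A] V j) (a b s t : ℤ → ℤ) (i : ℤ) (x : V (a i)) :
    parityMap d h a b s t (DirectSum.lof A ℤ (fun i => V (a i)) i x) =
      DirectSum.lof A ℤ (fun i => V (b i)) (s i) (d (a i) (b (s i)) x) +
      DirectSum.lof A ℤ (fun i => V (b i)) (t i) (h (a i) (b (t i)) x) := by
  rw [parityMap, DirectSum.toModule_lof]
  rfl

/-- Indices such as `s' (t i)` and `i` agree only propositionally; this transports along such an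
equality. -/
theorem lof_apply_congr {b : ℤ → ℤ} {l : ℤ} (f : ∀ j, V l →ₗ[A] V j) (x : V l) {i j : ℤ}
    (h : i = j) : DirectSum.lof A ℤ (fun i => V (b i)) i (f (b i) x) =
      DirectSum.lof A ℤ (fun i => V (b i)) j (f (b j) x) := by
  subst h
  rfl

variable {d h h' : ∀ i j : ℤ, V i →ₗ[A] V j}

variable [∀ i, Module.Finite A (V i)] [∀ i, Module.Projective A (V i)]

/-- Induction on the degree, starting below the complex. Put `y = d (h' - h)` one degree lower.
Since `dh + hd = 1` for both homotopies, `(h' - h) d = -y`, and the exchange identity turns the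
determinant into that of `1 - y`. As `y² = 0`, this is inverse to the determinant of `1 + y`, which
is `1` by induction. -/
theorem pdet_one_add_d_comp_sub (hV : BoundedFamily V) (hd : ∀ i j k, d j k ∘ₗ d i j = 0)
    (hh : IsContraction d h) (hh' : IsContraction d h') (i j : ℤ) (hij : j + 1 = i) :
    LinearMap.pdet (1 + d j i ∘ₗ (h' i j - h i j)) = 1 := by
  obtain ⟨a, _, hab⟩ := hV
  have key : ∀ n : ℕ, ∀ i j, j + 1 = i → i < a + n →
      LinearMap.pdet (1 + d j i ∘ₗ (h' i j - h i j)) = 1 := by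
    intro n
    induction n with
    | zero =>
      intro i j _ hi
      have := hab i (Or.inl (by simpa using hi))
      have : (1 + d j i ∘ₗ (h' i j - h i j) : V i →ₗ[A] V i) = 1 :=
        LinearMap.ext fun x => Subsingleton.elim _ _
      rw [this, LinearMap.pdet_one]
    | succ n ih =>
      intro i j hij hi
      push_cast at hi
      obtain ⟨l, hl⟩ : ∃ l : ℤ, l + 1 = j := ⟨j - 1, by omega⟩
      obtain ⟨m, hm⟩ : ∃ m : ℤ, m + 1 = l := ⟨l - 1, by omega⟩
      set y := d l j ∘ₗ (h' j l - h j l) with hy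
      have e1 : (h' i j - h i j) ∘ₗ d j i = -y := by
        have := (hh l j i hl hij).trans (hh' l j i hl hij).symm
        rw [hy, LinearMap.sub_comp, LinearMap.comp_sub, neg_sub, sub_eq_sub_iff_add_eq_add,
          add_comm, ← this, add_comm]
      have e2 : (h' j l - h j l) ∘ₗ d l j = -(d m l ∘ₗ (h' l m - h l m)) := by
        have := (hh m l j hm hl).trans (hh' m l j hm hl).symm
        rw [LinearMap.sub_comp, LinearMap.comp_sub, neg_sub, sub_eq_sub_iff_add_eq_add,
          add_comm, ← this, add_comm]
      have e3 : y ∘ₗ y = 0 := by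
        rw [hy, LinearMap.comp_assoc, ← LinearMap.comp_assoc _ (d l j), e2, LinearMap.neg_comp,
          LinearMap.comp_neg, LinearMap.comp_assoc, ← LinearMap.comp_assoc _ (d m l), hd,
          LinearMap.zero_comp, neg_zero]
      rw [LinearMap.pdet_one_add_comp_comm, e1]
      have e4 : (1 + -y) ∘ₗ (1 + y) = 1 := by
        refine LinearMap.ext fun x => ?_
        have : y (y x) = 0 := LinearMap.congr_fun e3 x
        simp [this]
      have e5 := congrArg LinearMap.pdet e4
      rwa [LinearMap.pdet_comp, ih j l hl (by omega), mul_one, LinearMap.pdet_one] at e5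
  exact key (i - a + 1).toNat i j hij (by have := Int.self_le_toNat (i - a + 1); omega)

/-- For two contractions `h` and `h'`, the endomorphism `(d + h)(d + h')` has determinant one. -/
theorem pdet_parityMap_comp (hV : BoundedFamily V) (hd : ∀ i j k, d j k ∘ₗ d i j = 0)
    (hh : IsContraction d h) (hh' : IsContraction d h') {a b s t s' t' : ℤ → ℤ} {c : ℤ}
    (ha : ∀ i, a i = 2 * i + c) (has : ∀ i, a i + 1 = b (s i)) (hat : ∀ i, b (t i) + 1 = a i)
    (h1 : ∀ i, s' (t i) = i) (h2 : ∀ i, t' (s i) = i) (h3 : ∀ i, t' (t i) < i)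
    [Module.Finite A (⨁ i, V (a i))] [Module.Projective A (⨁ i, V (a i))] :
    LinearMap.pdet (parityMap d h b a s' t' ∘ₗ parityMap d h' a b s t) = 1 := by
  set Y := parityMap d h b a s' t' ∘ₗ parityMap d h' a b s t with hY
  -- Here `s i` and `t i` locate the degrees `a i + 1` and `a i - 1` in the other parity. The
  -- contraction identity leaves the diagonal part `d (h' - h)` and the part `h h'`, which lowers
  -- the degree by two.
  have hYlof : ∀ i (x : V (a i)), (Y - 1) (DirectSum.lof A ℤ (fun i => V (a i)) i x) =
      DirectSum.lof A ℤ (fun i => V (a i)) i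
        (d (b (t i)) (a i) ((h' (a i) (b (t i)) - h (a i) (b (t i))) x)) +
      DirectSum.lof A ℤ (fun i => V (a i)) (t' (t i))
        (h (b (t i)) (a (t' (t i))) (h' (a i) (b (t i)) x)) := by
    intro i x
    have e1 := lof_apply_congr (b := a) (fun j => h (b (s i)) j) (d (a i) (b (s i)) x) (h2 i)
    have e2 := lof_apply_congr (b := a) (fun j => d (b (t i)) j) (h' (a i) (b (t i)) x) (h1 i)
    have e3 : d (b (s i)) (a (s' (s i))) (d (a i) (b (s i)) x) = 0 :=
      LinearMap.congr_fun (hd _ _ _) x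
    have e4 := LinearMap.congr_fun (hh (b (t i)) (a i) (b (s i)) (hat i) (has i)) x
    simp only [LinearMap.add_apply, LinearMap.comp_apply, LinearMap.id_apply] at e4
    rw [LinearMap.sub_apply, hY, LinearMap.comp_apply, parityMap_lof, map_add, parityMap_lof,
      parityMap_lof, e1, e2, e3, map_zero, zero_add, Module.End.one_apply]
    conv_lhs =>
      arg 2
      rw [← e4]
    simp only [LinearMap.sub_apply, map_add, map_sub]
    abel
  have hY1 : Y = 1 + (Y - 1) := by abel
  rw [hY1]
  refine pdet_one_add_eq_one_of_triangular (V := fun i => V (a i)) (hV.comp_two_mul_add ha) _ ?_ ?_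
  · intro j i x hji
    rw [hYlof, map_add, DirectSum.component.of, DirectSum.component.of,
      dif_neg (by omega), dif_neg (by have := h3 j; omega), add_zero]
  · intro i
    rw [← pdet_one_add_d_comp_sub hV hd hh hh' (a i) (b (t i)) (hat i)]
    congr 2
    refine LinearMap.ext fun x => ?_
    rw [LinearMap.comp_apply, LinearMap.comp_apply, hYlof, map_add, DirectSum.component.lof_self,
      DirectSum.component.of, dif_neg (by have := h3 i; omega), add_zero]
    rfl

end Contraction

section Splitting

variable {A : Type*} [CommRing A] {V : ℤ → Type*} [∀ i, AddCommGroup (V i)] [∀ i, Module A (V i)]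

/-- A bounded above exact complex of projective modules has a contraction. -/
theorem exists_isContraction (hV : BoundedFamily V) [∀ i, Module.Projective A (V i)]
    (d : ∀ i j : ℤ, V i →ₗ[A] V j)
    (hex : ∀ i j k : ℤ, i + 1 = j → j + 1 = k → Function.Exact (d i j) (d j k)) :
    ∃ h : ∀ i j : ℤ, V i →ₗ[A] V j, IsContraction d h := by
  obtain ⟨_, b, hb⟩ := hV
  have hr : ∀ i j k : ℤ, i + 1 = j → j + 1 = k → LinearMap.range (d i j) = LinearMap.ker (d j k) :=
    fun i j k h1 h2 => ((LinearMap.exact_iff).mp (hex i j k h1 h2)).symm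
  -- Descending induction from the top: the image of `d i j` is the kernel of the next differential.
  -- That kernel is a direct summand because the next differential splits onto its image, so the
  -- image of `d i j` is projective.
  have key : ∀ n : ℕ, ∀ i j : ℤ, i + 1 = j → b - n < i →
      ∃ σ : LinearMap.range (d i j) →ₗ[A] V i, (d i j).rangeRestrict ∘ₗ σ = LinearMap.id := by
    intro n
    induction n with
    | zero =>
      intro i j hij hi
      have := hb j (Or.inr (by push_cast at hi; omega))
      exact ⟨0, LinearMap.ext fun x => Subtype.ext (Subsingleton.elim _ _)⟩
    | succ n ih =>
      intro i j hij hi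
      obtain ⟨σ, hσ⟩ := ih j (j + 1) rfl (by push_cast at hi; omega)
      have hproj : Module.Projective A (LinearMap.range (d i j)) := by
        rw [hr i j (j + 1) hij rfl]
        refine Module.Projective.of_split (LinearMap.ker (d j (j + 1))).subtype
          (LinearMap.codRestrict _ (LinearMap.id - σ ∘ₗ (d j (j + 1)).rangeRestrict) ?_) ?_
        · intro x
          have := congrArg Subtype.val (LinearMap.congr_fun hσ ((d j (j + 1)).rangeRestrict x))
          simp only [LinearMap.comp_apply, LinearMap.id_apply, LinearMap.codRestrict_apply,
            LinearMap.rangeRestrict] at this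
          simp [LinearMap.mem_ker, LinearMap.rangeRestrict, this]
        · refine LinearMap.ext fun x => Subtype.ext ?_
          have : (d j (j + 1)).rangeRestrict x = 0 := Subtype.ext x.2
          simp [this]
      exact Module.projective_lifting_property _ LinearMap.id (LinearMap.surjective_rangeRestrict _)
  have key' : ∀ i : ℤ, ∃ σ : LinearMap.range (d i (i + 1)) →ₗ[A] V i,
      (d i (i + 1)).rangeRestrict ∘ₗ σ = LinearMap.id := fun i =>
    key (b - i + 1).toNat i (i + 1) rfl (by have := Int.self_le_toNat (b - i + 1); omega)
  choose σ hσ using key'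
  have hσ' : ∀ i (y : LinearMap.range (d i (i + 1))), d i (i + 1) (σ i y) = y := fun i y =>
    congrArg Subtype.val (LinearMap.congr_fun (hσ i) y)
  -- The projection of `V (i + 1)` onto its boundaries, along the section of the next differential.
  let pr : ∀ i, V (i + 1) →ₗ[A] LinearMap.range (d i (i + 1)) := fun i =>
    LinearMap.codRestrict _ (LinearMap.id - σ (i + 1) ∘ₗ (d (i + 1) (i + 1 + 1)).rangeRestrict) (by
      intro x
      rw [hr i (i + 1) (i + 1 + 1) rfl rfl, LinearMap.mem_ker, LinearMap.sub_apply, map_sub,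
        LinearMap.comp_apply, hσ']
      simp [LinearMap.rangeRestrict])
  -- Only the components from `i + 1` to `i` matter; there `h` lifts the boundary part of an
  -- element. The others are set to zero.
  let h : ∀ i j : ℤ, V i →ₗ[A] V j := fun j i =>
    if hij : i + 1 = j then hij ▸ (σ i ∘ₗ pr i) else 0
  have hh : ∀ i, h (i + 1) i = σ i ∘ₗ pr i := fun i => dif_pos rfl
  refine ⟨h, ?_⟩
  rintro i j k rfl rfl
  rw [hh, hh]
  refine LinearMap.ext fun x => ?_
  have hpr : pr (i + 1) (d (i + 1) (i + 1 + 1) x) = (d (i + 1) (i + 1 + 1)).rangeRestrict x := by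
    refine Subtype.ext ?_
    have h0 : (d (i + 1 + 1) (i + 1 + 1 + 1)).rangeRestrict (d (i + 1) (i + 1 + 1) x) = 0 :=
      Subtype.ext ((hex (i + 1) (i + 1 + 1) _ rfl rfl).apply_apply_eq_zero x)
    simp [pr, h0]
  rw [LinearMap.add_apply, LinearMap.comp_apply, LinearMap.comp_apply, LinearMap.comp_apply,
    LinearMap.comp_apply, hσ', hpr]
  simp [pr]

end Splitting

/-! ### Determinants of modules and transporters -/

section IdempotentDet

variable {A : Type*} [CommRing A]

/-- As `e * e ^ n = e`, the product `e * X.det` depends only on `e • X`. -/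
theorem idempotent_mul_det_congr {e : A} (he : IsIdempotentElem e) {n : ℕ}
    {P Q : Matrix (Fin n) (Fin n) A} (h : e • P = e • Q) : e * P.det = e * Q.det := by
  have key : ∀ X : Matrix (Fin n) (Fin n) A, e * X.det = e * (e • X).det := by
    intro X
    rw [Matrix.det_smul, ← mul_assoc, Fintype.card_fin, ← pow_succ', he.pow_succ_eq]
  rw [key, h, ← key]

theorem idempotent_mul_linearMap_det_congr {e : A} (he : IsIdempotentElem e) {n : ℕ}
    {P Q : (Fin n → A) →ₗ[A] (Fin n → A)} (h : e • P = e • Q) :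
    e * LinearMap.det P = e * LinearMap.det Q := by
  rw [← LinearMap.det_toMatrix', ← LinearMap.det_toMatrix']
  refine idempotent_mul_det_congr he ?_
  rw [← map_smul, h, map_smul]

variable {W : Type*} [AddCommGroup W] [Module A W] [Module.Finite A W] [Module.Projective A W]

/-- The map `α` is the product of a part supported on the factor `e` and a part supported on `1 -
e`. The determinant of the second becomes `1` after multiplication by `e`, and the exchange identity
carries the first to `Aⁿ`. -/
theorem idempotent_mul_pdet {e : A} (he : IsIdempotentElem e) {n : ℕ}
    (s : W →ₗ[A] (Fin n → A)) (π : (Fin n → A) →ₗ[A] W)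
    (h1 : π ∘ₗ s = e • LinearMap.id) (h2 : s ∘ₗ π = e • LinearMap.id) (α : W →ₗ[A] W) :
    e * LinearMap.pdet α = e * LinearMap.det (s ∘ₗ α ∘ₗ π) := by
  have hfac : α = (1 + π ∘ₗ (s ∘ₗ (α - 1))) ∘ₗ (1 + (1 - e) • (α - 1)) := by
    have : π ∘ₗ (s ∘ₗ (α - 1)) = e • (α - 1) := by
      rw [← LinearMap.comp_assoc, h1]
      rfl
    rw [this]
    obtain ⟨β, rfl⟩ : ∃ β, α = 1 + β := ⟨α - 1, by abel⟩
    rw [add_sub_cancel_left]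
    refine LinearMap.ext fun x => ?_
    have h0 : (1 - e) • e • β (β x) = 0 := by
      rw [smul_smul, sub_mul, he, one_mul, sub_self, zero_smul]
    simp only [LinearMap.comp_apply, LinearMap.add_apply, Module.End.one_apply,
      LinearMap.smul_apply, map_add, map_smul, smul_add, h0, add_zero]
    rw [sub_smul, one_smul]
    abel
  have h3 : e * LinearMap.pdet (1 + (1 - e) • (α - 1)) = e := by
    obtain ⟨m, s', π', h'⟩ := LinearMap.exists_retraction_pi (A := A) W
    rw [LinearMap.pdet_eq_det_of_retraction s' π' h', add_sub_cancel_left,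
      idempotent_mul_linearMap_det_congr he (Q := 1), map_one, mul_one]
    refine LinearMap.ext fun x => ?_
    simp only [LinearMap.comp_apply, LinearMap.add_apply, Module.End.one_apply,
      LinearMap.smul_apply, map_smul, smul_add]
    rw [smul_smul, mul_sub, he, mul_one, sub_self, zero_smul, add_zero]
  rw [hfac, LinearMap.pdet_comp, mul_comm (LinearMap.pdet _), ← mul_assoc, h3,
    LinearMap.pdet_one_add_comp_pi, ← hfac]
  refine idempotent_mul_linearMap_det_congr he (LinearMap.ext fun x => ?_)
  have h2' : s (π x) = e • x := LinearMap.congr_fun h2 x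
  simp only [LinearMap.comp_apply, LinearMap.add_apply, Module.End.one_apply, LinearMap.sub_apply,
    LinearMap.smul_apply, map_sub, smul_add, smul_sub, h2', smul_smul, he.eq]
  abel

/-- An alternating map in `n` variables on `A ^ n` is a multiple of the determinant. -/
theorem AlternatingMap.apply_eq_det_smul {n : ℕ} {N : Type*} [AddCommGroup N] [Module A N]
    (F : (Fin n → A) [⋀^Fin n]→ₗ[A] N) (v : Fin n → Fin n → A) :
    F v = (Matrix.of v).det • F (Pi.basisFun A (Fin n)) := by
  let G : (Fin n → A) [⋀^Fin n]→ₗ[A] N :=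
    (LinearMap.toSpanSingleton A N (F (Pi.basisFun A (Fin n)))).compAlternatingMap
      Matrix.detRowAlternating
  suffices h : F = G by
    conv_lhs => rw [h]
    rfl
  refine Module.Basis.ext_alternating (Pi.basisFun A (Fin n)) fun v hv => ?_
  let σ : Equiv.Perm (Fin n) := Equiv.ofBijective v (Finite.injective_iff_bijective.mp hv)
  have hσ : (fun i => Pi.basisFun A (Fin n) (v i)) = (Pi.basisFun A (Fin n)) ∘ σ := rfl
  rw [hσ, AlternatingMap.map_perm, AlternatingMap.map_perm]
  congr 1
  change _ = Matrix.det (Matrix.of fun i => Pi.basisFun A (Fin n) i) •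
    F (Pi.basisFun A (Fin n))
  have : (Matrix.of fun i => Pi.basisFun A (Fin n) i) = 1 := by
    ext i j
    simp [Matrix.one_apply, Pi.single_apply, eq_comm]
  rw [this, Matrix.det_one, one_smul]

/-- The determinant is a linear form on the top exterior power with value `1` on the wedge of the
standard basis. -/
theorem smul_ιMulti_basisFun_injective {n : ℕ} {c : A}
    (h : c • ExteriorAlgebra.ιMulti A n (Pi.basisFun A (Fin n)) = 0) : c = 0 := by
  have h' : c • exteriorPower.ιMulti A n (Pi.basisFun A (Fin n)) = 0 := Subtype.ext h
  have := congrArg (exteriorPower.alternatingMapLinearEquiv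
    (Matrix.detRowAlternating (R := A) (n := Fin n))) h'
  rw [map_smul, exteriorPower.alternatingMapLinearEquiv_apply_ιMulti, map_zero] at this
  have h1 : Matrix.detRowAlternating (R := A) (n := Fin n) (Pi.basisFun A (Fin n)) = 1 := by
    change Matrix.det (Matrix.of fun i => Pi.basisFun A (Fin n) i) = 1
    have : (Matrix.of fun i => Pi.basisFun A (Fin n) i) = 1 := by
      ext i j
      simp [Matrix.one_apply, Pi.single_apply, eq_comm]
    rw [this, Matrix.det_one]
  rwa [h1, smul_eq_mul, mul_one] at this

theorem smul_ιMulti_smul {V : Type*} [AddCommGroup V] [Module A V] {e : A}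
    (he : IsIdempotentElem e) {n : ℕ} (v : Fin n → V) :
    e • ExteriorAlgebra.ιMulti A n (fun i => e • v i) = e • ExteriorAlgebra.ιMulti A n v := by
  have := (ExteriorAlgebra.ιMulti A n (M := V)).toMultilinearMap.map_smul_univ (fun _ => e) v
  simp only [Finset.prod_const, Finset.card_univ, Fintype.card_fin] at this
  have h2 : ExteriorAlgebra.ιMulti A n (fun i => e • v i) =
    e ^ n • ExteriorAlgebra.ιMulti A n v := this
  rw [h2, smul_smul, ← pow_succ', he.pow_succ_eq]

end IdempotentDet

section Transporter

variable {R : Type*} [CommRing R]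

theorem detModule_map_equiv {M N : Type*} [AddCommGroup M] [Module R M] [AddCommGroup N]
    [Module R N] (θ : M ≃ₗ[R] N) {x : ExteriorAlgebra R M} (hx : x ∈ detModule R M) :
    ExteriorAlgebra.map θ.toLinearMap x ∈ detModule R N := by
  unfold detModule at hx
  induction hx using Submodule.span_induction with
  | mem x hx =>
    obtain ⟨n, e, x, he, hr, hx, rfl⟩ := hx
    rw [map_smul]
    refine Submodule.subset_span ⟨n, e, _, he, fun 𝔭 h𝔭 => ?_, ?_, rfl⟩
    · rw [← Module.rankAtStalk_eq_of_equiv θ, hr 𝔭 h𝔭]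
    · rw [← ExteriorAlgebra.ιMulti_span_fixedDegree] at hx
      induction hx using Submodule.span_induction with
      | mem x hx =>
        obtain ⟨v, rfl⟩ := hx
        rw [ExteriorAlgebra.map_apply_ιMulti]
        exact ExteriorAlgebra.ιMulti_range R n ⟨_, rfl⟩
      | zero => rw [map_zero]; exact Submodule.zero_mem _
      | add x y _ _ hx hy => rw [map_add]; exact Submodule.add_mem _ hx hy
      | smul r x _ hx => rw [map_smul]; exact Submodule.smul_mem _ r hx
  | zero => rw [map_zero]; exact Submodule.zero_mem _
  | add x y _ _ hx hy => rw [map_add]; exact Submodule.add_mem _ hx hy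
  | smul r x _ hx => rw [map_smul]; exact Submodule.smul_mem _ r hx

variable {K : Type*} [CommRing K] [Algebra R K] {N W : Type*} [AddCommGroup N] [Module R N]
  [AddCommGroup W] [Module K W] [Module R W] [IsScalarTower R K W]

theorem exteriorMap_ι (f : N →ₗ[R] W) (x : N) :
    exteriorMap (K := K) f (ExteriorAlgebra.ι R x) = ExteriorAlgebra.ι K (f x) :=
  ExteriorAlgebra.lift_ι_apply R _ _ x

theorem exteriorMap_ιMulti (f : N →ₗ[R] W) {n : ℕ} (v : Fin n → N) :
    exteriorMap (K := K) f (ExteriorAlgebra.ιMulti R n v) =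
      ExteriorAlgebra.ιMulti K n (fun i => f (v i)) := by
  rw [ExteriorAlgebra.ιMulti_apply, ExteriorAlgebra.ιMulti_apply, map_list_prod, List.map_ofFn]
  congr 2
  funext i
  exact exteriorMap_ι f (v i)

theorem exteriorMap_comp {M : Type*} [AddCommGroup M] [Module R M] (θ : M →ₗ[R] N)
    (g : N →ₗ[R] W) (α : W →ₗ[K] W) (f : M →ₗ[R] W) (hf : ∀ x, f x = α (g (θ x)))
    (x : ExteriorAlgebra R M) : exteriorMap (K := K) f x =
      ExteriorAlgebra.map α (exteriorMap (K := K) g (ExteriorAlgebra.map θ x)) := by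
  have : exteriorMap (K := K) f = ((ExteriorAlgebra.map α).restrictScalars R).comp
      ((exteriorMap (K := K) g).comp (ExteriorAlgebra.map θ)) := by
    refine ExteriorAlgebra.hom_ext (LinearMap.ext fun x => ?_)
    simp [exteriorMap_ι, hf]
  rw [this]
  rfl

/-- Coordinates on the locus of rank `n`, after extension of scalars. -/
theorem exists_local_coordinates_baseChange {g : N →ₗ[R] W} (hg : IsBaseChange K g) {n : ℕ}
    {e : R} (s : N →ₗ[R] (Fin n → R)) (π : (Fin n → R) →ₗ[R] N)
    (h1 : π ∘ₗ s = e • LinearMap.id) (h2 : s ∘ₗ π = e • LinearMap.id) :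
    ∃ (s' : W →ₗ[K] (Fin n → K)) (π' : (Fin n → K) →ₗ[K] W),
      (∀ x i, s' (g x) i = algebraMap R K (s x i)) ∧
      (∀ i, π' (Pi.basisFun K (Fin n) i) = g (π (Pi.basisFun R (Fin n) i))) ∧
      π' ∘ₗ s' = algebraMap R K e • LinearMap.id ∧ s' ∘ₗ π' = algebraMap R K e • LinearMap.id := by
  let s' : W →ₗ[K] (Fin n → K) := hg.lift (((Algebra.linearMap R K).compLeft (Fin n)) ∘ₗ s)
  have hs' : ∀ x, s' (g x) = fun i => algebraMap R K (s x i) := fun x => hg.lift_eq _ x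
  let π' : (Fin n → K) →ₗ[K] W :=
    (Pi.basisFun K (Fin n)).constr K fun i => g (π (Pi.basisFun R (Fin n) i))
  have hπ' : ∀ i, π' (Pi.basisFun K (Fin n) i) = g (π (Pi.basisFun R (Fin n) i)) := fun i =>
    Module.Basis.constr_basis _ _ _ i
  have hπ'' : ∀ x : Fin n → R, π' (fun i => algebraMap R K (x i)) = g (π x) := by
    intro x
    have e1 : x = ∑ i, x i • Pi.basisFun R (Fin n) i := ((Pi.basisFun R (Fin n)).sum_repr x).symm
    have e2 : (fun i => algebraMap R K (x i)) =
        ∑ i, algebraMap R K (x i) • Pi.basisFun K (Fin n) i :=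
      ((Pi.basisFun K (Fin n)).sum_repr _).symm
    rw [e2]
    conv_rhs => rw [e1]
    simp only [map_sum, map_smul, hπ']
    simp only [algebraMap_smul]
  refine ⟨s', π', fun x i => congrFun (hs' x) i, hπ', ?_, ?_⟩
  · refine hg.algHom_ext _ _ fun x => ?_
    have := LinearMap.congr_fun h1 x
    simp only [LinearMap.comp_apply, LinearMap.smul_apply, LinearMap.id_apply] at this
    simp only [LinearMap.comp_apply, LinearMap.smul_apply, LinearMap.id_apply]
    rw [hs', hπ'', this, map_smul, algebraMap_smul]
  · refine (Pi.basisFun K (Fin n)).ext fun i => ?_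
    have := LinearMap.congr_fun h2 (Pi.basisFun R (Fin n) i)
    simp only [LinearMap.comp_apply, LinearMap.smul_apply, LinearMap.id_apply] at this
    simp only [LinearMap.comp_apply, LinearMap.smul_apply, LinearMap.id_apply]
    rw [hπ', hs', this]
    funext j
    simp [Pi.single_apply, apply_ite (algebraMap R K)]

variable [Module.Finite R N] [Module.Projective R N]
  [Finite (MaximalSpectrum R)]

/-- `Det_R(N)` is locally free of rank one, so only elements of `R` can multiply it into itself. In
coordinates on the locus of rank `n`, its image lies in the `R`-multiples of the standard wedge, and
comparing coefficients puts `b e_n` in `R`. Summing over the idempotents `e_n` gives `b`. -/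
theorem mem_range_of_smul_detModule_le {g : N →ₗ[R] W} (hg : IsBaseChange K g) (b : K)
    (hb : ∀ y ∈ detModule R N, b • exteriorMap (K := K) g y ∈
      (detModule R N).map (exteriorMap (K := K) g).toLinearMap) :
    b ∈ (1 : Submodule R K) := by
  obtain ⟨k, e, he, horth, hsum, hr⟩ := exists_rank_idempotents (R := R) N
  have key : ∀ n, b * algebraMap R K (e n) ∈ (1 : Submodule R K) := by
    intro n
    obtain ⟨s, π, h1, h2⟩ := exists_local_coordinates N n (e n) (he n) fun 𝔭 h => (hr n 𝔭).mp h
    obtain ⟨s', π', hs', hπ', h1', h2'⟩ :=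
      exists_local_coordinates_baseChange (K := K) hg s π h1 h2
    have heK : IsIdempotentElem (algebraMap R K (e n)) := (he n).map _
    obtain ⟨y, hy, hyb⟩ := hb (e n • ExteriorAlgebra.ιMulti R n fun i =>
      π (Pi.basisFun R (Fin n) i)) (Submodule.subset_span ⟨n, e n, _, he n,
        fun 𝔭 h => (hr n 𝔭).mp h, ExteriorAlgebra.ιMulti_range R n ⟨_, rfl⟩, rfl⟩)
    have claim : ∀ y ∈ detModule R N, ∃ r : R,
        ExteriorAlgebra.map s' (exteriorMap (K := K) g (e n • y)) =
          algebraMap R K r • ExteriorAlgebra.ιMulti K n (Pi.basisFun K (Fin n)) := by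
      intro y hy
      unfold detModule at hy
      induction hy using Submodule.span_induction with
      | mem y hy =>
        obtain ⟨m, e', x, he', hr', hx, rfl⟩ := hy
        by_cases hnm : m = n
        · subst hnm
          rw [smul_smul]
          rw [← ExteriorAlgebra.ιMulti_span_fixedDegree] at hx
          induction hx using Submodule.span_induction with
          | mem x hx =>
            obtain ⟨v, rfl⟩ := hx
            refine ⟨e m * e' * (Matrix.of fun i => s (v i)).det, ?_⟩
            rw [map_smul, exteriorMap_ιMulti, ← algebraMap_smul K (e m * e'), map_smul,
              ExteriorAlgebra.map_apply_ιMulti, AlternatingMap.apply_eq_det_smul, smul_smul,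
              map_mul _ (e m * e')]
            congr 2
            rw [RingHom.map_det]
            congr 1
            ext i j
            exact hs' (v i) j
          | zero => exact ⟨0, by simp⟩
          | add x y _ _ hx hy =>
            obtain ⟨r, hr⟩ := hx
            obtain ⟨r', hr'⟩ := hy
            exact ⟨r + r', by rw [smul_add, map_add, map_add, hr, hr', map_add, add_smul]⟩
          | smul t x _ hx =>
            obtain ⟨r, hr⟩ := hx
            refine ⟨t * r, ?_⟩
            rw [smul_comm, map_smul, ← algebraMap_smul K t, map_smul, hr, map_mul, mul_smul]
        · have h0 : e n * e' = 0 := by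
            refine eq_zero_of_forall_mem_prime ((he n).mul he') fun 𝔭 => ?_
            by_contra hc
            exact hnm ((hr' 𝔭 fun h => hc (Ideal.mul_mem_left _ _ h)).symm.trans
              ((hr n 𝔭).mp fun h => hc (Ideal.mul_mem_right _ _ h)))
          exact ⟨0, by rw [smul_smul, h0]; simp⟩
      | zero => exact ⟨0, by simp⟩
      | add x y _ _ hx hy =>
        obtain ⟨r, hr⟩ := hx
        obtain ⟨r', hr'⟩ := hy
        exact ⟨r + r', by rw [smul_add, map_add, map_add, hr, hr', map_add, add_smul]⟩
      | smul t x _ hx =>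
        obtain ⟨r, hr⟩ := hx
        refine ⟨t * r, ?_⟩
        rw [smul_comm, map_smul, ← algebraMap_smul K t, map_smul, hr, map_mul, mul_smul]
    obtain ⟨r, hr⟩ := claim y hy
    have h4 : exteriorMap (K := K) g y = _ := hyb
    rw [map_smul (exteriorMap (K := K) g), h4, map_smul (exteriorMap (K := K) g),
      exteriorMap_ιMulti, ← algebraMap_smul K (e n), ← algebraMap_smul K (e n), smul_comm b,
      smul_smul, heK.eq, map_smul, map_smul, ExteriorAlgebra.map_apply_ιMulti] at hr
    have h5 : (s' ∘ fun i => g (π (Pi.basisFun R (Fin n) i))) =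
        fun i => algebraMap R K (e n) • Pi.basisFun K (Fin n) i := by
      funext i
      rw [Function.comp_apply, ← hπ']
      exact LinearMap.congr_fun h2' _
    rw [h5, smul_comm, smul_ιMulti_smul heK, ← sub_eq_zero, smul_smul, ← sub_smul] at hr
    have := smul_ιMulti_basisFun_injective hr
    rw [sub_eq_zero] at this
    rw [this]
    exact Submodule.mem_one.mpr ⟨r, rfl⟩
  have : b = ∑ n ∈ Finset.range k, b * algebraMap R K (e n) := by
    rw [← Finset.mul_sum, ← map_sum, hsum, map_one, mul_one]
  rw [this]
  exact Submodule.sum_mem _ fun n _ => key n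

variable [Module.Finite K W] [Module.Projective K W]

/-- An endomorphism acts on the determinant module through its determinant. -/
theorem map_exteriorMap_of_mem_detModule {g : N →ₗ[R] W} (hg : IsBaseChange K g) (α : W →ₗ[K] W)
    {y : ExteriorAlgebra R N} (hy : y ∈ detModule R N) :
    ExteriorAlgebra.map α (exteriorMap (K := K) g y) =
      LinearMap.pdet α • exteriorMap (K := K) g y := by
  unfold detModule at hy
  induction hy using Submodule.span_induction with
  | mem y hy =>
    obtain ⟨n, e, x, he, hr, hx, rfl⟩ := hy
    rw [← ExteriorAlgebra.ιMulti_span_fixedDegree] at hx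
    induction hx using Submodule.span_induction with
    | mem x hx =>
      obtain ⟨v, rfl⟩ := hx
      obtain ⟨s, π, h1, h2⟩ := exists_local_coordinates N n e he hr
      obtain ⟨s', π', -, -, h1', h2'⟩ := exists_local_coordinates_baseChange (K := K) hg s π h1 h2
      have heK : IsIdempotentElem (algebraMap R K e) := he.map _
      rw [map_smul, exteriorMap_ιMulti, ← algebraMap_smul K e, map_smul,
        ExteriorAlgebra.map_apply_ιMulti]
      set ε := algebraMap R K e
      set F : (Fin n → K) [⋀^Fin n]→ₗ[K] ExteriorAlgebra K W :=
        (ExteriorAlgebra.ιMulti K n).compLinearMap π' with hF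
      -- On the locus of rank `n` every `n`-fold wedge is the determinant of its coordinates times
      -- one fixed wedge, so the action of `α` is read off from coordinates.
      have key : ∀ w : Fin n → W, ε • ExteriorAlgebra.ιMulti K n w =
          (ε * (Matrix.of fun i => s' (w i)).det) • F (Pi.basisFun K (Fin n)) := by
        intro w
        rw [← smul_ιMulti_smul heK, mul_smul, ← F.apply_eq_det_smul]
        change _ = ε • ExteriorAlgebra.ιMulti K n (fun i => π' (s' (w i)))
        congr 2
        funext i
        exact (LinearMap.congr_fun h1' (w i)).symm
      have e3 : (α ∘ fun i => g (v i)) = fun i => α (g (v i)) := rfl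
      rw [e3, key, key, smul_smul]
      congr 1
      have hdet : (Matrix.of fun i => (s' ∘ₗ α ∘ₗ π') (s' (g (v i)))).det =
          LinearMap.det (s' ∘ₗ α ∘ₗ π') * (Matrix.of fun i => s' (g (v i))).det := by
        rw [mul_comm, ← LinearMap.det_toMatrix', ← Matrix.det_transpose (LinearMap.toMatrix' _),
          ← Matrix.det_mul]
        congr 1
        ext i j
        have := congrFun (LinearMap.toMatrix'_mulVec (s' ∘ₗ α ∘ₗ π') (s' (g (v i)))) j
        rw [Matrix.of_apply, ← this]
        simp [Matrix.mul_apply, Matrix.mulVec, dotProduct, mul_comm]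
      have e4 : ε * (Matrix.of fun i => s' (α (g (v i)))).det =
          ε * (Matrix.of fun i => (s' ∘ₗ α ∘ₗ π') (s' (g (v i)))).det := by
        refine idempotent_mul_det_congr heK ?_
        ext i j
        have hps : π' (s' (g (v i))) = ε • g (v i) := LinearMap.congr_fun h1' _
        simp only [Matrix.smul_apply, Matrix.of_apply, LinearMap.comp_apply, hps, map_smul,
          Pi.smul_apply, smul_smul, heK.eq]
      rw [e4, hdet, ← mul_assoc, ← mul_assoc, ← idempotent_mul_pdet heK s' π' h1' h2',
        mul_comm ε (LinearMap.pdet α)]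
    | zero => simp
    | add x y _ _ hx hy => simp only [smul_add, map_add, hx, hy]
    | smul r x _ hx =>
      rw [smul_comm, map_smul, ← algebraMap_smul K r, map_smul, hx, smul_comm]
  | zero => simp
  | add x y _ _ hx hy => simp only [smul_add, map_add, hx, hy]
  | smul r x _ hx => rw [map_smul, ← algebraMap_smul K r, map_smul, hx, smul_comm]

/-- The transporter between determinant modules is generated by the inverse of a determinant. -/
theorem mem_detTransporter_iff {M : Type*} [AddCommGroup M] [Module R M] {g : N →ₗ[R] W}
    (hg : IsBaseChange K g) (θ : M ≃ₗ[R] N) (α : W →ₗ[K] W) (f : M →ₗ[R] W)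
    (hf : ∀ x, f x = α (g (θ x))) (a : K) :
    a ∈ detTransporter K f g ↔ a * LinearMap.pdet α ∈ (1 : Submodule R K) := by
  have key : ∀ x ∈ detModule R M, a • exteriorMap (K := K) f x =
      (a * LinearMap.pdet α) • exteriorMap (K := K) g (ExteriorAlgebra.map θ.toLinearMap x) := by
    intro x hx
    rw [exteriorMap_comp θ.toLinearMap g α f hf,
      map_exteriorMap_of_mem_detModule hg α (detModule_map_equiv θ hx), smul_smul]
  constructor
  · intro ha
    refine mem_range_of_smul_detModule_le hg _ fun y hy => ?_
    have hx := detModule_map_equiv θ.symm hy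
    have := ha _ hx
    rw [key _ hx] at this
    have e1 : ExteriorAlgebra.map θ.toLinearMap (ExteriorAlgebra.map θ.symm.toLinearMap y) = y := by
      have := ExteriorAlgebra.map_comp_map θ.symm.toLinearMap θ.toLinearMap
      rw [LinearEquiv.comp_coe, LinearEquiv.symm_trans_self, LinearEquiv.refl_toLinearMap,
        ExteriorAlgebra.map_id] at this
      exact DFunLike.congr_fun this y
    rwa [e1] at this
  · intro ha x hx
    obtain ⟨r, hr⟩ := Submodule.mem_one.mp ha
    change a • exteriorMap (K := K) f x ∈ _
    rw [key x hx, ← hr, algebraMap_smul, ← map_smul]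
    exact ⟨_, Submodule.smul_mem _ r (detModule_map_equiv θ hx), rfl⟩

end Transporter

/-! ### Relative determinants -/

section SplitExact

variable {A : Type*} [CommRing A]

/-- The maps `i, q, p, j` exhibit `Y` as the direct sum of `X` and `Z`. -/
structure SplitExact {X Y Z : Type*} [AddCommGroup X] [Module A X] [AddCommGroup Y] [Module A Y]
    [AddCommGroup Z] [Module A Z] (i : X →ₗ[A] Y) (q : Y →ₗ[A] X) (p : Y →ₗ[A] Z)
    (j : Z →ₗ[A] Y) : Prop where
  q_i : ∀ x, q (i x) = x
  p_j : ∀ z, p (j z) = z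
  p_i : ∀ x, p (i x) = 0
  sum : ∀ y, i (q y) + j (p y) = y

namespace SplitExact

variable {X Y Z : Type*} [AddCommGroup X] [Module A X] [AddCommGroup Y] [Module A Y]
  [AddCommGroup Z] [Module A Z] {i : X →ₗ[A] Y} {q : Y →ₗ[A] X} {p : Y →ₗ[A] Z} {j : Z →ₗ[A] Y}

theorem q_j (h : SplitExact i q p j) (z : Z) : q (j z) = 0 := by
  have h1 := h.sum (j z)
  rw [h.p_j, add_eq_right] at h1
  rw [← h.q_i (q (j z)), h1, map_zero]

theorem baseChange (h : SplitExact i q p j) (K : Type*) [CommRing K] [Algebra A K] :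
    SplitExact (i.baseChange K) (q.baseChange K) (p.baseChange K) (j.baseChange K) where
  q_i x := by
    have : q ∘ₗ i = LinearMap.id := LinearMap.ext h.q_i
    rw [← LinearMap.comp_apply, ← LinearMap.baseChange_comp, this, LinearMap.baseChange_id]
    rfl
  p_j x := by
    have : p ∘ₗ j = LinearMap.id := LinearMap.ext h.p_j
    rw [← LinearMap.comp_apply, ← LinearMap.baseChange_comp, this, LinearMap.baseChange_id]
    rfl
  p_i x := by
    have : p ∘ₗ i = 0 := LinearMap.ext h.p_i
    rw [← LinearMap.comp_apply, ← LinearMap.baseChange_comp, this, LinearMap.baseChange_zero]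
    rfl
  sum x := by
    have : i ∘ₗ q + j ∘ₗ p = LinearMap.id := LinearMap.ext h.sum
    rw [← LinearMap.comp_apply, ← LinearMap.comp_apply, ← LinearMap.add_apply,
      ← LinearMap.baseChange_comp, ← LinearMap.baseChange_comp, ← LinearMap.baseChange_add, this,
      LinearMap.baseChange_id]
    rfl

theorem directSum {X Y Z : ℤ → Type*} [∀ n, AddCommGroup (X n)] [∀ n, Module A (X n)]
    [∀ n, AddCommGroup (Y n)] [∀ n, Module A (Y n)] [∀ n, AddCommGroup (Z n)]
    [∀ n, Module A (Z n)] {i : ∀ n, X n →ₗ[A] Y n} {q : ∀ n, Y n →ₗ[A] X n}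
    {p : ∀ n, Y n →ₗ[A] Z n} {j : ∀ n, Z n →ₗ[A] Y n}
    (h : ∀ n, SplitExact (i n) (q n) (p n) (j n)) :
    SplitExact (DirectSum.lmap i) (DirectSum.lmap q) (DirectSum.lmap p) (DirectSum.lmap j) where
  q_i _ := DFinsupp.ext fun n => (h n).q_i _
  p_j _ := DFinsupp.ext fun n => (h n).p_j _
  p_i _ := DFinsupp.ext fun n => (h n).p_i _
  sum _ := DFinsupp.ext fun n => (h n).sum _

/-- The isomorphism of direct sums induced by isomorphisms of the summands. -/
noncomputable def congr {X' Y' Z' : Type*} [AddCommGroup X'] [Module A X'] [AddCommGroup Y']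
    [Module A Y'] [AddCommGroup Z'] [Module A Z'] {i' : X' →ₗ[A] Y'} {q' : Y' →ₗ[A] X'}
    {p' : Y' →ₗ[A] Z'} {j' : Z' →ₗ[A] Y'} (h : SplitExact i q p j) (h' : SplitExact i' q' p' j')
    (θX : X ≃ₗ[A] X') (θZ : Z ≃ₗ[A] Z') : Y ≃ₗ[A] Y' :=
  LinearEquiv.ofLinearMap (i' ∘ₗ θX.toLinearMap ∘ₗ q + j' ∘ₗ θZ.toLinearMap ∘ₗ p)
    (i ∘ₗ θX.symm.toLinearMap ∘ₗ q' + j ∘ₗ θZ.symm.toLinearMap ∘ₗ p')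
    (LinearMap.ext fun y => by simp [h.q_i, h.q_j, h.p_i, h.p_j, h'.sum])
    (LinearMap.ext fun y => by simp [h'.q_i, h'.q_j, h'.p_i, h'.p_j, h.sum])

theorem congr_symm_apply {X' Y' Z' : Type*} [AddCommGroup X'] [Module A X'] [AddCommGroup Y']
    [Module A Y'] [AddCommGroup Z'] [Module A Z'] {i' : X' →ₗ[A] Y'} {q' : Y' →ₗ[A] X'}
    {p' : Y' →ₗ[A] Z'} {j' : Z' →ₗ[A] Y'} (h : SplitExact i q p j) (h' : SplitExact i' q' p' j')
    (θX : X ≃ₗ[A] X') (θZ : Z ≃ₗ[A] Z') (y : Y') :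
    (h.congr h' θX θZ).symm y = i (θX.symm (q' y)) + j (θZ.symm (p' y)) := rfl

end SplitExact

end SplitExact

/-! ### Contracting homotopies and extensions of complexes -/

section Naturality

variable {A : Type*} [CommRing A] {V V' : ℤ → Type*} [∀ i, AddCommGroup (V i)]
  [∀ i, Module A (V i)] [∀ i, AddCommGroup (V' i)] [∀ i, Module A (V' i)]

theorem parityMap_naturality {d h : ∀ i j : ℤ, V i →ₗ[A] V j} {d' h' : ∀ i j : ℤ, V' i →ₗ[A] V' j}
    {a b s t : ℤ → ℤ} (has : ∀ i, a i + 1 = b (s i)) (hat : ∀ i, b (t i) + 1 = a i)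
    (φ : ∀ i, V i →ₗ[A] V' i) (hd : ∀ i j x, i + 1 = j → φ j (d i j x) = d' i j (φ i x))
    (hh : ∀ i j x, i + 1 = j → φ i (h j i x) = h' j i (φ j x)) (x : ⨁ i, V (a i)) :
    DirectSum.lmap (fun i => φ (b i)) (parityMap d h a b s t x) =
      parityMap d' h' a b s t (DirectSum.lmap (fun i => φ (a i)) x) := by
  suffices H : DirectSum.lmap (fun i => φ (b i)) ∘ₗ parityMap d h a b s t =
      parityMap d' h' a b s t ∘ₗ DirectSum.lmap (fun i => φ (a i)) from LinearMap.congr_fun H x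
  refine DirectSum.linearMap_ext _ fun i => LinearMap.ext fun x => ?_
  simp only [LinearMap.comp_apply, parityMap_lof, map_add, DirectSum.lmap_lof,
    hd _ _ _ (has i), hh _ _ _ (hat i)]

variable {X Y Z : ℤ → Type*} [∀ i, AddCommGroup (X i)] [∀ i, Module A (X i)]
  [∀ i, AddCommGroup (Y i)] [∀ i, Module A (Y i)] [∀ i, AddCommGroup (Z i)] [∀ i, Module A (Z i)]

/-- A contraction of an extension of complexes which is compatible with given contractions of the
two ends. -/
theorem exists_isContraction_of_splitExact {i : ∀ n, X n →ₗ[A] Y n} {q : ∀ n, Y n →ₗ[A] X n}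
    {p : ∀ n, Y n →ₗ[A] Z n} {j : ∀ n, Z n →ₗ[A] Y n}
    (hs : ∀ n, SplitExact (i n) (q n) (p n) (j n)) {dX hX : ∀ m n : ℤ, X m →ₗ[A] X n}
    {dY : ∀ m n : ℤ, Y m →ₗ[A] Y n} {dZ hZ : ∀ m n : ℤ, Z m →ₗ[A] Z n}
    (hi : ∀ m n x, i n (dX m n x) = dY m n (i m x))
    (hp : ∀ m n y, p n (dY m n y) = dZ m n (p m y)) (hd : ∀ l m n y, dY m n (dY l m y) = 0)
    (cX : IsContraction dX hX) (cZ : IsContraction dZ hZ) :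
    ∃ hY : ∀ m n : ℤ, Y m →ₗ[A] Y n, IsContraction dY hY ∧
      (∀ m n x, i n (hX m n x) = hY m n (i m x)) ∧
      (∀ m n y, p n (hY m n y) = hZ m n (p m y)) := by
  -- In the decomposition `Y = X ⊕ Z` the differential has the off-diagonal entry `τ = q d j`. The
  -- diagonal homotopy given by `hX` and `hZ` is corrected by the entry `-hX τ hZ`.
  let hY : ∀ m n : ℤ, Y m →ₗ[A] Y n := fun m n =>
    i n ∘ₗ hX m n ∘ₗ q m + j n ∘ₗ hZ m n ∘ₗ p m -
      i n ∘ₗ hX m n ∘ₗ q m ∘ₗ dY n m ∘ₗ j n ∘ₗ hZ m n ∘ₗ p m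
  have hhY : ∀ m n y, hY m n y = i n (hX m n (q m y)) + j n (hZ m n (p m y)) -
      i n (hX m n (q m (dY n m (j n (hZ m n (p m y)))))) := fun m n y => rfl
  refine ⟨hY, ?_, ?_, ?_⟩
  · intro l m n h1 h2
    refine LinearMap.ext fun y => ?_
    rw [LinearMap.add_apply, LinearMap.comp_apply, LinearMap.comp_apply, LinearMap.id_apply,
      hhY, hhY]
    have ecX : ∀ x, dX l m (hX m l x) + hX n m (dX m n x) = x := fun x =>
      LinearMap.congr_fun (cX l m n h1 h2) x
    have ecZ : ∀ x, dZ l m (hZ m l x) + hZ n m (dZ m n x) = x := fun x =>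
      LinearMap.congr_fun (cZ l m n h1 h2) x
    have dj : ∀ a b z, dY a b (j a z) = i b (q b (dY a b (j a z))) + j b (dZ a b z) :=
      fun a b z => by
      conv_lhs => rw [← (hs b).sum (dY a b (j a z)), hp, (hs a).p_j]
    have qd : ∀ a b y, q b (dY a b y) = dX a b (q a y) + q b (dY a b (j a (p a y))) :=
      fun a b y => by
      conv_lhs => rw [← (hs a).sum y, map_add, map_add, ← hi, (hs b).q_i]
    -- The off-diagonal entry of `d² = 0`: `τ dZ = -dX τ`.
    have τ0 : ∀ a b c z, q c (dY b c (j b (dZ a b z))) = - dX b c (q b (dY a b (j a z))) := by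
      intro a b c z
      have := congrArg (q c) (hd a b c (j a z))
      rw [dj a b z, map_add, map_add, ← hi, (hs c).q_i, map_zero] at this
      rw [eq_neg_iff_add_eq_zero, add_comm, this]
    have e1 : dY l m (i l (hX m l (q m y))) = i m (dX l m (hX m l (q m y))) := (hi _ _ _).symm
    have e2 : dY l m (i l (hX m l (q m (dY l m (j l (hZ m l (p m y))))))) =
      i m (dX l m (hX m l (q m (dY l m (j l (hZ m l (p m y))))))) := (hi _ _ _).symm
    rw [map_sub, map_add, e1, e2]
    have e3 : dX l m (hX m l (q m y)) = q m y - hX n m (dX m n (q m y)) := by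
      rw [eq_sub_iff_add_eq, ecX]
    set τ1 := q m (dY l m (j l (hZ m l (p m y)))) with hτ1
    have e4 : dX l m (hX m l τ1) = τ1 - hX n m (dX m n τ1) := by rw [eq_sub_iff_add_eq, ecX]
    rw [e4, dj l m, ← hτ1, hp, qd m n]
    have e5 : dZ l m (hZ m l (p m y)) = p m y - hZ n m (dZ m n (p m y)) := by
      rw [eq_sub_iff_add_eq, ecZ]
    have e6 : hZ n m (dZ m n (p m y)) = p m y - dZ l m (hZ m l (p m y)) := by
      rw [eq_sub_iff_add_eq, add_comm, ecZ]
    have e7 : q n (dY m n (j m (hZ n m (dZ m n (p m y))))) =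
        q n (dY m n (j m (p m y))) + dX m n τ1 := by
      rw [e6]
      simp only [map_sub]
      rw [τ0, ← hτ1, sub_neg_eq_add]
    rw [e3, e7, e5]
    have e8 := (hs m).sum y
    simp only [map_sub, map_add]
    rw [← sub_eq_zero, ← sub_eq_zero.mpr e8]
    abel
  · intro m n x
    rw [hhY, (hs m).q_i, (hs m).p_i]
    simp
  · intro m n y
    rw [hhY]
    simp [(hs n).p_i, (hs n).p_j]

end Naturality

/-! ### Determinants of maps with respect to lattices -/

section RelDet

variable {R K : Type*} [CommRing R] [CommRing K] [Algebra R K]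

theorem LinearMap.isUnit_pdet_of_comp_eq_one {W : Type*} [AddCommGroup W] [Module R W]
    [Module.Finite R W] [Module.Projective R W] {f g : W →ₗ[R] W} (h : f ∘ₗ g = 1) :
    IsUnit (LinearMap.pdet f) :=
  IsUnit.of_mul_eq_one (LinearMap.pdet g) (by rw [← LinearMap.pdet_comp, h, LinearMap.pdet_one])

variable {M N W : Type*} [AddCommGroup M] [Module R M] [AddCommGroup N] [Module R N]
  [AddCommGroup W] [Module R W] [Module K W]
  [IsScalarTower R K W] [Module.Finite K W] [Module.Projective K W] {g : N →ₗ[R] W}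

/-- The determinant of a map `M → W` with respect to an isomorphism of `M` with a lattice `N`. -/
noncomputable def relDet (hg : IsBaseChange K g) (θ : M ≃ₗ[R] N) (f : M →ₗ[R] W) : K :=
  LinearMap.pdet (hg.lift (f ∘ₗ θ.symm.toLinearMap))

theorem mem_detTransporter_iff_relDet [Finite (MaximalSpectrum R)] [Module.Finite R N]
    [Module.Projective R N] (hg : IsBaseChange K g)
    (θ : M ≃ₗ[R] N) (f : M →ₗ[R] W) (a : K) :
    a ∈ detTransporter K f g ↔ a * relDet hg θ f ∈ (1 : Submodule R K) :=
  mem_detTransporter_iff hg θ _ f (fun x => by simp [hg.lift_eq]) a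

theorem relDet_comp (hg : IsBaseChange K g) (θ : M ≃ₗ[R] N) (f f' : M →ₗ[R] W) (β : W →ₗ[K] W)
    (h : ∀ x, f' x = β (f x)) : relDet hg θ f' = LinearMap.pdet β * relDet hg θ f := by
  unfold relDet
  rw [← LinearMap.pdet_comp]
  congr 1
  refine hg.algHom_ext _ _ fun x => ?_
  simp [hg.lift_eq, h]

/-- Two isomorphisms differ by an automorphism of the lattice `N`, whose determinant is a unit of
`R`. -/
theorem relDet_change [Module.Finite R N] [Module.Projective R N]
    (hg : IsBaseChange K g) (θ θ' : M ≃ₗ[R] N) (f : M →ₗ[R] W) :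
    ∃ r : R, IsUnit r ∧ relDet hg θ' f = relDet hg θ f * algebraMap R K r := by
  refine ⟨LinearMap.pdet (θ.toLinearMap ∘ₗ θ'.symm.toLinearMap),
    LinearMap.isUnit_pdet_of_comp_eq_one (g := θ'.toLinearMap ∘ₗ θ.symm.toLinearMap)
      (LinearMap.ext fun x => by simp), ?_⟩
  have := LinearMap.pdet_isBaseChange hg (θ.toLinearMap ∘ₗ θ'.symm.toLinearMap)
    (hg.lift (g ∘ₗ θ.toLinearMap ∘ₗ θ'.symm.toLinearMap)) (fun x => hg.lift_eq _ x)
  rw [← this]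
  unfold relDet
  rw [← LinearMap.pdet_comp]
  congr 1
  refine hg.algHom_ext _ _ fun x => ?_
  simp [hg.lift_eq]

theorem relDet_self (hg : IsBaseChange K g) (θ : M ≃ₗ[R] N) (f : M →ₗ[R] W)
    (h : ∀ x, f x = g (θ x)) : relDet hg θ f = 1 := by
  unfold relDet
  rw [← LinearMap.pdet_one (A := K) (W := W)]
  congr 1
  refine hg.algHom_ext _ _ fun x => ?_
  simp [hg.lift_eq, h]

/-- An inverse is the determinant of `v` followed by the extension to `V` of `g ∘ θ`: in the product
the lattices cancel, leaving `pdet (u ∘ v) = 1`. -/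
theorem isUnit_relDet (hg : IsBaseChange K g) (θ : M ≃ₗ[R] N) {V : Type*} [AddCommGroup V]
    [Module R V] [Module K V] [IsScalarTower R K V] {f₀ : M →ₗ[R] V} (hf₀ : IsBaseChange K f₀)
    (u : V →ₗ[K] W) (v : W →ₗ[K] V) (huv : LinearMap.pdet (u ∘ₗ v) = 1) (f : M →ₗ[R] W)
    (hf : ∀ x, f x = u (f₀ x)) : IsUnit (relDet hg θ f) := by
  refine IsUnit.of_mul_eq_one (LinearMap.pdet (hf₀.lift (g ∘ₗ θ.toLinearMap) ∘ₗ v)) ?_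
  unfold relDet
  rw [← LinearMap.pdet_comp, ← huv, ← LinearMap.comp_assoc]
  congr 2
  refine hf₀.algHom_ext _ _ fun x => ?_
  simp [hg.lift_eq, hf₀.lift_eq, hf]

variable {M' N' W' : Type*} [AddCommGroup M'] [Module R M'] [AddCommGroup N'] [Module R N']
  [AddCommGroup W'] [Module R W'] [Module K W']
  [IsScalarTower R K W'] [Module.Finite K W'] [Module.Projective K W'] {g' : N' →ₗ[R] W'}
  {M'' N'' W'' : Type*} [AddCommGroup M''] [Module R M''] [AddCommGroup N''] [Module R N'']
  [AddCommGroup W''] [Module R W'']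
  [Module K W''] [IsScalarTower R K W''] [Module.Finite K W''] [Module.Projective K W'']
  {g'' : N'' →ₗ[R] W''}

/-- For the isomorphism assembled from `θ'` and `θ''`, the extension of `f ∘ θ⁻¹` to `W` is block
triangular, with the corresponding maps of `W'` and `W''` on the diagonal. -/
theorem relDet_splitExact (hg' : IsBaseChange K g') (hg : IsBaseChange K g)
    (hg'' : IsBaseChange K g'') {iM : M' →ₗ[R] M} {qM : M →ₗ[R] M'} {pM : M →ₗ[R] M''}
    {jM : M'' →ₗ[R] M} (hM : SplitExact iM qM pM jM) {iN : N' →ₗ[R] N} {qN : N →ₗ[R] N'}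
    {pN : N →ₗ[R] N''} {jN : N'' →ₗ[R] N} (hN : SplitExact iN qN pN jN) {iW : W' →ₗ[K] W}
    {qW : W →ₗ[K] W'} {pW : W →ₗ[K] W''} {jW : W'' →ₗ[K] W} (hW : SplitExact iW qW pW jW)
    (hi : ∀ x, iW (g' x) = g (iN x)) (hp : ∀ x, pW (g x) = g'' (pN x))
    (θ' : M' ≃ₗ[R] N') (θ'' : M'' ≃ₗ[R] N'') (f' : M' →ₗ[R] W') (f : M →ₗ[R] W)
    (f'' : M'' →ₗ[R] W'') (hf' : ∀ x, f (iM x) = iW (f' x)) (hf'' : ∀ x, pW (f x) = f'' (pM x)) :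
    relDet hg (hM.congr hN θ' θ'') f = relDet hg' θ' f' * relDet hg'' θ'' f'' := by
  refine LinearMap.pdet_eq_mul_of_split iW qW pW jW (LinearMap.ext hW.q_i) (LinearMap.ext hW.p_j)
    (LinearMap.ext hW.p_i) (LinearMap.ext hW.sum) _ _ _ ?_ ?_
  · refine hg'.algHom_ext _ _ fun x => ?_
    simp [hg'.lift_eq, hi, hg.lift_eq, SplitExact.congr_symm_apply, hN.q_i, hN.p_i, hf']
  · refine hg.algHom_ext _ _ fun x => ?_
    simp [hg''.lift_eq, hp, hg.lift_eq, SplitExact.congr_symm_apply, hf'', hM.p_i, hM.p_j]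

end RelDet

/-! ### Determinants of generically exact complexes -/

section ParityDet

variable {R K : Type*} [CommRing R] [CommRing K] [Algebra R K] {L V : ℤ → Type*}
  [∀ i, AddCommGroup (L i)] [∀ i, Module R (L i)] [∀ i, AddCommGroup (V i)] [∀ i, Module R (V i)]
  [∀ i, Module K (V i)] [∀ i, IsScalarTower R K (V i)]

/-- The map `d + h` from the odd part to the even part. -/
noncomputable abbrev oddToEvenMap (d h : ∀ i j : ℤ, V i →ₗ[K] V j) :
    (⨁ i, V (2 * i + 1)) →ₗ[K] ⨁ i, V (2 * i) :=
  parityMap d h (fun i => 2 * i + 1) (fun i => 2 * i) (fun i => i + 1) (fun i => i)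

/-- The map `d + h` from the even part to the odd part. -/
noncomputable abbrev evenToOddMap (d h : ∀ i j : ℤ, V i →ₗ[K] V j) :
    (⨁ i, V (2 * i)) →ₗ[K] ⨁ i, V (2 * i + 1) :=
  parityMap d h (fun i => 2 * i) (fun i => 2 * i + 1) (fun i => i) (fun i => i - 1)

/-- The base change map of the even parts. -/
noncomputable abbrev evenMap (g : ∀ i, L i →ₗ[R] V i) : (⨁ i, L (2 * i)) →ₗ[R] ⨁ i, V (2 * i) :=
  DirectSum.lmap fun i => g (2 * i)

/-- The base change map of the odd parts. -/
noncomputable abbrev oddMap (g : ∀ i, L i →ₗ[R] V i) :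
    (⨁ i, L (2 * i + 1)) →ₗ[R] ⨁ i, V (2 * i + 1) :=
  DirectSum.lmap fun i => g (2 * i + 1)

section

variable [∀ i, Module.Finite K (V i)] [∀ i, Module.Projective K (V i)]
  {d h h' : ∀ i j : ℤ, V i →ₗ[K] V j}

theorem pdet_oddToEvenMap_comp_evenToOddMap [Module.Finite K (⨁ i, V (2 * i))]
    [Module.Projective K (⨁ i, V (2 * i))] (hV : BoundedFamily V)
    (hd : ∀ i j k, d j k ∘ₗ d i j = 0) (hh : IsContraction d h) (hh' : IsContraction d h') :
    LinearMap.pdet (oddToEvenMap d h ∘ₗ evenToOddMap d h') = 1 :=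
  pdet_parityMap_comp hV hd hh hh' (c := 0) (fun i => by ring) (fun i => by ring)
    (fun i => by ring) (fun i => by ring) (fun i => rfl) (fun i => by omega)

theorem pdet_evenToOddMap_comp_oddToEvenMap [Module.Finite K (⨁ i, V (2 * i + 1))]
    [Module.Projective K (⨁ i, V (2 * i + 1))] (hV : BoundedFamily V)
    (hd : ∀ i j k, d j k ∘ₗ d i j = 0) (hh : IsContraction d h) (hh' : IsContraction d h') :
    LinearMap.pdet (evenToOddMap d h ∘ₗ oddToEvenMap d h') = 1 :=
  pdet_parityMap_comp hV hd hh hh' (c := 1) (fun i => by ring) (fun i => by ring)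
    (fun i => by ring) (fun i => rfl) (fun i => by ring) (fun i => by omega)

/-- Both composites with the map from even to odd have determinant `1`, hence are bijective. -/
theorem oddToEvenMap_bijective (hV : BoundedFamily V) (hd : ∀ i j k, d j k ∘ₗ d i j = 0)
    (hh : IsContraction d h) : Function.Bijective (oddToEvenMap d h) := by
  have : Module.Finite K (⨁ i, V (2 * i + 1)) :=
    (hV.comp_two_mul_add (a := fun i => 2 * i + 1) (c := 1) fun i => rfl).finite_directSum
  have : Module.Projective K (⨁ i, V (2 * i + 1)) := projective_directSum
  have : Module.Finite K (⨁ i, V (2 * i)) :=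
    (hV.comp_two_mul_add (a := fun i => 2 * i) (c := 0) fun i => by ring).finite_directSum
  have : Module.Projective K (⨁ i, V (2 * i)) := projective_directSum
  have h1 := LinearMap.bijective_of_isUnit_pdet
    ((pdet_oddToEvenMap_comp_evenToOddMap hV hd hh hh).symm ▸ isUnit_one)
  have h2 := LinearMap.bijective_of_isUnit_pdet
    ((pdet_evenToOddMap_comp_oddToEvenMap hV hd hh hh).symm ▸ isUnit_one)
  rw [LinearMap.coe_comp] at h1 h2
  exact ⟨h2.1.of_comp, h1.2.of_comp⟩

end

/-- The determinant of `d + h` with respect to an isomorphism between the odd part and the even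
part of a complex. -/
noncomputable def parityDet [Module.Finite K (⨁ i, V (2 * i))]
    [Module.Projective K (⨁ i, V (2 * i))] {g : ∀ i, L i →ₗ[R] V i}
    (hg : ∀ i, IsBaseChange K (g i)) (θ : (⨁ i, L (2 * i + 1)) ≃ₗ[R] ⨁ i, L (2 * i))
    (d h : ∀ i j : ℤ, V i →ₗ[K] V j) : K :=
  relDet (IsBaseChange.directSum fun i => hg (2 * i) : IsBaseChange K (evenMap g)) θ
    ((oddToEvenMap d h).restrictScalars R ∘ₗ oddMap g)

/-- The element `x` of `K` is a determinant of the generically exact complex given by the lattices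
`g i : L i → V i` and the differentials `d`. -/
def HasParityDet {g : ∀ i, L i →ₗ[R] V i} (hg : ∀ i, IsBaseChange K (g i))
    (d : ∀ i j : ℤ, V i →ₗ[K] V j) (x : K) : Prop :=
  ∃ (_ : Module.Finite K (⨁ i, V (2 * i))) (_ : Module.Projective K (⨁ i, V (2 * i)))
    (h : ∀ i j : ℤ, V i →ₗ[K] V j) (θ : (⨁ i, L (2 * i + 1)) ≃ₗ[R] ⨁ i, L (2 * i)),
    IsContraction d h ∧ parityDet hg θ d h = x

variable [∀ i, Module.Finite K (V i)] [∀ i, Module.Projective K (V i)]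

/-- Over `K` the map `d + h` identifies the two parts, so their rank functions agree, and these
determine projective modules over a semilocal ring. -/
theorem nonempty_odd_equiv_even {g : ∀ i, L i →ₗ[R] V i} (hg : ∀ i, IsBaseChange K (g i))
    {d : ∀ i j : ℤ, V i →ₗ[K] V j} [IsFractionRing R K] [Finite (MaximalSpectrum R)]
    [∀ i, Module.Finite R (L i)] [∀ i, Module.Projective R (L i)] (hL : BoundedFamily L)
    (hV : BoundedFamily V) (hd : ∀ i j k, d j k ∘ₗ d i j = 0) {h : ∀ i j : ℤ, V i →ₗ[K] V j}
    (hh : IsContraction d h) : Nonempty ((⨁ i, L (2 * i + 1)) ≃ₗ[R] ⨁ i, L (2 * i)) := by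
  have : Module.Finite R (⨁ i, L (2 * i + 1)) :=
    (hL.comp_two_mul_add (a := fun i => 2 * i + 1) (c := 1) fun i => rfl).finite_directSum
  have : Module.Projective R (⨁ i, L (2 * i + 1)) := projective_directSum
  have : Module.Finite R (⨁ i, L (2 * i)) :=
    (hL.comp_two_mul_add (a := fun i => 2 * i) (c := 0) fun i => by ring).finite_directSum
  have : Module.Projective R (⨁ i, L (2 * i)) := projective_directSum
  have : Module.Finite K (⨁ i, V (2 * i)) :=
    (hV.comp_two_mul_add (a := fun i => 2 * i) (c := 0) fun i => by ring).finite_directSum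
  have : Module.Projective K (⨁ i, V (2 * i)) := projective_directSum
  exact nonempty_linearEquiv_of_rankAtStalk_eq _ _ <|
    rankAtStalk_eq_of_isBaseChange_fractionRing (K := K) (f := oddMap g) (g := evenMap g)
      (IsBaseChange.directSum fun i => hg (2 * i + 1)) (IsBaseChange.directSum fun i => hg (2 * i))
      (LinearEquiv.ofBijective _ (oddToEvenMap_bijective hV hd hh))

namespace HasParityDet

variable {g : ∀ i, L i →ₗ[R] V i} {hg : ∀ i, IsBaseChange K (g i)} {d : ∀ i j : ℤ, V i →ₗ[K] V j}

theorem isUnit {x : K} (hV : BoundedFamily V) (hd : ∀ i j k, d j k ∘ₗ d i j = 0)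
    (hx : HasParityDet hg d x) : IsUnit x := by
  obtain ⟨_, _, h, θ, hh, rfl⟩ := hx
  exact isUnit_relDet (g := evenMap g) (f₀ := oddMap g) _ θ
    (IsBaseChange.directSum fun i => hg (2 * i + 1)) (oddToEvenMap d h)
    (evenToOddMap d h) (pdet_oddToEvenMap_comp_evenToOddMap hV hd hh hh) _ fun _ => rfl

/-- A change of `θ` costs a unit of `R`; a change of `h` costs nothing. -/
theorem exists_parityDet_eq [∀ i, Module.Finite R (L i)] [∀ i, Module.Projective R (L i)]
    (hL : BoundedFamily L) (hV : BoundedFamily V) (hd : ∀ i j k, d j k ∘ₗ d i j = 0)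
    [Module.Finite K (⨁ i, V (2 * i))] [Module.Projective K (⨁ i, V (2 * i))] {x : K}
    (hx : HasParityDet hg d x) {h : ∀ i j : ℤ, V i →ₗ[K] V j} (hh : IsContraction d h)
    (θ : (⨁ i, L (2 * i + 1)) ≃ₗ[R] ⨁ i, L (2 * i)) :
    ∃ r : R, IsUnit r ∧ parityDet hg θ d h = x * algebraMap R K r := by
  obtain ⟨_, _, h', θ', hh', rfl⟩ := hx
  have : Module.Finite R (⨁ i, L (2 * i)) :=
    (hL.comp_two_mul_add (a := fun i => 2 * i) (c := 0) fun i => by ring).finite_directSum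
  have : Module.Projective R (⨁ i, L (2 * i)) := projective_directSum
  obtain ⟨r, hr, e⟩ := relDet_change
    (IsBaseChange.directSum fun i => hg (2 * i) : IsBaseChange K (evenMap g)) θ' θ
    ((oddToEvenMap d h).restrictScalars R ∘ₗ oddMap g)
  refine ⟨r, hr, ?_⟩
  rw [parityDet, e]
  congr 1
  let ε := LinearEquiv.ofBijective _ (oddToEvenMap_bijective hV hd hh')
  -- Composed with the same `evenToOddMap d h'`, the maps `d + h` and `d + h'` both have determinant
  -- `1`; hence so does their quotient.
  have h1 : LinearMap.pdet (oddToEvenMap d h ∘ₗ ε.symm.toLinearMap) = 1 := by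
    have h1 := pdet_oddToEvenMap_comp_evenToOddMap hV hd hh hh'
    have h2 : oddToEvenMap d h ∘ₗ evenToOddMap d h' =
        (oddToEvenMap d h ∘ₗ ε.symm.toLinearMap) ∘ₗ (oddToEvenMap d h' ∘ₗ evenToOddMap d h') :=
      LinearMap.ext fun x => congrArg (oddToEvenMap d h) (ε.symm_apply_apply _).symm
    rwa [h2, LinearMap.pdet_comp, pdet_oddToEvenMap_comp_evenToOddMap hV hd hh' hh',
      mul_one] at h1
  rw [← one_mul (parityDet _ _ _ _), ← h1]
  exact relDet_comp _ θ' _ _ _ fun x => congrArg (oddToEvenMap d h) (ε.symm_apply_apply _).symm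

theorem exists_eq_mul [∀ i, Module.Finite R (L i)] [∀ i, Module.Projective R (L i)]
    (hL : BoundedFamily L) (hV : BoundedFamily V) (hd : ∀ i j k, d j k ∘ₗ d i j = 0) {x y : K}
    (hx : HasParityDet hg d x) (hy : HasParityDet hg d y) :
    ∃ r : R, IsUnit r ∧ y = x * algebraMap R K r := by
  obtain ⟨_, _, h, θ, hh, rfl⟩ := hy
  exact hx.exists_parityDet_eq hL hV hd hh θ

theorem mem_detTransporter_iff [Finite (MaximalSpectrum R)] [∀ i, Module.Finite R (L i)]
    [∀ i, Module.Projective R (L i)] (hL : BoundedFamily L) (hV : BoundedFamily V)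
    (hd : ∀ i j k, d j k ∘ₗ d i j = 0) {x : K} (hx : HasParityDet hg d x)
    {h : ∀ i j : ℤ, V i →ₗ[K] V j} (hh : IsContraction d h) (a : K) :
    a ∈ detTransporter K ((oddToEvenMap d h).restrictScalars R ∘ₗ oddMap g) (evenMap g) ↔
      a * x ∈ (1 : Submodule R K) := by
  obtain ⟨_, _, h', θ, hh', rfl⟩ := id hx
  have : Module.Finite R (⨁ i, L (2 * i)) :=
    (hL.comp_two_mul_add (a := fun i => 2 * i) (c := 0) fun i => by ring).finite_directSum
  have : Module.Projective R (⨁ i, L (2 * i)) := projective_directSum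
  obtain ⟨r, hr, e⟩ := hx.exists_parityDet_eq hL hV hd hh θ
  rw [mem_detTransporter_iff_relDet
    (IsBaseChange.directSum fun i => hg (2 * i) : IsBaseChange K (evenMap g)) θ]
  change a * parityDet hg θ d h ∈ _ ↔ _
  rw [e]
  obtain ⟨r, rfl⟩ := hr
  constructor
  · intro h1
    have := Submodule.smul_mem _ (↑r⁻¹ : R) h1
    rwa [Algebra.smul_def, mul_comm, mul_assoc, mul_assoc, ← map_mul, Units.mul_inv, map_one,
      mul_one] at this
  · intro h1
    have := Submodule.smul_mem _ (r : R) h1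
    rwa [Algebra.smul_def, mul_comm, mul_assoc] at this

/-- A complex which is exact before localisation has trivial determinant. -/
theorem one_of_isContraction [∀ i, Module.Finite R (L i)] [∀ i, Module.Projective R (L i)]
    (hL : BoundedFamily L) (hV : BoundedFamily V) {d₀ h₀ : ∀ i j : ℤ, L i →ₗ[R] L j}
    (hd₀ : ∀ i j k, d₀ j k ∘ₗ d₀ i j = 0) (hh₀ : IsContraction d₀ h₀)
    {h : ∀ i j : ℤ, V i →ₗ[K] V j} (hd : ∀ i j x, g j (d₀ i j x) = d i j (g i x))
    (hh : ∀ i j x, g j (h₀ i j x) = h i j (g i x)) : HasParityDet hg d 1 := by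
  have : Module.Finite K (⨁ i, V (2 * i)) :=
    (hV.comp_two_mul_add (a := fun i => 2 * i) (c := 0) fun i => by ring).finite_directSum
  have : Module.Projective K (⨁ i, V (2 * i)) := projective_directSum
  have : Module.Finite R (⨁ i, L (2 * i)) :=
    (hL.comp_two_mul_add (a := fun i => 2 * i) (c := 0) fun i => by ring).finite_directSum
  have : Module.Projective R (⨁ i, L (2 * i)) := projective_directSum
  have hc : IsContraction d h := by
    intro i j k hij hjk
    refine (hg j).algHom_ext _ _ fun x => ?_
    rw [LinearMap.add_apply, LinearMap.comp_apply, LinearMap.comp_apply, ← hh, ← hd, ← hd, ← hh,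
      ← map_add]
    exact congrArg (g j) (LinearMap.congr_fun (hh₀ i j k hij hjk) x)
  -- The map `d₀ + h₀` is already an isomorphism over `R`, and is taken as `θ`.
  refine ⟨inferInstance, inferInstance, h,
    LinearEquiv.ofBijective _ (oddToEvenMap_bijective hL hd₀ hh₀), hc, ?_⟩
  refine relDet_self _ _ _ fun x => ?_
  suffices H : (oddToEvenMap d h).restrictScalars R ∘ₗ oddMap g =
      evenMap g ∘ₗ oddToEvenMap d₀ h₀ from LinearMap.congr_fun H x
  refine DirectSum.linearMap_ext _ fun i => LinearMap.ext fun x => ?_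
  simp only [LinearMap.comp_apply, parityMap_lof, map_add, DirectSum.lmap_lof, hd, hh,
    LinearMap.coe_restrictScalars]
  exact parityMap_lof d h _ _ _ _ _ _

end HasParityDet

end ParityDet

/-! ### Multiplicativity in extensions of complexes -/

section ParityDetSplit

variable {R K : Type*} [CommRing R] [CommRing K] [Algebra R K] {L V L' V' L'' V'' : ℤ → Type*}
  [∀ i, AddCommGroup (L i)] [∀ i, Module R (L i)] [∀ i, AddCommGroup (V i)] [∀ i, Module R (V i)]
  [∀ i, Module K (V i)] [∀ i, IsScalarTower R K (V i)]
  [∀ i, AddCommGroup (L' i)] [∀ i, Module R (L' i)] [∀ i, AddCommGroup (V' i)]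
  [∀ i, Module R (V' i)] [∀ i, Module K (V' i)] [∀ i, IsScalarTower R K (V' i)]
  [∀ i, AddCommGroup (L'' i)] [∀ i, Module R (L'' i)] [∀ i, AddCommGroup (V'' i)]
  [∀ i, Module R (V'' i)] [∀ i, Module K (V'' i)] [∀ i, IsScalarTower R K (V'' i)]
  [∀ i, Module.Finite K (V i)] [∀ i, Module.Projective K (V i)]
  {g : ∀ i, L i →ₗ[R] V i} {hg : ∀ i, IsBaseChange K (g i)} {d : ∀ i j : ℤ, V i →ₗ[K] V j}
  {g' : ∀ i, L' i →ₗ[R] V' i} {hg' : ∀ i, IsBaseChange K (g' i)}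
  {d' : ∀ i j : ℤ, V' i →ₗ[K] V' j}
  {g'' : ∀ i, L'' i →ₗ[R] V'' i} {hg'' : ∀ i, IsBaseChange K (g'' i)}
  {d'' : ∀ i j : ℤ, V'' i →ₗ[K] V'' j}

/-- The determinant of a complex is multiplicative in short exact sequences. -/
theorem HasParityDet.of_splitExact (hV : BoundedFamily V) (hd : ∀ i j k v, d j k (d i j v) = 0)
    {iL : ∀ n, L' n →ₗ[R] L n} {qL : ∀ n, L n →ₗ[R] L' n} {pL : ∀ n, L n →ₗ[R] L'' n}
    {jL : ∀ n, L'' n →ₗ[R] L n} (hL : ∀ n, SplitExact (iL n) (qL n) (pL n) (jL n))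
    {iV : ∀ n, V' n →ₗ[K] V n} {qV : ∀ n, V n →ₗ[K] V' n} {pV : ∀ n, V n →ₗ[K] V'' n}
    {jV : ∀ n, V'' n →ₗ[K] V n} (hS : ∀ n, SplitExact (iV n) (qV n) (pV n) (jV n))
    (hi : ∀ n x, iV n (g' n x) = g n (iL n x)) (hp : ∀ n x, pV n (g n x) = g'' n (pL n x))
    (hid : ∀ m n x, iV n (d' m n x) = d m n (iV m x))
    (hpd : ∀ m n x, pV n (d m n x) = d'' m n (pV m x))
    {x z : K} (hx : HasParityDet hg' d' x) (hz : HasParityDet hg'' d'' z) :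
    HasParityDet hg d (x * z) := by
  obtain ⟨_, _, h', θ', hh', rfl⟩ := hx
  obtain ⟨_, _, h'', θ'', hh'', rfl⟩ := hz
  have : Module.Finite K (⨁ i, V (2 * i)) :=
    (hV.comp_two_mul_add (a := fun i => 2 * i) (c := 0) fun i => by ring).finite_directSum
  have : Module.Projective K (⨁ i, V (2 * i)) := projective_directSum
  obtain ⟨h, hh, hih, hph⟩ := exists_isContraction_of_splitExact hS hid hpd hd hh' hh''
  refine ⟨inferInstance, inferInstance, h,
    (SplitExact.directSum fun n => hL (2 * n + 1)).congr
      (SplitExact.directSum fun n => hL (2 * n)) θ' θ'', hh, ?_⟩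
  refine relDet_splitExact (g := evenMap g) (g' := evenMap g') (g'' := evenMap g'') _ _ _ _ _
    (SplitExact.directSum fun n => hS (2 * n)) ?_ ?_ _ _ _ _ _ ?_ ?_
  · intro x
    exact DFinsupp.ext fun n => hi _ _
  · intro x
    exact DFinsupp.ext fun n => hp _ _
  · intro x
    have h1 : oddMap g (DirectSum.lmap (fun n => iL (2 * n + 1)) x) =
        DirectSum.lmap (fun n => iV (2 * n + 1)) (oddMap g' x) :=
      DFinsupp.ext fun n => (hi _ _).symm
    change oddToEvenMap d h (oddMap g _) = DirectSum.lmap _ (oddToEvenMap d' h' (oddMap g' x))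
    rw [h1]
    exact (parityMap_naturality (fun i => by ring) (fun i => rfl) iV (fun i j x _ => hid i j x)
      (fun i j x _ => hih j i x) _).symm
  · intro x
    have h1 : oddMap g'' (DirectSum.lmap (fun n => pL (2 * n + 1)) x) =
        DirectSum.lmap (fun n => pV (2 * n + 1)) (oddMap g x) :=
      DFinsupp.ext fun n => (hp _ _).symm
    change DirectSum.lmap _ (oddToEvenMap d h (oddMap g x)) = oddToEvenMap d'' h'' (oddMap g'' _)
    rw [h1]
    exact parityMap_naturality (fun i => by ring) (fun i => rfl) pV (fun i j x _ => hpd i j x)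
      (fun i j x _ => hph j i x) _

end ParityDetSplit

/-! ### Determinants of perfect complexes -/

section PerfectDet

variable {R : Type u} [CommRing R] {F : CochainComplex (ModuleCat.{u} R) ℤ}

namespace IsPerfectComplex

theorem boundedFamily (hF : IsPerfectComplex F) : BoundedFamily fun i => F.X i := by
  obtain ⟨a, b, h⟩ := hF.bounded
  exact ⟨a, b, fun i hi => ModuleCat.subsingleton_of_isZero (h i hi)⟩

theorem boundedFamily_fracTerm (hF : IsPerfectComplex F) : BoundedFamily (FracTerm F) := by
  obtain ⟨a, b, h⟩ := hF.boundedFamily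
  exact ⟨a, b, fun i hi => have := h i hi; inferInstance⟩

end IsPerfectComplex

theorem fracDiff_comp_fracDiff (i j k : ℤ) : fracDiff F j k ∘ₗ fracDiff F i j = 0 := by
  unfold fracDiff
  rw [← LinearMap.baseChange_comp, ← ModuleCat.hom_comp, F.d_comp_d, ModuleCat.hom_zero,
    LinearMap.baseChange_zero]

/-- The base change maps from the terms of a complex to the terms over the ring of fractions. -/
noncomputable abbrev toFrac (F : CochainComplex (ModuleCat.{u} R) ℤ) (i : ℤ) :
    F.X i →ₗ[R] FracTerm F i :=
  TensorProduct.mk R (FractionRing R) (F.X i) 1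

theorem isBaseChange_toFrac (F : CochainComplex (ModuleCat.{u} R) ℤ) (i : ℤ) :
    IsBaseChange (FractionRing R) (toFrac F i) :=
  TensorProduct.isBaseChange R (F.X i) (FractionRing R)

/-- The element `x` of `Frac(R)` is a determinant of the complex `F`. -/
def HasDet (F : CochainComplex (ModuleCat.{u} R) ℤ) (x : FractionRing R) : Prop :=
  HasParityDet (isBaseChange_toFrac F) (fracDiff F) x

namespace HasDet

theorem exists_of_fracContraction [Finite (MaximalSpectrum R)] (hF : IsPerfectComplex F)
    (c : FracContraction F) : ∃ x, HasDet F x := by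
  have := hF.finite
  have := hF.projective
  have hV := hF.boundedFamily_fracTerm
  have : Module.Finite (FractionRing R) (⨁ i, FracTerm F (2 * i)) :=
    (hV.comp_two_mul_add (a := fun i => 2 * i) (c := 0) fun i => by ring).finite_directSum
  have : Module.Projective (FractionRing R) (⨁ i, FracTerm F (2 * i)) := projective_directSum
  obtain ⟨θ⟩ := nonempty_odd_equiv_even (isBaseChange_toFrac F) hF.boundedFamily
    hV fracDiff_comp_fracDiff c.comm
  exact ⟨_, inferInstance, inferInstance, c.h, θ, c.comm, rfl⟩

theorem isUnit (hF : IsPerfectComplex F) {x : FractionRing R} (hx : HasDet F x) : IsUnit x := by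
  have := hF.finite
  have := hF.projective
  exact HasParityDet.isUnit hF.boundedFamily_fracTerm fracDiff_comp_fracDiff hx

theorem exists_eq_mul (hF : IsPerfectComplex F) {x y : FractionRing R} (hx : HasDet F x)
    (hy : HasDet F y) : ∃ r : R, IsUnit r ∧ y = x * algebraMap R _ r := by
  have := hF.finite
  have := hF.projective
  exact HasParityDet.exists_eq_mul hF.boundedFamily hF.boundedFamily_fracTerm
    fracDiff_comp_fracDiff hx hy

theorem mem_det_iff [Finite (MaximalSpectrum R)] (hF : IsPerfectComplex F) {x : FractionRing R}
    (hx : HasDet F x) (c : FracContraction F) (a : FractionRing R) :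
    a ∈ c.det ↔ a * x ∈ (1 : Submodule R (FractionRing R)) := by
  have := hF.finite
  have := hF.projective
  exact HasParityDet.mem_detTransporter_iff hF.boundedFamily hF.boundedFamily_fracTerm
    fracDiff_comp_fracDiff hx c.comm a

theorem one_of_exact (hF : IsPerfectComplex F)
    (hex : ∀ i j k : ℤ, i + 1 = j → j + 1 = k → Function.Exact (F.d i j).hom (F.d j k).hom) :
    HasDet F 1 := by
  have := hF.finite
  have := hF.projective
  obtain ⟨h, hh⟩ := exists_isContraction hF.boundedFamily (fun i j => (F.d i j).hom) hex
  refine HasParityDet.one_of_isContraction hF.boundedFamily hF.boundedFamily_fracTerm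
    (d₀ := fun i j => (F.d i j).hom) (fun i j k => ?_) hh
    (h := fun i j => (h i j).baseChange (FractionRing R)) (fun i j x => rfl) fun i j x => rfl
  rw [← ModuleCat.hom_comp, F.d_comp_d, ModuleCat.hom_zero]

/-- The determinant is multiplicative in termwise split short exact sequences of complexes. -/
theorem of_splitting {S : ShortComplex (CochainComplex (ModuleCat.{u} R) ℤ)}
    (h₂ : IsPerfectComplex S.X₂)
    (σ : ∀ n, (S.map (HomologicalComplex.eval _ _ n)).Splitting) {x z : FractionRing R}
    (hx : HasDet S.X₁ x) (hz : HasDet S.X₃ z) : HasDet S.X₂ (x * z) := by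
  have := h₂.finite
  have := h₂.projective
  have hL : ∀ n, SplitExact (S.f.f n).hom (σ n).r.hom (S.g.f n).hom (σ n).s.hom := fun n =>
    { q_i := fun y => ConcreteCategory.congr_hom (σ n).f_r y
      p_j := fun y => ConcreteCategory.congr_hom (σ n).s_g y
      p_i := fun y => ConcreteCategory.congr_hom (S.map (HomologicalComplex.eval _ _ n)).zero y
      sum := fun y => ConcreteCategory.congr_hom (σ n).id y }
  refine HasParityDet.of_splitExact h₂.boundedFamily_fracTerm
    (fun i j k v => LinearMap.congr_fun (fracDiff_comp_fracDiff i j k) v) hL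
    (fun n => (hL n).baseChange _) (fun n x => rfl) (fun n x => rfl) ?_ ?_ hx hz
  · intro m n y
    rw [fracDiff, fracDiff, ← LinearMap.comp_apply, ← LinearMap.comp_apply,
      ← LinearMap.baseChange_comp, ← LinearMap.baseChange_comp, ← ModuleCat.hom_comp,
      ← ModuleCat.hom_comp, S.f.comm]
  · intro m n y
    rw [fracDiff, fracDiff, ← LinearMap.comp_apply, ← LinearMap.comp_apply,
      ← LinearMap.baseChange_comp, ← LinearMap.baseChange_comp, ← ModuleCat.hom_comp,
      ← ModuleCat.hom_comp, S.g.comm]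

end HasDet

end PerfectDet

/-! ### Torsion modules and perfect complexes with torsion cohomology -/

section Torsion

/-- Torsion along `ι : S → R` is the same as being torsion over `R`. -/
def TorsionCompatible {S R : Type u} [CommRing S] [CommRing R] (ι : S →+* R) : Prop :=
  ∀ (M : Type u) [AddCommGroup M] [Module R M], IsTorsionAlong ι M ↔ Module.IsTorsion R M

variable {R : Type u} [CommRing R]

theorem Module.IsTorsion.of_linearEquiv {M N : Type*} [AddCommGroup M] [Module R M]
    [AddCommGroup N] [Module R N] (e : M ≃ₗ[R] N) (h : Module.IsTorsion R M) :
    Module.IsTorsion R N := by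
  intro x
  obtain ⟨a, ha⟩ := @h (e.symm x)
  refine ⟨a, e.symm.injective ?_⟩
  rw [map_zero, ← ha]
  exact map_smul e.symm (a : R) x

theorem isTorsion_of_exact {S : ShortComplex (ModuleCat.{u} R)} (hS : S.Exact)
    (h₁ : Module.IsTorsion R S.X₁) (h₃ : Module.IsTorsion R S.X₃) : Module.IsTorsion R S.X₂ := by
  rw [ShortComplex.moduleCat_exact_iff] at hS
  intro x
  obtain ⟨a, ha⟩ := @h₃ (S.g x)
  obtain ⟨y, hy⟩ := hS ((a : R) • x) ((map_smul S.g.hom (a : R) x).trans ha)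
  obtain ⟨b, hb⟩ := @h₁ y
  refine ⟨b * a, ?_⟩
  change ((b : R) * a) • x = 0
  rw [mul_smul, ← hy]
  exact (map_smul S.f.hom (b : R) y).symm.trans ((congrArg S.f.hom hb).trans (map_zero _))

/-- The elementwise form of torsion cohomology, suited to clearing denominators over `Frac(R)`. -/
theorem isTorsion_homology_iff (F : CochainComplex (ModuleCat.{u} R) ℤ) {i j k : ℤ}
    (hij : i + 1 = j) (hjk : j + 1 = k) : Module.IsTorsion R (F.homology j) ↔
      ∀ y : F.X j, (F.d j k).hom y = 0 →
        ∃ (a : nonZeroDivisors R) (x : F.X i), (F.d i j).hom x = (a : R) • y := by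
  let τ : F.X i →ₗ[R] LinearMap.ker (F.d j k).hom := (F.sc' i j k).moduleCatToCycles
  have e : F.homology j ≃ₗ[R] (LinearMap.ker (F.d j k).hom ⧸
      LinearMap.range τ) :=
    (F.homologyIsoSc' i j k (by simp [← hij]) (by simp [hjk]) ≪≫
      (F.sc' i j k).moduleCatHomologyIso).toLinearEquiv
  have hmem : ∀ (a : R) (y : LinearMap.ker (F.d j k).hom),
      a • (LinearMap.range τ).mkQ y = 0 ↔
      ∃ x : F.X i, (F.d i j).hom x = a • (y : F.X j) := by
    intro a y
    rw [← map_smul, Submodule.mkQ_apply, Submodule.Quotient.mk_eq_zero]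
    exact ⟨fun ⟨x, hx⟩ => ⟨x, congrArg Subtype.val hx⟩, fun ⟨x, hx⟩ => ⟨x, Subtype.ext hx⟩⟩
  constructor
  · intro h y hy
    have h' := h.of_linearEquiv e
    obtain ⟨a, ha⟩ := @h' (Submodule.Quotient.mk ⟨y, hy⟩)
    exact ⟨a, (hmem _ _).mp ha⟩
  · intro h
    refine Module.IsTorsion.of_linearEquiv e.symm fun {y} => ?_
    obtain ⟨y, rfl⟩ := Submodule.Quotient.mk_surjective _ y
    obtain ⟨a, x, hx⟩ := h y.1 y.2
    exact ⟨a, (hmem _ _).mpr ⟨x, hx⟩⟩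

theorem exact_of_exactAt {F : CochainComplex (ModuleCat.{u} R) ℤ} {i j k : ℤ}
    (hij : i + 1 = j) (hjk : j + 1 = k) (h : F.ExactAt j) :
    Function.Exact (F.d i j).hom (F.d j k).hom := by
  rw [F.exactAt_iff' i j k (by simp [← hij]) (by simp [hjk]), ShortComplex.moduleCat_exact_iff] at h
  intro y
  refine ⟨fun hy => h y hy, ?_⟩
  rintro ⟨x, rfl⟩
  exact ConcreteCategory.congr_hom (F.d_comp_d i j k) x

end Torsion

/-! ### Permanence properties of perfect complexes -/

namespace IsPerfectComplex

variable {R : Type u} [CommRing R] {F : CochainComplex (ModuleCat.{u} R) ℤ}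

/-- A cycle over `Frac(R)` becomes integral after clearing denominators, a boundary after
multiplication by a further nonzerodivisor, and these factors are invertible in `Frac(R)`. The
resulting bounded exact complex of projectives splits. -/
theorem nonempty_fracContraction (hF : IsPerfectComplex F)
    (h : ∀ i, Module.IsTorsion R (F.homology i)) : Nonempty (FracContraction F) := by
  have := hF.finite
  have := hF.projective
  have key : ∀ i j k : ℤ, i + 1 = j → j + 1 = k →
      Function.Exact (fracDiff F i j) (fracDiff F j k) := by
    intro i j k hij hjk
    have hloc := fun i => (isLocalizedModule_iff_isBaseChange (nonZeroDivisors R)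
      (FractionRing R) (toFrac F i)).mpr (isBaseChange_toFrac F i)
    intro v
    constructor
    · intro hv
      obtain ⟨⟨y, s⟩, hys⟩ := IsLocalizedModule.surj (nonZeroDivisors R) (toFrac F j) v
      have h1 : toFrac F k ((F.d j k).hom y) = 0 := by
        change fracDiff F j k (toFrac F j y) = 0
        rw [← hys]
        refine ((fracDiff F j k).map_smul_of_tower (s : R) v).trans ?_
        rw [hv, smul_zero]
      -- So far `d y` vanishes only over `Frac(R)`; the factor `t` makes it vanish in `F` itself.
      obtain ⟨t, ht⟩ := (IsLocalizedModule.eq_zero_iff (nonZeroDivisors R) (toFrac F k)).mp h1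
      obtain ⟨a, x, hx⟩ := (isTorsion_homology_iff F hij hjk).mp (h j) ((t : R) • y)
        ((map_smul (F.d j k).hom (t : R) y).trans ht)
      have hu : IsUnit (algebraMap R (FractionRing R) (a * t * s : nonZeroDivisors R)) :=
        IsLocalization.map_units _ _
      obtain ⟨r, hr⟩ := hu.exists_left_inv
      refine ⟨r • toFrac F i x, ?_⟩
      rw [map_smul]
      change r • toFrac F j ((F.d i j).hom x) = v
      have hys' : toFrac F j y = (s : R) • v := hys.symm
      rw [hx, map_smul, map_smul, hys', smul_smul, smul_smul,
        ← algebraMap_smul (FractionRing R) ((a : R) * t * s), smul_smul]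
      exact (congrArg (· • v) hr).trans (one_smul _ v)
    · rintro ⟨x, rfl⟩
      exact LinearMap.congr_fun (fracDiff_comp_fracDiff i j k) x
  obtain ⟨c, hc⟩ := exists_isContraction hF.boundedFamily_fracTerm (fracDiff F) key
  exact ⟨c, hc⟩

theorem of_splitting {S : ShortComplex (CochainComplex (ModuleCat.{u} R) ℤ)}
    (σ : ∀ n, (S.map (HomologicalComplex.eval _ _ n)).Splitting) (h₁ : IsPerfectComplex S.X₁)
    (h₃ : IsPerfectComplex S.X₃) : IsPerfectComplex S.X₂ := by
  have := h₁.finite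
  have := h₁.projective
  have := h₃.finite
  have := h₃.projective
  let α : ∀ n, S.X₁.X n × S.X₃.X n →ₗ[R] S.X₂.X n := fun n =>
    LinearMap.coprod (S.f.f n).hom (σ n).s.hom
  let β : ∀ n, S.X₂.X n →ₗ[R] S.X₁.X n × S.X₃.X n := fun n =>
    LinearMap.prod (σ n).r.hom (S.g.f n).hom
  have key : ∀ n y, α n (β n y) = y := fun n y => ConcreteCategory.congr_hom (σ n).id y
  refine ⟨?_, fun n => ?_, fun n => ?_⟩
  · obtain ⟨a, b, h⟩ := h₁.bounded
    obtain ⟨a', b', h'⟩ := h₃.bounded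
    refine ⟨min a a', max b b', fun i hi => ?_⟩
    have h1 := ModuleCat.subsingleton_of_isZero (h i (by omega))
    have h2 := ModuleCat.subsingleton_of_isZero (h' i (by omega))
    refine @ModuleCat.isZero_of_subsingleton _ _ _ ⟨fun x y => ?_⟩
    rw [← key i x, ← key i y, Subsingleton.elim (β i x) (β i y)]
  · exact Module.Finite.of_surjective (α n) fun y => ⟨_, key n y⟩
  · exact Module.Projective.of_split (β n) (α n) (LinearMap.ext (key n))

theorem shift (hF : IsPerfectComplex F) (n : ℤ) : IsPerfectComplex (F⟦n⟧) := by
  refine ⟨?_, fun i => hF.finite (i + n), fun i => hF.projective (i + n)⟩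
  obtain ⟨a, b, h⟩ := hF.bounded
  exact ⟨a - n, b - n, fun i hi => h (i + n) (by omega)⟩

open CochainComplex in
theorem mappingCone {G : CochainComplex (ModuleCat.{u} R) ℤ} (hF : IsPerfectComplex F)
    (hG : IsPerfectComplex G) (f : F ⟶ G) : IsPerfectComplex (mappingCone f) :=
  of_splitting (S := mappingCone.triangleRotateShortComplex f)
    (mappingCone.triangleRotateShortComplexSplitting f) hG (hF.shift 1)

/-- This allows morphisms out of `F` in the derived category to be represented by maps of complexes.
-/
theorem isKProjective (hF : IsPerfectComplex F) : F.IsKProjective := by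
  obtain ⟨a, b, h⟩ := hF.bounded
  have : F.IsStrictlyLE b := by
    rw [CochainComplex.isStrictlyLE_iff]
    exact fun i hi => h i (Or.inr hi)
  have : ∀ n, Projective (F.X n) := fun n => by
    have := hF.projective n
    exact (IsProjective.iff_projective (R := R) (F.X n)).mp this
  exact CochainComplex.isKProjective_of_projective F b

end IsPerfectComplex

theorem isTorsion_homology_shift {R : Type u} [CommRing R]
    {F : CochainComplex (ModuleCat.{u} R) ℤ} (h : ∀ i, Module.IsTorsion R (F.homology i))
    (n i : ℤ) : Module.IsTorsion R ((F⟦n⟧).homology i) :=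
  (h (n + i)).of_linearEquiv
    (((HomologicalComplex.homologyFunctor (ModuleCat.{u} R) (ComplexShape.up ℤ) 0).shiftIso n i
      (n + i) rfl).app F).toLinearEquiv.symm

/-! ### The determinant on the Grothendieck group -/

section DetClass

variable {R : Type u} [CommRing R]

/-- The invertible ideal generated by a unit of the ring of fractions. -/
noncomputable def principalUnit (R : Type u) [CommRing R] :
    (FractionRing R)ˣ →* InvertibleIdeals R :=
  Units.map
    { toFun := FractionalIdeal.spanSingleton (nonZeroDivisors R)
      map_one' := FractionalIdeal.spanSingleton_one
      map_mul' := fun x y => by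
        rw [FractionalIdeal.spanSingleton_mul_spanSingleton] }

theorem coe_principalUnit (x : (FractionRing R)ˣ) :
    ((principalUnit R x : InvertibleIdeals R) :
      FractionalIdeal (nonZeroDivisors R) (FractionRing R)) =
      FractionalIdeal.spanSingleton _ (x : FractionRing R) := rfl

theorem principalUnit_eq_one {x : (FractionRing R)ˣ} {r : R} (hr : IsUnit r)
    (hx : (x : FractionRing R) = algebraMap R _ r) : principalUnit R x = 1 := by
  refine Units.ext ?_
  rw [coe_principalUnit, hx, Units.val_one]
  obtain ⟨r, rfl⟩ := hr
  refine le_antisymm ?_ ?_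
  · rw [FractionalIdeal.spanSingleton_le_iff_mem]
    exact FractionalIdeal.coe_mem_one _ _
  · rw [← FractionalIdeal.spanSingleton_one, FractionalIdeal.spanSingleton_le_iff_mem,
      FractionalIdeal.mem_spanSingleton]
    exact ⟨↑r⁻¹, by rw [Algebra.smul_def, ← map_mul, Units.inv_mul, map_one]⟩

open Classical in
/-- The determinant of a perfect complex which is generically exact, as an invertible ideal. -/
noncomputable def detClass (F : CochainComplex (ModuleCat.{u} R) ℤ) : InvertibleIdeals R :=
  if h : ∃ x : (FractionRing R)ˣ, HasDet F x then (principalUnit R h.choose)⁻¹ else 1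

variable {F G : CochainComplex (ModuleCat.{u} R) ℤ}

theorem HasDet.detClass_eq (hF : IsPerfectComplex F) {x : (FractionRing R)ˣ}
    (hx : HasDet F (x : FractionRing R)) : detClass F = (principalUnit R x)⁻¹ := by
  have h : ∃ x : (FractionRing R)ˣ, HasDet F x := ⟨x, hx⟩
  rw [detClass, dif_pos h]
  congr 1
  obtain ⟨r, hr, e⟩ := HasDet.exists_eq_mul hF hx h.choose_spec
  rw [← mul_inv_eq_one, ← map_inv, ← map_mul]
  refine principalUnit_eq_one hr ?_
  rw [Units.val_mul, e, mul_right_comm, Units.mul_inv, one_mul]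

theorem exists_hasDet [Finite (MaximalSpectrum R)] (hF : IsPerfectComplex F)
    (ht : ∀ i, Module.IsTorsion R (F.homology i)) :
    ∃ x : (FractionRing R)ˣ, HasDet F (x : FractionRing R) := by
  obtain ⟨c⟩ := hF.nonempty_fracContraction ht
  obtain ⟨x, hx⟩ := HasDet.exists_of_fracContraction hF c
  obtain ⟨x, rfl⟩ := HasDet.isUnit hF hx
  exact ⟨x, hx⟩

theorem coe_detClass [Finite (MaximalSpectrum R)] (hF : IsPerfectComplex F)
    (ht : ∀ i, Module.IsTorsion R (F.homology i)) (c : FracContraction F) :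
    ((detClass F : FractionalIdeal (nonZeroDivisors R) (FractionRing R)) :
      Submodule R (FractionRing R)) = c.det := by
  obtain ⟨x, hx⟩ := exists_hasDet hF ht
  rw [hx.detClass_eq hF, ← map_inv, coe_principalUnit]
  ext a
  rw [hx.mem_det_iff hF, FractionalIdeal.mem_coe, FractionalIdeal.mem_spanSingleton,
    Submodule.mem_one]
  refine exists_congr fun r => ?_
  rw [Algebra.smul_def, Units.mul_inv_eq_iff_eq_mul]

theorem detClass_of_splitting [Finite (MaximalSpectrum R)]
    {S : ShortComplex (CochainComplex (ModuleCat.{u} R) ℤ)}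
    (σ : ∀ n, (S.map (HomologicalComplex.eval _ _ n)).Splitting) (h₁ : IsPerfectComplex S.X₁)
    (h₃ : IsPerfectComplex S.X₃) (ht₁ : ∀ i, Module.IsTorsion R (S.X₁.homology i))
    (ht₃ : ∀ i, Module.IsTorsion R (S.X₃.homology i)) :
    detClass S.X₂ = detClass S.X₁ * detClass S.X₃ := by
  obtain ⟨x, hx⟩ := exists_hasDet h₁ ht₁
  obtain ⟨z, hz⟩ := exists_hasDet h₃ ht₃
  have h₂ := IsPerfectComplex.of_splitting σ h₁ h₃
  have h : HasDet S.X₂ ((x * z : (FractionRing R)ˣ) : FractionRing R) :=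
    HasDet.of_splitting h₂ σ hx hz
  rw [h.detClass_eq h₂, hx.detClass_eq h₁, hz.detClass_eq h₃, map_mul, mul_inv]

theorem detClass_of_acyclic (hF : IsPerfectComplex F) (h : F.Acyclic) : detClass F = 1 := by
  have : HasDet F ((1 : (FractionRing R)ˣ) : FractionRing R) :=
    HasDet.one_of_exact hF fun _ j _ hij hjk => exact_of_exactAt hij hjk (h j)
  rw [this.detClass_eq hF, map_one, inv_one]

end DetClass

/-! ### Determinants of mapping cones -/

section Cone

open CochainComplex DerivedCategory Pretriangulated

theorem acyclic_of_isZero_Q {C : Type*} [Category C] [Abelian C] [HasDerivedCategory C]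
    {K : CochainComplex C ℤ} (h : Limits.IsZero (Q.obj K)) : K.Acyclic := fun i => by
  rw [HomologicalComplex.exactAt_iff_isZero_homology]
  exact ((homologyFunctor C i).map_isZero h).of_iso ((homologyFunctorFactors C i).symm.app K)

theorem acyclic_mappingCone_of_quasiIso {C : Type*} [Category C] [Abelian C]
    {K L : CochainComplex C ℤ} (f : K ⟶ L) [QuasiIso f] : (mappingCone f).Acyclic := by
  let := HasDerivedCategory.standard C
  exact acyclic_of_isZero_Q
    (Triangle.isZero₃_of_isIso₁ _ (mappingCone_triangle_distinguished f)
      (inferInstanceAs (IsIso (Q.map f))))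

variable {R : Type u} [CommRing R] [Finite (MaximalSpectrum R)]
  {F G : CochainComplex (ModuleCat.{u} R) ℤ}

/-- The cone of the identity is acyclic, and it is a termwise split extension of `F⟦1⟧` by `F`. -/
theorem detClass_shift (hF : IsPerfectComplex F)
    (ht : ∀ i, Module.IsTorsion R (F.homology i)) : detClass F * detClass (F⟦(1 : ℤ)⟧) = 1 := by
  have h := detClass_of_splitting (S := mappingCone.triangleRotateShortComplex (𝟙 F))
    (mappingCone.triangleRotateShortComplexSplitting (𝟙 F)) hF (hF.shift 1) ht
    (isTorsion_homology_shift ht 1)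
  exact h.symm.trans (detClass_of_acyclic (hF.mappingCone hF (𝟙 F))
    (acyclic_mappingCone_of_quasiIso (𝟙 F)))

/-- The cone is a termwise split extension of `F⟦1⟧` by `G`. -/
theorem detClass_mappingCone (hF : IsPerfectComplex F)
    (htF : ∀ i, Module.IsTorsion R (F.homology i)) (hG : IsPerfectComplex G)
    (htG : ∀ i, Module.IsTorsion R (G.homology i)) (f : F ⟶ G) :
    detClass G = detClass F * detClass (mappingCone f) := by
  have h : detClass (mappingCone f) = detClass G * detClass (F⟦(1 : ℤ)⟧) :=
    detClass_of_splitting (S := mappingCone.triangleRotateShortComplex f)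
      (mappingCone.triangleRotateShortComplexSplitting f) hG (hF.shift 1) htG
      (isTorsion_homology_shift htF 1)
  rw [h, mul_left_comm, detClass_shift hF htF, mul_one]

theorem detClass_of_quasiIso (hF : IsPerfectComplex F)
    (htF : ∀ i, Module.IsTorsion R (F.homology i)) (hG : IsPerfectComplex G)
    (htG : ∀ i, Module.IsTorsion R (G.homology i)) (f : F ⟶ G) [QuasiIso f] :
    detClass F = detClass G := by
  rw [detClass_mappingCone hF htF hG htG f, detClass_of_acyclic (hF.mappingCone hG f)
    (acyclic_mappingCone_of_quasiIso f), mul_one]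

end Cone

/-! ### Determinants in the derived category -/

section Derived

open CochainComplex DerivedCategory Pretriangulated

/-- Out of a K-projective complex, morphisms in the derived category are those in the homotopy
category, and these lift to maps of complexes. -/
theorem exists_Q_map_eq {C : Type*} [Category C] [Abelian C] [HasDerivedCategory C]
    {K L : CochainComplex C ℤ} (hK : K.IsKProjective) (α : Q.obj K ⟶ Q.obj L) :
    ∃ f : K ⟶ L, Q.map f = α := by
  obtain ⟨g, hg⟩ := (IsKProjective.Qh_map_bijective K
    ((HomotopyCategory.quotient C (ComplexShape.up ℤ)).obj L)).2
      ((quotientCompQhIso C).hom.app K ≫ α ≫ (quotientCompQhIso C).inv.app L)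
  obtain ⟨f, rfl⟩ := (HomotopyCategory.quotient C (ComplexShape.up ℤ)).map_surjective g
  refine ⟨f, ?_⟩
  have h := quotientCompQhIso_hom_naturality f
  rw [hg] at h
  simpa using h.symm

variable {R : Type u} [CommRing R] [HasDerivedCategory.{w} (ModuleCat.{u} R)]
  {F G : CochainComplex (ModuleCat.{u} R) ℤ}

theorem isTorsion_homology_of_iso (e : Q.obj F ≅ Q.obj G)
    (h : ∀ i, Module.IsTorsion R (F.homology i)) (i : ℤ) : Module.IsTorsion R (G.homology i) :=
  (h i).of_linearEquiv ((homologyFunctorFactors _ i).symm.app F ≪≫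
    (homologyFunctor _ i).mapIso e ≪≫ (homologyFunctorFactors _ i).app G).toLinearEquiv

variable [Finite (MaximalSpectrum R)]

theorem detClass_of_iso (hF : IsPerfectComplex F)
    (htF : ∀ i, Module.IsTorsion R (F.homology i)) (hG : IsPerfectComplex G)
    (e : Q.obj F ≅ Q.obj G) : detClass F = detClass G := by
  obtain ⟨f, hf⟩ := exists_Q_map_eq hF.isKProjective e.hom
  have : QuasiIso f := by
    rw [← isIso_Q_map_iff_quasiIso, hf]
    infer_instance
  exact detClass_of_quasiIso hF htF hG (isTorsion_homology_of_iso e htF) f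

/-- The first morphism is represented by a map of complexes `f`. The third vertex is then isomorphic
to the cone of `f`, to which `detClass_mappingCone` applies. -/
theorem detClass_of_distTriang {T : Triangle (DerivedCategory (ModuleCat.{u} R))}
    (hT : T ∈ distTriang _) {F₁ F₂ F₃ : CochainComplex (ModuleCat.{u} R) ℤ}
    (h₁ : IsPerfectComplex F₁) (h₂ : IsPerfectComplex F₂) (h₃ : IsPerfectComplex F₃)
    (ht₁ : ∀ i, Module.IsTorsion R (F₁.homology i))
    (ht₂ : ∀ i, Module.IsTorsion R (F₂.homology i))
    (ht₃ : ∀ i, Module.IsTorsion R (F₃.homology i)) (e₁ : Q.obj F₁ ≅ T.obj₁)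
    (e₂ : Q.obj F₂ ≅ T.obj₂) (e₃ : Q.obj F₃ ≅ T.obj₃) :
    detClass F₂ = detClass F₁ * detClass F₃ := by
  obtain ⟨f, hf⟩ := exists_Q_map_eq h₁.isKProjective (e₁.hom ≫ T.mor₁ ≫ e₂.inv)
  have e := isoTriangleOfIso₁₂ _ _ (mappingCone_triangle_distinguished f) hT e₁ e₂ (by
    change Q.map f ≫ e₂.hom = _
    rw [hf, Category.assoc, Category.assoc, Iso.inv_hom_id, Category.comp_id]
    rfl)
  have e' : Q.obj F₃ ≅ Q.obj (mappingCone f) := e₃ ≪≫ (Triangle.π₃.mapIso e).symm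
  rw [detClass_mappingCone h₁ ht₁ h₂ ht₂ f, detClass_of_iso h₃ ht₃ (h₁.mappingCone h₂ f) e']

end Derived

/-! ### Homomorphisms between Grothendieck groups -/

section ExactK0

variable {C : Type*} [Category C] [Abelian C] {P : ObjectProperty C}

namespace ExactK0

/-- The homomorphism defined by an additive function on an exact category. -/
def lift {A : Type*} [AddCommGroup A] (f : {X : C // P X} → A)
    (hf : ∀ (S : ShortComplex C) (h₁ : P S.X₁) (h₂ : P S.X₂) (h₃ : P S.X₃), S.ShortExact →
      f ⟨S.X₂, h₂⟩ = f ⟨S.X₁, h₁⟩ + f ⟨S.X₃, h₃⟩) : ExactK0 P →+ A :=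
  QuotientAddGroup.lift _ (FreeAbelianGroup.lift f) (by
    rw [AddSubgroup.closure_le]
    rintro _ ⟨S, h₁, h₂, h₃, hS, rfl⟩
    simp [hf S h₁ h₂ h₃ hS])

theorem lift_of {A : Type*} [AddCommGroup A] (f : {X : C // P X} → A)
    (hf : ∀ (S : ShortComplex C) (h₁ : P S.X₁) (h₂ : P S.X₂) (h₃ : P S.X₃), S.ShortExact →
      f ⟨S.X₂, h₂⟩ = f ⟨S.X₁, h₁⟩ + f ⟨S.X₃, h₃⟩) (X : C) (hX : P X) :
    lift f hf (of P X hX) = f ⟨X, hX⟩ :=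
  FreeAbelianGroup.lift_apply_of _ _

theorem of_eq_add {S : ShortComplex C} (hS : S.ShortExact) (h₁ : P S.X₁) (h₂ : P S.X₂)
    (h₃ : P S.X₃) : of P S.X₂ h₂ = of P S.X₁ h₁ + of P S.X₃ h₃ := by
  rw [← sub_eq_zero]
  exact (QuotientAddGroup.eq_zero_iff _).mpr
    (AddSubgroup.subset_closure ⟨S, h₁, h₂, h₃, hS, rfl⟩)

theorem mem_of_forall_of_mem {H : AddSubgroup (ExactK0 P)} (h : ∀ X hX, of P X hX ∈ H)
    (x : ExactK0 P) : x ∈ H := by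
  obtain ⟨x, rfl⟩ := QuotientAddGroup.mk_surjective x
  induction x using FreeAbelianGroup.induction_on with
  | zero => exact H.zero_mem
  | of X => exact h X.1 X.2
  | neg X => exact H.neg_mem (h X.1 X.2)
  | add x y hx hy => exact H.add_mem hx hy

end ExactK0

end ExactK0

/-! ### Grothendieck groups of triangulated categories -/

section TriangulatedK0

open Limits Pretriangulated
open scoped ZeroObject

variable {C : Type*} [Category C] [HasZeroObject C] [HasShift C ℤ] [Preadditive C]
  [∀ n : ℤ, (shiftFunctor C n).Additive] [Pretriangulated C] {P : ObjectProperty C}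

namespace TriangulatedK0

/-- The homomorphism defined by an additive function on a triangulated category. -/
def lift {A : Type*} [AddCommGroup A] (f : {X : C // P X} → A)
    (hf : ∀ (T : Triangle C) (h₁ : P T.obj₁) (h₂ : P T.obj₂) (h₃ : P T.obj₃), T ∈ distTriang C →
      f ⟨T.obj₂, h₂⟩ = f ⟨T.obj₁, h₁⟩ + f ⟨T.obj₃, h₃⟩) : TriangulatedK0 P →+ A :=
  QuotientAddGroup.lift _ (FreeAbelianGroup.lift f) (by
    rw [AddSubgroup.closure_le]
    rintro _ ⟨S, h₁, h₂, h₃, hS, rfl⟩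
    simp [hf S h₁ h₂ h₃ hS])

theorem lift_of {A : Type*} [AddCommGroup A] (f : {X : C // P X} → A)
    (hf : ∀ (T : Triangle C) (h₁ : P T.obj₁) (h₂ : P T.obj₂) (h₃ : P T.obj₃), T ∈ distTriang C →
      f ⟨T.obj₂, h₂⟩ = f ⟨T.obj₁, h₁⟩ + f ⟨T.obj₃, h₃⟩) (X : C) (hX : P X) :
    lift f hf (of P X hX) = f ⟨X, hX⟩ :=
  FreeAbelianGroup.lift_apply_of _ _

theorem of_eq_add {T : Triangle C} (hT : T ∈ distTriang C) (h₁ : P T.obj₁) (h₂ : P T.obj₂)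
    (h₃ : P T.obj₃) : of P T.obj₂ h₂ = of P T.obj₁ h₁ + of P T.obj₃ h₃ := by
  rw [← sub_eq_zero]
  exact (QuotientAddGroup.eq_zero_iff _).mpr
    (AddSubgroup.subset_closure ⟨T, h₁, h₂, h₃, hT, rfl⟩)

theorem of_zero (h : P 0) : of P 0 h = 0 := by
  have := of_eq_add (P := P) (contractible_distinguished (0 : C)) h h h
  exact left_eq_add.mp this

/-- The generators of `K₀` are objects, not isomorphism classes. An isomorphism is compared with the
identity by the distinguished triangle `X → Y → 0`. -/
theorem of_eq_of_iso (h : P 0) {X Y : C} (e : X ≅ Y) (hX : P X) (hY : P Y) :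
    of P X hX = of P Y hY := by
  have hT : Triangle.mk e.hom (0 : Y ⟶ 0) 0 ∈ distTriang C :=
    isomorphic_distinguished _ (contractible_distinguished X) _
      (Triangle.isoMk _ _ (Iso.refl X) e.symm (Iso.refl 0)
        (e.hom_inv_id.trans (Category.id_comp (𝟙 X)).symm)
        (Limits.zero_comp.trans Limits.comp_zero.symm)
        (Limits.zero_comp.trans Limits.comp_zero.symm))
  exact (left_eq_add.mpr (of_zero h)).trans (of_eq_add (P := P) hT hX hY h).symm

/-- From the triangle `X → 0 → X⟦1⟧`. -/
theorem of_shift (h : P 0) {X : C} (hX : P X) (hX' : P (X⟦(1 : ℤ)⟧)) :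
    of P (X⟦(1 : ℤ)⟧) hX' = -of P X hX := by
  have := of_eq_add (P := P) (contractible_distinguished₂ X) hX h hX'
  rw [eq_neg_iff_add_eq_zero, add_comm, ← of_zero h]
  exact this.symm

theorem mem_of_forall_of_mem {H : AddSubgroup (TriangulatedK0 P)} (h : ∀ X hX, of P X hX ∈ H)
    (x : TriangulatedK0 P) : x ∈ H := by
  obtain ⟨x, rfl⟩ := QuotientAddGroup.mk_surjective x
  induction x using FreeAbelianGroup.induction_on with
  | zero => exact H.zero_mem
  | of X => exact h X.1 X.2
  | neg X => exact H.neg_mem (h X.1 X.2)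
  | add x y hx hy => exact H.add_mem hx hy

end TriangulatedK0

end TriangulatedK0

/-! ### The homomorphisms `Det` and `φ` -/

section DetHom

open scoped ZeroObject

open CochainComplex DerivedCategory Pretriangulated

variable {S R : Type u} [CommRing S] [CommRing R] {ι : S →+* R}

theorem IsPerfectTorsion.isTorsion (hι : TorsionCompatible ι)
    {F : CochainComplex (ModuleCat.{u} R) ℤ} (hF : IsPerfectTorsion ι F) (i : ℤ) :
    Module.IsTorsion R (F.homology i) := (hι _).mp (hF.2 i)

theorem isPerfectComplex_of_isZero {F : CochainComplex (ModuleCat.{u} R) ℤ}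
    (h : ∀ i, Limits.IsZero (F.X i)) : IsPerfectComplex F := by
  have := fun i => ModuleCat.subsingleton_of_isZero (h i)
  exact ⟨⟨0, 0, fun i _ => h i⟩, fun i => inferInstance, fun i => inferInstance⟩

variable [HasDerivedCategory.{w} (ModuleCat.{u} R)]

/-- The homomorphism `Det` on the Grothendieck group of perfect complexes. -/
noncomputable def detHom [Finite (MaximalSpectrum R)] (hι : TorsionCompatible ι) :
    TriangulatedK0 (derivedPerfTor.{w} ι) →+ Additive (InvertibleIdeals R) :=
  TriangulatedK0.lift (fun X => Additive.ofMul (detClass X.2.choose)) (by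
    intro T h₁ h₂ h₃ hT
    rw [← ofMul_mul]
    exact congrArg Additive.ofMul (detClass_of_distTriang hT h₁.choose_spec.1.1
      h₂.choose_spec.1.1 h₃.choose_spec.1.1 (h₁.choose_spec.1.isTorsion hι)
      (h₂.choose_spec.1.isTorsion hι) (h₃.choose_spec.1.isTorsion hι) h₁.choose_spec.2.some
      h₂.choose_spec.2.some h₃.choose_spec.2.some))

theorem detHom_complexClass [Finite (MaximalSpectrum R)] (hι : TorsionCompatible ι)
    {F : CochainComplex (ModuleCat.{u} R) ℤ} (hF : IsPerfectTorsion ι F) :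
    detHom.{w} hι (complexClass.{w} ι F hF) = Additive.ofMul (detClass F) := by
  have h : derivedPerfTor.{w} ι (Q.obj F) := ⟨F, hF, ⟨Iso.refl _⟩⟩
  exact (TriangulatedK0.lift_of _ _ _ h).trans <| congrArg Additive.ofMul (detClass_of_iso
    h.choose_spec.1.1 (h.choose_spec.1.isTorsion hι) hF.1 h.choose_spec.2.some)

/-- A perfect complex represents an object with torsion cohomology if it has torsion
cohomology. -/
theorem derivedPerfTor_of_perfect (hι : TorsionCompatible ι)
    {F : CochainComplex (ModuleCat.{u} R) ℤ} (hF : IsPerfectComplex F)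
    {X : DerivedCategory (ModuleCat.{u} R)} (e : Q.obj F ≅ X)
    (h : ∀ i, Module.IsTorsion R ((homologyFunctor (ModuleCat.{u} R) i).obj X)) :
    derivedPerfTor ι X :=
  ⟨F, ⟨hF, fun i => (hι _).mpr ((h i).of_linearEquiv
    ((homologyFunctor (ModuleCat.{u} R) i).mapIso e.symm ≪≫
    (homologyFunctorFactors (ModuleCat.{u} R) i).app F).toLinearEquiv)⟩, ⟨e⟩⟩

theorem isTorsion_homologyFunctor (hι : TorsionCompatible ι)
    {X : DerivedCategory (ModuleCat.{u} R)} (h : derivedPerfTor ι X) (i : ℤ) :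
    Module.IsTorsion R ((homologyFunctor (ModuleCat.{u} R) i).obj X) := by
  obtain ⟨F, hF, ⟨e⟩⟩ := h
  exact (hF.isTorsion hι i).of_linearEquiv
    ((homologyFunctorFactors (ModuleCat.{u} R) i).symm.app F ≪≫
      (homologyFunctor (ModuleCat.{u} R) i).mapIso e).toLinearEquiv

/-- The third vertex is the cone of a map of perfect complexes, and the long exact sequence places
its cohomology between torsion modules. -/
theorem derivedPerfTor_of_distTriang (hι : TorsionCompatible ι)
    {T : Triangle (DerivedCategory (ModuleCat.{u} R))} (hT : T ∈ distTriang _)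
    (h₁ : derivedPerfTor ι T.obj₁) (h₂ : derivedPerfTor ι T.obj₂) :
    derivedPerfTor ι T.obj₃ := by
  obtain ⟨F₁, hF₁, ⟨e₁⟩⟩ := id h₁
  obtain ⟨F₂, hF₂, ⟨e₂⟩⟩ := id h₂
  obtain ⟨f, hf⟩ := exists_Q_map_eq hF₁.1.isKProjective (e₁.hom ≫ T.mor₁ ≫ e₂.inv)
  have e := isoTriangleOfIso₁₂ _ _ (mappingCone_triangle_distinguished f) hT e₁ e₂ (by
    change Q.map f ≫ e₂.hom = _
    rw [hf, Category.assoc, Category.assoc, Iso.inv_hom_id, Category.comp_id]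
    rfl)
  refine derivedPerfTor_of_perfect hι (hF₁.1.mappingCone hF₂.1 f) (Triangle.π₃.mapIso e)
    fun i => ?_
  exact isTorsion_of_exact (HomologySequence.exact₃ T hT i (i + 1) rfl)
    (isTorsion_homologyFunctor hι h₂ i) (isTorsion_homologyFunctor hι h₁ (i + 1))

theorem derivedPerfTor_of_isZero (hι : TorsionCompatible ι)
    {X : DerivedCategory (ModuleCat.{u} R)} (h : Limits.IsZero X) : derivedPerfTor ι X := by
  refine derivedPerfTor_of_perfect hι (F := 0) (isPerfectComplex_of_isZero fun i => ?_)
    ((Q.map_isZero (Limits.isZero_zero _)).iso h) fun i x => ⟨1, ?_⟩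
  · exact (HomologicalComplex.eval _ _ i).map_isZero (Limits.isZero_zero _)
  · have := ModuleCat.subsingleton_of_isZero ((homologyFunctor (ModuleCat.{u} R) i).map_isZero h)
    exact Subsingleton.elim _ _

end DetHom

/-! ### Perfect resolutions -/

section Resolution

open DerivedCategory Pretriangulated
open CochainComplex (mappingCone)

variable {R : Type u} [CommRing R]

theorem isPerfectComplex_single (M : ModuleCat.{u} R) [Module.Finite R M]
    [Module.Projective R M] :
    IsPerfectComplex
      ((HomologicalComplex.single (ModuleCat.{u} R) (ComplexShape.up ℤ) 0).obj M) := by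
  have h : ∀ i : ℤ, i ≠ 0 → Limits.IsZero
      (((HomologicalComplex.single (ModuleCat.{u} R) (ComplexShape.up ℤ) 0).obj M).X i) :=
    fun i hi => HomologicalComplex.isZero_single_obj_X _ _ _ _ hi
  have e := (HomologicalComplex.singleObjXSelf (ComplexShape.up ℤ) 0 M).symm.toLinearEquiv
  refine ⟨⟨0, 0, fun i hi => h i (by omega)⟩, fun i => ?_, fun i => ?_⟩
  · by_cases hi : i = 0
    · subst hi
      exact Module.Finite.equiv e
    · have := ModuleCat.subsingleton_of_isZero (h i hi)
      infer_instance
  · by_cases hi : i = 0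
    · subst hi
      exact Module.Projective.of_equiv e
    · have := ModuleCat.subsingleton_of_isZero (h i hi)
      infer_instance

theorem isZero_mappingCone_X {C : Type*} [Category C] [Abelian C] {K L : CochainComplex C ℤ}
    (f : K ⟶ L) (i : ℤ) (hK : Limits.IsZero (K.X (i + 1))) (hL : Limits.IsZero (L.X i)) :
    Limits.IsZero ((mappingCone f).X i) := by
  let σ := CochainComplex.mappingCone.triangleRotateShortComplexSplitting f i
  have hr : σ.r = 0 := hL.eq_of_tgt _ _
  have hs : σ.s = 0 := Limits.IsZero.eq_of_src (Y := (mappingCone f).X i) hK _ _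
  have h := σ.id
  rw [hr, hs, Limits.zero_comp, Limits.comp_zero, add_zero] at h
  exact (Limits.IsZero.iff_id_eq_zero _).mpr h.symm

/-- Dimension shifting: if `F` resolves the kernel of `Rᵐ → M`, the cone of `F → Rᵐ` resolves `M`.
Noetherianity keeps the kernel finitely generated, and the cone moves `F` one step to the left, so
it still vanishes in degrees `≥ 1`. -/
theorem exists_perfect_iso_single [IsNoetherianRing R] [HasDerivedCategory.{w} (ModuleCat.{u} R)]
    (n : ℕ) (M : ModuleCat.{u} R) [Module.Finite R M] [HasProjectiveDimensionLT M (n + 1)] :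
    ∃ F : CochainComplex (ModuleCat.{u} R) ℤ, IsPerfectComplex F ∧
      (∀ i : ℤ, 1 ≤ i → Limits.IsZero (F.X i)) ∧
      Nonempty (Q.obj F ≅ (singleFunctor (ModuleCat.{u} R) 0).obj M) := by
  induction n generalizing M with
  | zero =>
    have : Projective M := projective_iff_hasProjectiveDimensionLT_one.mpr ‹_›
    have := (IsProjective.iff_projective (R := R) M).mpr this
    exact ⟨_, isPerfectComplex_single M,
      fun i hi => HomologicalComplex.isZero_single_obj_X _ _ _ _ (by omega), ⟨Iso.refl _⟩⟩
  | succ n ih =>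
    obtain ⟨m, g, hg⟩ := Module.Finite.exists_fin' R M
    have hS := LinearMap.shortExact_shortComplexKer hg
    have : HasProjectiveDimensionLT (ModuleCat.of R (LinearMap.ker g)) (n + 1) :=
      hS.hasProjectiveDimensionLT_X₁ (n + 1)
        (have : Projective (ModuleCat.of R (Fin m → R)) := inferInstance
         hasProjectiveDimensionLT_of_ge _ 1 _ (by omega)) inferInstance
    obtain ⟨F, hF, hF1, ⟨e⟩⟩ := ih (ModuleCat.of R (LinearMap.ker g))
    have hT := hS.singleTriangle_distinguished
    obtain ⟨f, hf⟩ := exists_Q_map_eq (L := (HomologicalComplex.single (ModuleCat.{u} R)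
      (ComplexShape.up ℤ) 0).obj (ModuleCat.of R (Fin m → R))) hF.isKProjective
      (e.hom ≫ hS.singleTriangle.mor₁)
    have e' := isoTriangleOfIso₁₂ _ _ (mappingCone_triangle_distinguished f) hT e (Iso.refl _)
      ((Category.comp_id _).trans hf)
    refine ⟨mappingCone f, hF.mappingCone (isPerfectComplex_single _) f, fun i hi => ?_,
      ⟨Triangle.π₃.mapIso e'⟩⟩
    exact isZero_mappingCone_X f i (hF1 _ (by omega))
      (HomologicalComplex.isZero_single_obj_X _ _ _ _ (by omega))

variable {S : Type u} [CommRing S] {ι : S →+* R}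

theorem isTorsion_homologyFunctor_single [HasDerivedCategory.{w} (ModuleCat.{u} R)]
    {M : ModuleCat.{u} R} (hM : Module.IsTorsion R M) (i : ℤ) : Module.IsTorsion R
      ((homologyFunctor (ModuleCat.{u} R) i).obj ((singleFunctor (ModuleCat.{u} R) 0).obj M)) := by
  have e := (homologyFunctorFactors (ModuleCat.{u} R) i).symm.app
    ((HomologicalComplex.single (ModuleCat.{u} R) (ComplexShape.up ℤ) 0).obj M)
  by_cases hi : i = 0
  · subst hi
    exact hM.of_linearEquiv ((HomologicalComplex.singleObjHomologySelfIso _ 0 M).symm ≪≫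
      e).toLinearEquiv
  · have h : Limits.IsZero (((HomologicalComplex.single (ModuleCat.{u} R) (ComplexShape.up ℤ)
        0).obj M).homology i) := HomologicalComplex.isZero_single_obj_homology _ _ _ _ hi
    have := ModuleCat.subsingleton_of_isZero h
    exact Module.IsTorsion.of_linearEquiv e.toLinearEquiv fun x =>
      ⟨1, @Subsingleton.elim _ this _ _⟩

theorem exists_isPerfectResolution [IsNoetherianRing R] (hι : TorsionCompatible ι)
    (M : ModuleCat.{u} R) (hM : catQ ι M) :
    ∃ F : CochainComplex (ModuleCat.{u} R) ℤ, IsPerfectResolution ι F M := by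
  -- The derived category is auxiliary here: the isomorphism found in it is realised by a map of
  -- complexes since `F` is K-projective.
  let := HasDerivedCategory.standard (ModuleCat.{u} R)
  obtain ⟨h1, h2, n, h3⟩ := hM
  obtain ⟨F, hF, hF1, ⟨e⟩⟩ := exists_perfect_iso_single n M
  obtain ⟨π, hπ⟩ := exists_Q_map_eq (L := (HomologicalComplex.single (ModuleCat.{u} R)
      (ComplexShape.up ℤ) 0).obj M) hF.isKProjective e.hom
  have hq : QuasiIso π := by
    rw [← isIso_Q_map_iff_quasiIso, hπ]
    exact e.isIso_hom
  refine ⟨F, ⟨hF, fun i => (hι _).mpr ?_⟩, hF1, π, hq⟩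
  exact (isTorsion_homologyFunctor_single ((hι M).mp h2) i).of_linearEquiv
    ((homologyFunctor (ModuleCat.{u} R) i).mapIso e.symm ≪≫
    (homologyFunctorFactors (ModuleCat.{u} R) i).app F).toLinearEquiv

variable [HasDerivedCategory.{w} (ModuleCat.{u} R)]

theorem derivedPerfTor_single [IsNoetherianRing R] (hι : TorsionCompatible ι) {M : ModuleCat.{u} R}
    (hM : catQ ι M) : derivedPerfTor ι ((singleFunctor (ModuleCat.{u} R) 0).obj M) := by
  obtain ⟨F, hF, -, π, hπ⟩ := exists_isPerfectResolution hι M hM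
  have e := asIso (Q.map π)
  exact ⟨F, hF, ⟨e⟩⟩

/-- The homomorphism `φ`, which sends a module to the class of its resolutions. -/
noncomputable def resolutionHom [IsNoetherianRing R] (hι : TorsionCompatible ι) :
    ExactK0 (catQ ι) →+ TriangulatedK0 (derivedPerfTor.{w} ι) :=
  -- The value is the class of `M` placed in degree `0`, so that additivity is the triangle of a
  -- short exact sequence. Any resolution is isomorphic to this object in the derived category.
  ExactK0.lift (fun M => TriangulatedK0.of _ _ (derivedPerfTor_single hι M.2))
    fun _ _ _ _ hS => TriangulatedK0.of_eq_add hS.singleTriangle_distinguished _ _ _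

theorem resolutionHom_of [IsNoetherianRing R] (hι : TorsionCompatible ι) {M : ModuleCat.{u} R}
    (hM : catQ ι M) : resolutionHom.{w} hι (ExactK0.of _ M hM) =
      TriangulatedK0.of _ _ (derivedPerfTor_single hι hM) :=
  ExactK0.lift_of _ _ _ _

theorem resolutionHom_of_eq_complexClass [IsNoetherianRing R] (hι : TorsionCompatible ι)
    {M : ModuleCat.{u} R} (hM : catQ ι M) {F : CochainComplex (ModuleCat.{u} R) ℤ}
    (hF : IsPerfectResolution ι F M) :
    resolutionHom.{w} hι (ExactK0.of _ M hM) = complexClass.{w} ι F hF.1 := by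
  obtain ⟨hF, -, π, hπ⟩ := hF
  rw [resolutionHom_of]
  exact (TriangulatedK0.of_eq_of_iso (derivedPerfTor_of_isZero hι (Limits.isZero_zero _))
    (asIso (Q.map π)) _ _).symm

end Resolution

/-! ### Surjectivity of `ι` -/

section InclSurjective

variable {S R : Type u} [CommRing S] [CommRing R] {ι : S →+* R}

/-- The short complex `Rᵐ → Rᵐ → Rᵐ / s Rᵐ`. -/
noncomputable abbrev freeQuotientComplex (s : R) (m : ℕ) : ShortComplex (ModuleCat.{u} R) :=
  .mk (ModuleCat.ofHom (s • LinearMap.id : (Fin m → R) →ₗ[R] Fin m → R))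
    (ModuleCat.ofHom (LinearMap.range (s • LinearMap.id : (Fin m → R) →ₗ[R] Fin m → R)).mkQ)
    (ModuleCat.hom_ext (LinearMap.range_mkQ_comp _))

theorem shortExact_freeQuotientComplex {s : R} (hs : s ∈ nonZeroDivisors R) (m : ℕ) :
    (freeQuotientComplex s m).ShortExact := by
  refine ModuleCat.shortComplex_shortExact _ (LinearMap.exact_map_mkQ_range _)
    (fun x y h => funext fun i => ?_) (Submodule.mkQ_surjective _)
  exact (mul_cancel_left_mem_nonZeroDivisors hs).mp
    (congrFun h i)

theorem isTorsion_of_smul_eq_zero {M : Type*} [AddCommGroup M] [Module R M] {s : R}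
    (hs : s ∈ nonZeroDivisors R) (h : ∀ x : M, s • x = 0) : Module.IsTorsion R M :=
  fun x => ⟨⟨s, hs⟩, h x⟩

theorem smul_quotient_range_smul_eq_zero {M : Type*} [AddCommGroup M] [Module R M] (s : R)
    (x : M ⧸ LinearMap.range (s • LinearMap.id : M →ₗ[R] M)) : s • x = 0 := by
  obtain ⟨x, rfl⟩ := Submodule.mkQ_surjective _ x
  exact (Submodule.Quotient.mk_eq_zero _).mpr ⟨x, rfl⟩

theorem catP_freeQuotientComplex (hι : TorsionCompatible ι) {s : R} (hs : s ∈ nonZeroDivisors R)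
    (m : ℕ) : catP ι (freeQuotientComplex s m).X₃ := by
  have : Projective (ModuleCat.of R (Fin m → R)) := inferInstance
  refine ⟨inferInstanceAs (Module.Finite R ((Fin m → R) ⧸ _)),
    (hι _).mpr (isTorsion_of_smul_eq_zero hs (smul_quotient_range_smul_eq_zero s)),
    (shortExact_freeQuotientComplex hs m).hasProjectiveDimensionLT_X₃ 1
      (inferInstanceAs (HasProjectiveDimensionLT (ModuleCat.of R (Fin m → R)) 1))
      (hasProjectiveDimensionLT_of_ge (ModuleCat.of R (Fin m → R)) 1 _ (by omega))⟩

/-- A finitely generated torsion module is a quotient of some `Rᵐ / s Rᵐ`. -/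
theorem exists_quotient_range_smul_surjective {M : Type*} [AddCommGroup M] [Module R M]
    [Module.Finite R M] (hM : Module.IsTorsion R M) :
    ∃ (s : R) (_ : s ∈ nonZeroDivisors R) (_ : ∀ x : M, s • x = 0) (m : ℕ)
      (g : (Fin m → R) →ₗ[R] M)
      (q : ((Fin m → R) ⧸ LinearMap.range (s • LinearMap.id : (Fin m → R) →ₗ[R] Fin m → R))
        →ₗ[R] M), Function.Surjective g ∧ Function.Surjective q ∧
        q.comp (Submodule.mkQ _) = g := by
  obtain ⟨s, hs, hs0⟩ := Submodule.annihilator_top_inter_nonZeroDivisors hM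
  have hs' : ∀ x : M, s • x = 0 := fun x => Submodule.mem_annihilator.mp hs x trivial
  obtain ⟨m, g, hg⟩ := Module.Finite.exists_fin' R M
  have hle : LinearMap.range (s • LinearMap.id : (Fin m → R) →ₗ[R] Fin m → R) ≤
      LinearMap.ker g := by
    rintro _ ⟨x, rfl⟩
    simp [hs']
  refine ⟨s, hs0, hs', m, g, Submodule.liftQ _ g hle, hg, fun x => ?_, Submodule.liftQ_mkQ _ _ _⟩
  obtain ⟨y, rfl⟩ := hg x
  exact ⟨Submodule.mkQ _ y, Submodule.liftQ_apply _ _ _⟩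

theorem Module.IsTorsion.submodule {M : Type*} [AddCommGroup M] [Module R M]
    (hM : Module.IsTorsion R M) (N : Submodule R M) : Module.IsTorsion R N := fun x => by
  obtain ⟨a, ha⟩ := hM (x := (x : M))
  exact ⟨a, Subtype.ext ha⟩

/-- A surjection `Rᵐ / s Rᵐ → M` has source in `𝒫_R`, and its kernel has smaller projective
dimension when that of `M` is at least `2`. Thus `[M]` is a difference of classes in the image. -/
theorem of_mem_range_incl [IsNoetherianRing R] (hι : TorsionCompatible ι) (n : ℕ)
    (M : ModuleCat.{u} R) (hM : catQ ι M) [HasProjectiveDimensionLT M (n + 1)] :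
    ExactK0.of _ M hM ∈ (ExactK0.incl (catP_le_catQ ι)).range := by
  induction n generalizing M with
  | zero =>
    exact ⟨ExactK0.of _ M ⟨hM.1, hM.2.1, hasProjectiveDimensionLT_of_ge M 1 _ (by omega)⟩, rfl⟩
  | succ n ih =>
    have := hM.1
    have hMt := (hι _).mp hM.2.1
    obtain ⟨s, hs, -, m, g, q, -, hq, -⟩ := exists_quotient_range_smul_surjective hMt
    have h2 := catP_freeQuotientComplex hι hs m
    have h2' : HasProjectiveDimensionLT (freeQuotientComplex s m).X₃ 2 := h2.2.2
    -- In projective dimension `≤ 1` the module is already in `𝒫_R`; the bound on the kernel needs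
    -- `2 ≤ n + 1`.
    by_cases hn : n = 0
    · subst hn
      exact ⟨ExactK0.of _ M ⟨hM.1, hM.2.1, ‹_›⟩, rfl⟩
    have hS := LinearMap.shortExact_shortComplexKer hq
    have h1' : HasProjectiveDimensionLT (ModuleCat.of R (LinearMap.ker q)) (n + 1) :=
      hS.hasProjectiveDimensionLT_X₁ (n + 1)
        (hasProjectiveDimensionLT_of_ge (freeQuotientComplex s m).X₃ 2 _ (by omega)) ‹_›
    have h1 : catQ ι (ModuleCat.of R (LinearMap.ker q)) :=
      ⟨inferInstanceAs (Module.Finite R (LinearMap.ker q)), (hι _).mpr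
        (((hι _).mp h2.2.1).submodule _), n, h1'⟩
    have e := ExactK0.of_eq_add (P := catQ ι) hS h1 (catP_le_catQ ι _ h2) hM
    rw [← sub_eq_iff_eq_add'] at e
    exact e ▸ AddSubgroup.sub_mem _ ⟨ExactK0.of _ _ h2, rfl⟩ (ih _ h1)

theorem incl_surjective [IsNoetherianRing R] (hι : TorsionCompatible ι) :
    Function.Surjective (ExactK0.incl (catP_le_catQ ι)) := fun x =>
  ExactK0.mem_of_forall_of_mem (H := (ExactK0.incl (catP_le_catQ ι)).range)
    (fun M hM => by
      obtain ⟨n, hn⟩ := hM.2.2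
      exact of_mem_range_incl hι n M hM) x

end InclSurjective

/-! ### Surjectivity of `φ` -/

section ResolutionSurjective

open DerivedCategory Pretriangulated
open CochainComplex.HomComplex
open scoped ZeroObject

variable {R : Type u} [CommRing R] {F : CochainComplex (ModuleCat.{u} R) ℤ}

/-- If `s` annihilates `Hⁿ(F)`, then a map from a projective module to the cycles becomes
a boundary after multiplication by `s`. -/
theorem exists_comp_d_eq_smul {P : ModuleCat.{u} R} [Projective P] {i j : ℤ} (hij : i + 1 = j)
    {s : R} (hs : ∀ x : F.homology j, s • x = 0) (ψ : P ⟶ F.cycles j) :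
    ∃ t : P ⟶ F.X i, t ≫ F.d i j = s • (ψ ≫ F.iCycles j) := by
  have hij' : (ComplexShape.up ℤ).prev j = i := by simp [← hij]
  have hex := ShortComplex.exact_of_g_is_cokernel
    (ShortComplex.mk (F.toCycles i j) (F.homologyπ j) (F.toCycles_comp_homologyπ i j))
    (F.homologyIsCokernel i j hij')
  have hψ : (s • ψ) ≫ F.homologyπ j = 0 := by
    ext x
    exact (map_smul (F.homologyπ j).hom s (ψ.hom x)).trans (hs _)
  refine ⟨hex.liftFromProjective (s • ψ) hψ, ?_⟩
  have := hex.liftFromProjective_comp (s • ψ) hψ =≫ F.iCycles j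
  rwa [Category.assoc, F.toCycles_i, Linear.smul_comp] at this

theorem IsPerfectComplex.finite_homology [IsNoetherianRing R] (hF : IsPerfectComplex F) (i : ℤ) :
    Module.Finite R (F.homology i) := by
  have := hF.finite i
  have : Module.Finite R (F.cycles i) := Module.Finite.of_injective (F.iCycles i).hom
    ((ModuleCat.mono_iff_injective _).mp inferInstance)
  exact Module.Finite.of_surjective (F.homologyπ i).hom
    ((ModuleCat.epi_iff_surjective _).mp inferInstance)

/-- A map from an object in degree `0` which factors through a differential is homotopic to zero. -/
noncomputable def homotopyZeroOfSingle {C : Type*} [Category C] [Preadditive C]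
    [Limits.HasZeroObject C] {P : C} {K : CochainComplex C ℤ}
    (f : (HomologicalComplex.single C (.up ℤ) 0).obj P ⟶ K) (t : P ⟶ K.X (-1))
    (h : f.f 0 = (HomologicalComplex.singleObjXSelf (.up ℤ) 0 P).hom ≫ t ≫ K.d (-1) 0) :
    Homotopy f 0 :=
  (Cochain.equivHomotopy (F := (CochainComplex.singleFunctor C 0).obj P) f 0).symm
    ⟨Cochain.fromSingleMk t (zero_add _), by
      rw [Cochain.δ_fromSingleMk t (zero_add (-1)) 0 0 (zero_add 0), Cochain.ofHom_zero, add_zero]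
      apply (Cochain.fromSingleEquiv (zero_add 0)).injective
      rw [Cochain.fromSingleEquiv_fromSingleMk]
      change (HomologicalComplex.singleObjXSelf (.up ℤ) 0 P).inv ≫ (Cochain.ofHom _).v 0 0 _ = _
      rw [Cochain.ofHom_v, h, Iso.inv_hom_id_assoc]⟩

/-- On `H^j` the map given by `ψ` is `ψ` followed by the projection from cycles to cohomology. -/
theorem epi_homologyMap_mkHomFromSingle {P : ModuleCat.{u} R} {j : ℤ} (ψ : P ⟶ F.cycles j)
    [Epi (ψ ≫ F.homologyπ j)] :
    Epi (HomologicalComplex.homologyMap (HomologicalComplex.mkHomFromSingle (c := .up ℤ)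
      (ψ ≫ F.iCycles j) (fun k _ => by simp)) j) := by
  set β := HomologicalComplex.mkHomFromSingle (c := .up ℤ) (ψ ≫ F.iCycles j) (fun k _ => by simp)
  have h1 : HomologicalComplex.cyclesMap β j =
      (HomologicalComplex.singleObjCyclesSelfIso (.up ℤ) j P).hom ≫ ψ := by
    rw [← cancel_mono (F.iCycles j), HomologicalComplex.cyclesMap_i, Category.assoc]
    simp [β, HomologicalComplex.singleObjCyclesSelfIso]
  have h2 : (HomologicalComplex.singleObjCyclesSelfIso (.up ℤ) j P).hom ≫ ψ ≫ F.homologyπ j =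
      ((HomologicalComplex.single _ (.up ℤ) j).obj P).homologyπ j ≫
        HomologicalComplex.homologyMap β j := by
    rw [HomologicalComplex.homologyπ_naturality, h1, Category.assoc]
  have : Epi (((HomologicalComplex.single _ (.up ℤ) j).obj P).homologyπ j ≫
      HomologicalComplex.homologyMap β j) := h2 ▸ inferInstance
  exact epi_of_epi (((HomologicalComplex.single _ (.up ℤ) j).obj P).homologyπ j) _

variable [HasDerivedCategory.{w} (ModuleCat.{u} R)]

/-- A class in `Ext^i(A, Y)` is represented by a map of complexes `F → Y[i]`. It lives in degree
`-i`, where `F` vanishes as soon as `-i < a`. -/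
theorem exists_hasProjectiveDimensionLE_of_iso {F : CochainComplex (ModuleCat.{u} R) ℤ}
    (hF : IsPerfectComplex F) {A : ModuleCat.{u} R}
    (e : Q.obj F ≅ (singleFunctor (ModuleCat.{u} R) 0).obj A) :
    ∃ n : ℕ, HasProjectiveDimensionLE A n := by
  obtain ⟨a, b, hab⟩ := hF.bounded
  let := HasExt.standard (ModuleCat.{u} R)
  refine ⟨(1 - a).toNat, HasProjectiveDimensionLT.mk fun i hi Y α => ?_⟩
  apply Abelian.Ext.homEquiv.injective
  let L := (HomologicalComplex.single (ModuleCat.{u} R) (ComplexShape.up ℤ) 0).obj Y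
  let α' : (singleFunctor (ModuleCat.{u} R) 0).obj A ⟶ (Q.obj L)⟦(i : ℤ)⟧ :=
    Abelian.Ext.homEquiv α
  obtain ⟨f, hf⟩ := exists_Q_map_eq hF.isKProjective
    (e.hom ≫ α' ≫ (Q.commShiftIso (i : ℤ)).inv.app L)
  have hf0 : f = 0 := by
    ext1 j
    by_cases hj : j + i = 0
    · exact (hab j (Or.inl (by omega))).eq_of_src _ _
    · exact Limits.IsZero.eq_of_tgt (Y := F.X j)
        (HomologicalComplex.isZero_single_obj_X (ComplexShape.up ℤ) 0 Y (j + i) hj) _ _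
  rw [hf0, Q.map_zero] at hf
  have h0 : α' = 0 := by
    rw [← cancel_epi e.hom, ← cancel_mono ((Q.commShiftIso (i : ℤ)).inv.app L), Category.assoc,
      ← hf, Limits.comp_zero, Limits.zero_comp]
  exact h0.trans (Abelian.Ext.zero_hom ..).symm

/-- A class in `H⁰` annihilated by a nonzerodivisor is represented by a map from the complex
`Rᵐ / s Rᵐ` in degree `0`. -/
theorem exists_single_hom_epi [IsNoetherianRing R] (hF : IsPerfectComplex F)
    (hF0 : Module.IsTorsion R (F.homology 0)) :
    ∃ (s : R) (_ : s ∈ nonZeroDivisors R) (m : ℕ)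
      (γ : (singleFunctor (ModuleCat.{u} R) 0).obj (freeQuotientComplex s m).X₃ ⟶ Q.obj F),
      Epi ((homologyFunctor (ModuleCat.{u} R) 0).map γ) := by
  have := hF.finite_homology 0
  obtain ⟨s, hs, hs0, m, g, -, hg, -, -⟩ := exists_quotient_range_smul_surjective hF0
  let P := ModuleCat.of R (Fin m → R)
  let ψ : P ⟶ F.cycles 0 := Projective.factorThru (ModuleCat.ofHom g) (F.homologyπ 0)
  have hψ : ψ ≫ F.homologyπ 0 = ModuleCat.ofHom g := Projective.factorThru_comp _ _
  have : Epi (ψ ≫ F.homologyπ 0) := hψ ▸ (ModuleCat.epi_iff_surjective _).mpr hg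
  have hβ := epi_homologyMap_mkHomFromSingle ψ
  obtain ⟨t, ht⟩ := exists_comp_d_eq_smul (show (-1 : ℤ) + 1 = 0 by rfl) hs0 ψ
  set β := HomologicalComplex.mkHomFromSingle (c := .up ℤ) (ψ ≫ F.iCycles 0) (fun k _ => by simp)
  -- Multiplication by `s` on `Rᵐ` followed by `β` is null-homotopic, since `s` kills `H⁰(F)`. So
  -- `β` factors through `Rᵐ / s Rᵐ` in the derived category, and the factor `γ` is still surjective
  -- on `H⁰`.
  have hh : Homotopy ((HomologicalComplex.single _ (.up ℤ) 0).map (freeQuotientComplex s m).f ≫ β)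
      0 := homotopyZeroOfSingle _ t (by
    rw [HomologicalComplex.comp_f, HomologicalComplex.single_map_f_self,
      HomologicalComplex.mkHomFromSingle_f, ht, Category.assoc, Category.assoc,
      Iso.inv_hom_id_assoc]
    refine congrArg (_ ≫ ·) ?_
    exact ModuleCat.hom_ext (LinearMap.ext fun x => map_smul (ψ ≫ F.iCycles 0).hom s x))
  have hS := shortExact_freeQuotientComplex hs m
  have h0 : hS.singleTriangle.mor₁ ≫ Q.map β = 0 := by
    have := Q_map_eq_of_homotopy _ hh
    rwa [Q.map_comp, Q.map_zero] at this
  obtain ⟨γ, hγ⟩ := Triangle.yoneda_exact₂ _ hS.singleTriangle_distinguished (Q.map β) h0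
  refine ⟨s, hs, m, γ, ?_⟩
  have h1 : Epi ((homologyFunctor (ModuleCat.{u} R) 0).map (Q.map β)) := by
    have : Epi ((HomologicalComplex.homologyFunctor _ _ 0).map β) := hβ
    exact ((MorphismProperty.epimorphisms _).arrow_mk_iso_iff
      (((Functor.mapArrowFunctor _ _).mapIso
        (homologyFunctorFactors (ModuleCat.{u} R) 0)).app (Arrow.mk β))).mpr this
  have h2 : (homologyFunctor (ModuleCat.{u} R) 0).map (Q.map β) =
    (homologyFunctor (ModuleCat.{u} R) 0).map hS.singleTriangle.mor₂ ≫
      (homologyFunctor (ModuleCat.{u} R) 0).map γ :=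
    (congrArg _ hγ).trans (Functor.map_comp _ _ _)
  exact @epi_of_epi_fac _ _ _ _ _ _ _ _ h1 h2.symm

variable {S : Type u} [CommRing S] {ι : S →+* R}

theorem isZero_homology_shift_iff (X : DerivedCategory (ModuleCat.{u} R)) {n a a' : ℤ}
    (h : n + a = a') :
    Limits.IsZero ((homologyFunctor (ModuleCat.{u} R) a).obj (X⟦n⟧)) ↔
      Limits.IsZero ((homologyFunctor (ModuleCat.{u} R) a').obj X) :=
  (((homologyFunctor (ModuleCat.{u} R) 0).shiftIso n a a' h).app X).isZero_iff

theorem derivedPerfTor_shift (hι : TorsionCompatible ι) {X : DerivedCategory (ModuleCat.{u} R)}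
    (hX : derivedPerfTor ι X) (n : ℤ) : derivedPerfTor ι (X⟦n⟧) := by
  obtain ⟨F, hF, ⟨e⟩⟩ := id hX
  refine derivedPerfTor_of_perfect hι (hF.1.shift n)
    ((Q.commShiftIso n).app F ≪≫ (shiftFunctor _ n).mapIso e) fun i => ?_
  exact (isTorsion_homologyFunctor hι hX (n + i)).of_linearEquiv
    (((homologyFunctor (ModuleCat.{u} R) 0).shiftIso n i _ rfl).app X).symm.toLinearEquiv

/-- Induction on the length of the interval `[-n, 0]` carrying the cohomology. For `n = 0` the
object is a module of finite projective dimension. Otherwise take the cone `Z` of a map from `Rᵐ / s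
Rᵐ` that is surjective on `H⁰`: the top cohomology is gone, and `Z⟦-1⟧` is carried by an interval
that is shorter by one. -/
theorem of_mem_range_resolutionHom_of_isZero [IsNoetherianRing R] (hι : TorsionCompatible ι)
    (n : ℕ) (X : DerivedCategory (ModuleCat.{u} R)) (hX : derivedPerfTor ι X)
    (hlow : ∀ i : ℤ, i < -n → Limits.IsZero ((homologyFunctor (ModuleCat.{u} R) i).obj X))
    (hhigh : ∀ i : ℤ, 0 < i → Limits.IsZero ((homologyFunctor (ModuleCat.{u} R) i).obj X)) :
    TriangulatedK0.of _ X hX ∈ (resolutionHom.{w} hι).range := by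
  have h0 : derivedPerfTor.{w} ι 0 := derivedPerfTor_of_isZero hι (Limits.isZero_zero _)
  obtain ⟨F, hF, ⟨e⟩⟩ := id hX
  induction n generalizing X F with
  | zero =>
    have : X.IsGE 0 := (isGE_iff X 0).mpr (by simpa using hlow)
    have : X.IsLE 0 := (isLE_iff X 0).mpr hhigh
    obtain ⟨A, ⟨e'⟩⟩ := exists_iso_singleFunctor_obj_of_isGE_of_isLE X 0
    have eA : F.homology 0 ≅ A := (homologyFunctorFactors (ModuleCat.{u} R) 0).symm.app F ≪≫
      (homologyFunctor (ModuleCat.{u} R) 0).mapIso (e ≪≫ e') ≪≫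
      (homologyFunctorFactors (ModuleCat.{u} R) 0).app
        ((HomologicalComplex.single (ModuleCat.{u} R) (ComplexShape.up ℤ) 0).obj A) ≪≫
      HomologicalComplex.singleObjHomologySelfIso _ 0 A
    have := hF.1.finite_homology 0
    have hA : catQ ι A := ⟨Module.Finite.equiv eA.toLinearEquiv,
      (hι _).mpr ((hF.isTorsion hι 0).of_linearEquiv eA.toLinearEquiv),
      exists_hasProjectiveDimensionLE_of_iso hF.1 (e ≪≫ e')⟩
    exact ⟨ExactK0.of _ A hA, (resolutionHom_of hι hA).trans
      (TriangulatedK0.of_eq_of_iso h0 e'.symm _ _)⟩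
  | succ n ih =>
    obtain ⟨s, hs, m, γ, hγ⟩ := exists_single_hom_epi hF.1 (hF.isTorsion hι 0)
    have hA := catP_le_catQ ι _ (catP_freeQuotientComplex hι hs m)
    obtain ⟨Z, p, q, hT⟩ := distinguished_cocone_triangle (γ ≫ e.hom)
    have hγ' : Epi ((homologyFunctor (ModuleCat.{u} R) 0).map (γ ≫ e.hom)) := by
      rw [Functor.map_comp]
      exact @epi_comp _ _ _ _ _ _ hγ _
        (((homologyFunctor (ModuleCat.{u} R) 0).mapIso e).isIso_hom.epi_of_iso)
    have h1 := derivedPerfTor_single.{w} hι hA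
    have hZ : derivedPerfTor.{w} ι Z := derivedPerfTor_of_distTriang hι hT h1 hX
    have hsingle : ∀ i : ℤ, i ≠ 0 → Limits.IsZero ((homologyFunctor (ModuleCat.{u} R) i).obj
        ((singleFunctor (ModuleCat.{u} R) 0).obj (freeQuotientComplex s m).X₃)) := fun i hi =>
      (HomologicalComplex.isZero_single_obj_homology (.up ℤ) 0 _ i hi).of_iso
        ((homologyFunctorFactors (ModuleCat.{u} R) i).app
          ((HomologicalComplex.single (ModuleCat.{u} R) (ComplexShape.up ℤ) 0).obj
            (freeQuotientComplex s m).X₃))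
    -- Degree `-1` is left out because `H⁻¹(Z)` also receives the kernel of the surjection onto
    -- `H⁰(X)`.
    have hZ0 : ∀ i : ℤ, i + 1 ≠ 0 → (i < -(n + 1 : ℕ) ∨ 0 ≤ i) →
        Limits.IsZero ((homologyFunctor (ModuleCat.{u} R) i).obj Z) := by
      intro i hi hi'
      refine (HomologySequence.exact₃ _ hT i (i + 1) rfl).isZero_of_both_zeros ?_
        ((hsingle _ hi).eq_of_tgt _ _)
      rcases hi' with hi' | hi'
      · exact (hlow i hi').eq_of_src _ _
      · rcases hi'.eq_or_lt with rfl | hi'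
        · exact (HomologySequence.epi_homologyMap_mor₁_iff _ hT 0).mp hγ'
        · exact (hhigh i hi').eq_of_src _ _
    have hW := derivedPerfTor_shift hι hZ (-1)
    obtain ⟨F', hF', ⟨e''⟩⟩ := id hW
    have key := ih (Z⟦(-1 : ℤ)⟧) hW
      (fun i hi => (isZero_homology_shift_iff Z rfl).mpr (hZ0 _ (by omega) (by left; omega)))
      (fun i hi => (isZero_homology_shift_iff Z rfl).mpr (hZ0 _ (by omega) (by right; omega)))
      F' hF' e''
    have hZW : TriangulatedK0.of _ (Z⟦(-1 : ℤ)⟧⟦(1 : ℤ)⟧) (derivedPerfTor_shift hι hW 1) =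
        TriangulatedK0.of _ Z hZ :=
          TriangulatedK0.of_eq_of_iso h0 ((shiftFunctorCompIsoId _ (-1 : ℤ) 1 rfl).app Z) _ _
    have hadd := TriangulatedK0.of_eq_add hT h1 hX hZ
    change TriangulatedK0.of _ X hX = TriangulatedK0.of _ _ h1 + TriangulatedK0.of _ Z hZ at hadd
    rw [hadd, ← hZW, TriangulatedK0.of_shift h0 hW]
    exact AddSubgroup.add_mem _ ⟨_, resolutionHom_of hι hA⟩ (AddSubgroup.neg_mem _ key)

/-- A shift only changes the sign of the class, so cohomology in positive degrees can be moved down.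
-/
theorem of_mem_range_resolutionHom [IsNoetherianRing R] (hι : TorsionCompatible ι)
    (k : ℕ) (X : DerivedCategory (ModuleCat.{u} R)) (hX : derivedPerfTor ι X)
    (hhigh : ∀ i : ℤ, k < i → Limits.IsZero ((homologyFunctor (ModuleCat.{u} R) i).obj X)) :
    TriangulatedK0.of _ X hX ∈ (resolutionHom.{w} hι).range := by
  induction k generalizing X with
  | zero =>
    obtain ⟨F, hF, ⟨e⟩⟩ := id hX
    obtain ⟨a, b, hab⟩ := hF.1.bounded
    refine of_mem_range_resolutionHom_of_isZero hι (-a).toNat X hX (fun i hi => ?_)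
      (by simpa using hhigh)
    refine Limits.IsZero.of_iso ?_ ((homologyFunctor (ModuleCat.{u} R) i).mapIso e.symm ≪≫
      (homologyFunctorFactors (ModuleCat.{u} R) i).app F)
    exact ShortComplex.isZero_homology_of_isZero_X₂ _ (hab i (Or.inl (by omega)))
  | succ k ih =>
    have h1 := derivedPerfTor_shift hι hX 1
    have key := ih _ h1 fun i hi => (isZero_homology_shift_iff X rfl).mpr (hhigh _ (by
      push_cast
      omega))
    rw [TriangulatedK0.of_shift (derivedPerfTor_of_isZero hι (Limits.isZero_zero _)) hX] at key
    exact (AddSubgroup.neg_mem_iff _).mp key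

theorem resolutionHom_surjective [IsNoetherianRing R] (hι : TorsionCompatible ι) :
    Function.Surjective (resolutionHom.{w} hι) := fun x =>
  TriangulatedK0.mem_of_forall_of_mem (H := (resolutionHom.{w} hι).range)
    (fun X hX => by
      obtain ⟨F, hF, ⟨e⟩⟩ := id hX
      obtain ⟨a, b, hab⟩ := hF.1.bounded
      refine of_mem_range_resolutionHom hι b.toNat X hX fun i hi => ?_
      refine Limits.IsZero.of_iso ?_ ((homologyFunctor (ModuleCat.{u} R) i).mapIso e.symm ≪≫
        (homologyFunctorFactors (ModuleCat.{u} R) i).app F)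
      exact ShortComplex.isZero_homology_of_isZero_X₂ _ (hab i (Or.inr (by omega)))) x

end ResolutionSurjective

/-! ### The determinant of a complex of two free modules of rank one -/

section LofEquiv

variable {A : Type*} [CommRing A] {V : ℤ → Type*} [∀ i, AddCommGroup (V i)] [∀ i, Module A (V i)]

theorem bijective_lof_of_subsingleton (i₀ : ℤ) (h : ∀ i, i ≠ i₀ → Subsingleton (V i)) :
    Function.Bijective (DirectSum.lof A ℤ V i₀) := by
  refine ⟨DirectSum.of_injective i₀, fun x => ?_⟩
  induction x using DirectSum.induction_on with
  | zero => exact ⟨0, map_zero _⟩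
  | of i x =>
    by_cases hi : i = i₀
    · subst hi
      exact ⟨x, rfl⟩
    · have := h i hi
      exact ⟨0, by rw [map_zero, Subsingleton.elim x 0, map_zero]⟩
  | add x y hx hy =>
    obtain ⟨x, rfl⟩ := hx
    obtain ⟨y, rfl⟩ := hy
    exact ⟨x + y, map_add _ _ _⟩

theorem LinearMap.pdet_smul_id_of_equiv {W : Type*} [AddCommGroup W] [Module A W]
    [Module.Finite A W] [Module.Projective A W] (e : W ≃ₗ[A] A) (a : A) :
    LinearMap.pdet (a • LinearMap.id : W →ₗ[A] W) = a := by
  have h1 : (a • LinearMap.id : W →ₗ[A] W) =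
      1 + e.symm.toLinearMap ∘ₗ ((a - 1) • e.toLinearMap) := by
    ext x
    simp [sub_smul, -smul_eq_mul]
  have h2 : 1 + ((a - 1) • e.toLinearMap) ∘ₗ e.symm.toLinearMap =
      (a • LinearMap.id : A →ₗ[A] A) := by
    ext
    simp
  rw [h1, LinearMap.pdet_one_add_comp_comm, h2, LinearMap.pdet_eq_det, LinearMap.det_ring]
  simp

end LofEquiv

section TwoTerm

variable {R : Type u} [CommRing R] {F : CochainComplex (ModuleCat.{u} R) ℤ}

/-- The odd part is the single term of degree `2 * (-1) + 1 = -1` and the even part that of degree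
`0`. The homotopy contributes nothing, as it maps to degree `-2`; so in the coordinates `α` and `β`
the map `d + h` is multiplication by `a`. -/
theorem HasDet.of_twoTerm (hF : IsPerfectComplex F) (c : FracContraction F)
    (h0 : ∀ i : ℤ, i ≠ 0 → i ≠ -1 → Limits.IsZero (F.X i)) (α : R ≃ₗ[R] F.X (-1))
    (β : R ≃ₗ[R] F.X 0) (a : R) (hd : ∀ r, (F.d (-1) 0).hom (α r) = β (a * r)) :
    HasDet F (algebraMap R (FractionRing R) a) := by
  have hX : ∀ i : ℤ, i ≠ 0 → i ≠ -1 → Subsingleton (F.X i) := fun i h h' =>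
    ModuleCat.subsingleton_of_isZero (h0 i h h')
  have hV : ∀ i : ℤ, i ≠ 0 → i ≠ -1 → Subsingleton (FracTerm F i) := fun i h h' =>
    have := hX i h h'
    inferInstance
  have := hF.finite
  have := hF.projective
  have hb := hF.boundedFamily_fracTerm
  have : Module.Finite (FractionRing R) (⨁ i, FracTerm F (2 * i)) :=
    (hb.comp_two_mul_add (a := fun i => 2 * i) (c := 0) fun i => by ring).finite_directSum
  have : Module.Projective (FractionRing R) (⨁ i, FracTerm F (2 * i)) := projective_directSum
  let α' : R ≃ₗ[R] OddPart F := α.trans (LinearEquiv.ofBijective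
    (DirectSum.lof R ℤ (fun i => F.X (2 * i + 1)) (-1))
    (bijective_lof_of_subsingleton (V := fun i => F.X (2 * i + 1)) _ fun i hi =>
      hX _ (by omega) (by omega)))
  let β' : R ≃ₗ[R] EvenPart F := β.trans (LinearEquiv.ofBijective
    (DirectSum.lof R ℤ (fun i => F.X (2 * i)) 0)
    (bijective_lof_of_subsingleton (V := fun i => F.X (2 * i)) _ fun i hi =>
      hX _ (by omega) (by omega)))
  let γ : (⨁ i, FracTerm F (2 * i)) ≃ₗ[FractionRing R] FractionRing R :=
    (LinearEquiv.ofBijective (DirectSum.lof (FractionRing R) ℤ (fun i => FracTerm F (2 * i)) 0)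
    (bijective_lof_of_subsingleton (V := fun i => FracTerm F (2 * i)) _ fun i hi =>
      hV _ (by omega) (by omega))).symm.trans
    ((β.symm.baseChange R (FractionRing R) _ _).trans
      (TensorProduct.AlgebraTensorModule.rid R (FractionRing R) (FractionRing R)))
  let θ := α'.symm.trans β'
  refine ⟨inferInstance, inferInstance, c.h, θ, c.comm, ?_⟩
  unfold parityDet
  rw [relDet_comp (f := evenMap (toFrac F) ∘ₗ θ.toLinearMap)
    (β := (algebraMap R (FractionRing R) a) • LinearMap.id), LinearMap.pdet_smul_id_of_equiv γ,
      relDet_self (h := fun x => rfl),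
    mul_one]
  intro x
  obtain ⟨r, rfl⟩ := α'.surjective x
  have hθ : θ (α' r) = β' r := by simp [θ]
  change oddToEvenMap (fracDiff F) c.h (oddMap (toFrac F) (α' r)) =
    algebraMap R (FractionRing R) a • evenMap (toFrac F) (θ (α' r))
  rw [hθ]
  have e1 : oddMap (toFrac F) (α' r) =
      DirectSum.lof (FractionRing R) ℤ (fun i => FracTerm F (2 * i + 1)) (-1)
        (toFrac F (2 * (-1) + 1) (α r)) :=
    DirectSum.lmap_lof (fun i => toFrac F (2 * i + 1)) (-1) (α r)
  have e2 : evenMap (toFrac F) (β' r) =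
      DirectSum.lof (FractionRing R) ℤ (fun i => FracTerm F (2 * i)) 0
        (toFrac F (2 * 0) (β r)) :=
    DirectSum.lmap_lof (fun i => toFrac F (2 * i)) 0 (β r)
  have e3 : fracDiff F (2 * (-1) + 1) (2 * (-1 + 1)) (toFrac F (2 * (-1) + 1) (α r)) =
      algebraMap R (FractionRing R) a • toFrac F (2 * 0) (β r) := by
    change (1 : FractionRing R) ⊗ₜ[R] (F.d (-1) 0).hom (α r) = _
    rw [hd, ← smul_eq_mul, map_smul, algebraMap_smul]
    exact (toFrac F 0).map_smul a (β r)
  have := hV (2 * (-1)) (by omega) (by omega)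
  rw [e1, e2, parityMap_lof, e3, Subsingleton.elim (c.h _ (2 * (-1)) _) 0, map_zero, add_zero]
  exact map_smul (DirectSum.lof (FractionRing R) ℤ (fun i => FracTerm F (2 * i)) 0) _ _

end TwoTerm

/-! ### Modules presented by square matrices -/

section MatrixModules

open Matrix

variable {R : Type u} [CommRing R] {n m : Type} [Fintype n] [DecidableEq n] [Fintype m]
  [DecidableEq m]

/-- The cokernel of a square matrix. -/
noncomputable abbrev matrixCoker (A : Matrix n n R) : ModuleCat.{u} R :=
  ModuleCat.of R ((n → R) ⧸ LinearMap.range A.mulVecLin)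

theorem mulVec_injective_of_det_mem {A : Matrix n n R} (hA : A.det ∈ nonZeroDivisors R) :
    Function.Injective A.mulVecLin := by
  rw [injective_iff_map_eq_zero]
  intro x hx
  have : A.det • x = 0 := by
    rw [← Matrix.one_mulVec x, ← Matrix.smul_mulVec, ← Matrix.adjugate_mul,
      ← Matrix.mulVec_mulVec]
    exact (congrArg _ hx).trans (Matrix.mulVec_zero _)
  funext i
  exact (mul_left_mem_nonZeroDivisors_eq_zero_iff hA).mp (congrFun this i)

/-- The presentation of the cokernel of a square matrix. -/
noncomputable abbrev matrixCokerComplex (A : Matrix n n R) : ShortComplex (ModuleCat.{u} R) :=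
  .mk (ModuleCat.ofHom A.mulVecLin) (ModuleCat.ofHom (LinearMap.range A.mulVecLin).mkQ)
    (ModuleCat.hom_ext (LinearMap.range_mkQ_comp _))

theorem shortExact_matrixCokerComplex {A : Matrix n n R} (hA : A.det ∈ nonZeroDivisors R) :
    (matrixCokerComplex A).ShortExact :=
  ModuleCat.shortComplex_shortExact _ (LinearMap.exact_map_mkQ_range _)
    (mulVec_injective_of_det_mem hA) (Submodule.mkQ_surjective _)

theorem det_smul_matrixCoker (A : Matrix n n R) (x : matrixCoker A) : A.det • x = 0 := by
  obtain ⟨x, rfl⟩ := Submodule.mkQ_surjective _ x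
  refine (Submodule.Quotient.mk_eq_zero _).mpr ⟨A.adjugate *ᵥ x, ?_⟩
  rw [Matrix.mulVecLin_apply, Matrix.mulVec_mulVec, Matrix.mul_adjugate, Matrix.smul_mulVec,
    Matrix.one_mulVec]

variable {S : Type u} [CommRing S] {ι : S →+* R}

theorem catP_matrixCoker (hι : TorsionCompatible ι) {A : Matrix n n R}
    (hA : A.det ∈ nonZeroDivisors R) : catP ι (matrixCoker A) := by
  have : Projective (ModuleCat.of R (n → R)) := inferInstance
  exact ⟨inferInstanceAs (Module.Finite R ((n → R) ⧸ _)),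
    (hι _).mpr (isTorsion_of_smul_eq_zero hA (det_smul_matrixCoker A)),
    (shortExact_matrixCokerComplex hA).hasProjectiveDimensionLT_X₃ 1
      (inferInstanceAs (HasProjectiveDimensionLT (ModuleCat.of R (n → R)) 1))
      (hasProjectiveDimensionLT_of_ge (ModuleCat.of R (n → R)) 1 _ (by omega))⟩

/-- The class of the cokernel of a square matrix whose determinant is a nonzerodivisor. -/
noncomputable def matrixClass (hι : TorsionCompatible ι) (A : Matrix n n R)
    (hA : A.det ∈ nonZeroDivisors R) : ExactK0 (catP ι) :=
  ExactK0.of _ (matrixCoker A) (catP_matrixCoker hι hA)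

theorem ExactK0.of_eq_of_iso {C : Type*} [Category C] [Abelian C] {P : ObjectProperty C}
    {Z : C} (hZ : Limits.IsZero Z) (h : P Z) {X Y : C} (e : X ≅ Y) (hX : P X) (hY : P Y) :
    of P X hX = of P Y hY := by
  have h0 := of_eq_add (P := P) (S := .mk (𝟙 Z) (𝟙 Z) (hZ.eq_of_src _ _))
    ⟨ShortComplex.exact_of_isZero_X₂ _ hZ⟩ h h h
  rw [left_eq_add] at h0
  have hS : (ShortComplex.mk e.hom (0 : Y ⟶ Z) Limits.comp_zero).ShortExact :=
    { exact := (ShortComplex.exact_iff_epi _ rfl).mpr inferInstance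
      epi_g := ⟨fun _ _ _ => hZ.eq_of_src _ _⟩ }
  exact ((of_eq_add (P := P) hS hX hY h).trans (by rw [h0, add_zero])).symm

variable (hι : TorsionCompatible ι)

theorem matrixClass_eq_of_equiv {A : Matrix n n R} {B : Matrix m m R}
    (hA : A.det ∈ nonZeroDivisors R) (hB : B.det ∈ nonZeroDivisors R)
    (e : matrixCoker A ≃ₗ[R] matrixCoker B) : matrixClass hι A hA = matrixClass hι B hB := by
  -- The cokernel of the empty matrix serves as the zero object of `𝒫_R`.
  have h1 : (1 : Matrix Empty Empty R).det ∈ nonZeroDivisors R := by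
    rw [Matrix.det_one]
    exact one_mem _
  exact ExactK0.of_eq_of_iso (ModuleCat.isZero_of_subsingleton (matrixCoker 1))
    (catP_matrixCoker hι h1) e.toModuleIso _ _

/-- The class is multiplicative in products. -/
theorem matrixClass_mul {A B : Matrix n n R} (hA : A.det ∈ nonZeroDivisors R)
    (hB : B.det ∈ nonZeroDivisors R) (hAB : (A * B).det ∈ nonZeroDivisors R) :
    matrixClass hι (A * B) hAB = matrixClass hι A hA + matrixClass hι B hB := by
  -- The exact sequence is `0 → coker B → coker (A B) → coker A → 0`, with first map induced by `A`
  -- and second by the identity; its injectivity on the left uses that of `A`.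
  let f : matrixCoker B →ₗ[R] matrixCoker (A * B) := Submodule.mapQ _ _ A.mulVecLin (by
    rintro _ ⟨x, rfl⟩
    exact ⟨x, (Matrix.mulVec_mulVec _ _ _).symm⟩)
  let g : matrixCoker (A * B) →ₗ[R] matrixCoker A := Submodule.mapQ _ _ LinearMap.id (by
    rintro _ ⟨x, rfl⟩
    exact ⟨B *ᵥ x, Matrix.mulVec_mulVec _ _ _⟩)
  have hgf : g ∘ₗ f = 0 := by
    refine Submodule.linearMap_qext _ (LinearMap.ext fun x => ?_)
    exact (Submodule.Quotient.mk_eq_zero _).mpr ⟨x, rfl⟩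
  have hS : (ShortComplex.mk (ModuleCat.ofHom f) (ModuleCat.ofHom g)
      (ModuleCat.hom_ext hgf)).ShortExact := by
    refine ModuleCat.shortComplex_shortExact _ (fun y => ⟨fun hy => ?_, ?_⟩) ?_ ?_
    · obtain ⟨y, rfl⟩ := Submodule.mkQ_surjective _ y
      obtain ⟨x, hx⟩ := (Submodule.Quotient.mk_eq_zero _).mp hy
      exact ⟨Submodule.mkQ _ x, congrArg (Submodule.mkQ _) hx⟩
    · rintro ⟨x, rfl⟩
      exact LinearMap.congr_fun hgf x
    · refine (injective_iff_map_eq_zero f).mpr fun x hx => ?_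
      obtain ⟨x, rfl⟩ := Submodule.mkQ_surjective _ x
      obtain ⟨y, hy⟩ := (Submodule.Quotient.mk_eq_zero _).mp hx
      refine (Submodule.Quotient.mk_eq_zero _).mpr ⟨y, mulVec_injective_of_det_mem hA ?_⟩
      exact (Matrix.mulVec_mulVec _ _ _).trans hy
    · intro x
      obtain ⟨x, rfl⟩ := Submodule.mkQ_surjective _ x
      exact ⟨Submodule.mkQ _ x, rfl⟩
  rw [add_comm]
  exact ExactK0.of_eq_add hS (catP_matrixCoker hι hB) (catP_matrixCoker hι hAB)
    (catP_matrixCoker hι hA)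

theorem matrixClass_congr {A B : Matrix n n R} (h : A = B) (hA : A.det ∈ nonZeroDivisors R)
    (hB : B.det ∈ nonZeroDivisors R) : matrixClass hι A hA = matrixClass hι B hB := by
  subst h
  rfl

/-- The block structure gives `0 → coker A → coker D → coker B → 0` for the block matrix `D`.
Exactness on the left rests on the injectivity of `B`, as in the snake lemma. -/
theorem matrixClass_fromBlocks_zero₂₁ {A : Matrix n n R} {B : Matrix m m R} (X : Matrix n m R)
    (hA : A.det ∈ nonZeroDivisors R) (hB : B.det ∈ nonZeroDivisors R)
    (hD : (fromBlocks A X 0 B).det ∈ nonZeroDivisors R) :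
    matrixClass hι (fromBlocks A X 0 B) hD = matrixClass hι A hA + matrixClass hι B hB := by
  have hD' : ∀ (x : n → R) (y : m → R), fromBlocks A X 0 B *ᵥ Sum.elim x y =
      Sum.elim (A *ᵥ x + X *ᵥ y) (B *ᵥ y) := fun x y => by
    rw [fromBlocks_mulVec]
    simp
  let i : (n → R) →ₗ[R] (n ⊕ m → R) :=
    (LinearEquiv.sumArrowLequivProdArrow n m R R).symm.toLinearMap ∘ₗ LinearMap.inl R _ _
  let p : (n ⊕ m → R) →ₗ[R] (m → R) := LinearMap.funLeft R R Sum.inr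
  have hi : ∀ x, i x = Sum.elim x 0 := fun x => rfl
  let f : matrixCoker A →ₗ[R] matrixCoker (fromBlocks A X 0 B) := Submodule.mapQ _ _ i (by
    rintro _ ⟨x, rfl⟩
    exact ⟨Sum.elim x 0, (hD' x 0).trans (by simp [hi])⟩)
  let g : matrixCoker (fromBlocks A X 0 B) →ₗ[R] matrixCoker B := Submodule.mapQ _ _ p (by
    rintro _ ⟨x, rfl⟩
    obtain ⟨x, y, rfl⟩ : ∃ u v, x = Sum.elim u v :=
      ⟨x ∘ Sum.inl, x ∘ Sum.inr, (Sum.elim_comp_inl_inr x).symm⟩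
    exact ⟨y, (congrArg p (hD' x y)).symm⟩)
  have hgf : g ∘ₗ f = 0 := Submodule.linearMap_qext _ (LinearMap.ext fun x =>
    (Submodule.Quotient.mk_eq_zero _).mpr (Submodule.zero_mem _))
  have hS : (ShortComplex.mk (ModuleCat.ofHom f) (ModuleCat.ofHom g)
      (ModuleCat.hom_ext hgf)).ShortExact := by
    refine ModuleCat.shortComplex_shortExact _ (fun y => ⟨fun hy => ?_, ?_⟩) ?_ ?_
    · obtain ⟨y, rfl⟩ := Submodule.mkQ_surjective _ y
      obtain ⟨x, hx⟩ := (Submodule.Quotient.mk_eq_zero _).mp hy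
      obtain ⟨u, v, rfl⟩ : ∃ u v, y = Sum.elim u v :=
        ⟨y ∘ Sum.inl, y ∘ Sum.inr, (Sum.elim_comp_inl_inr y).symm⟩
      refine ⟨Submodule.mkQ _ (u - X *ᵥ x), ?_⟩
      refine (Submodule.Quotient.eq _).mpr ⟨Sum.elim 0 (-x), (hD' _ _).trans ?_⟩
      have hx' : B *ᵥ x = v := hx
      rw [hi, Matrix.mulVec_zero, Matrix.mulVec_neg, Matrix.mulVec_neg, hx']
      funext k
      rcases k with k | k <;> simp
    · rintro ⟨x, rfl⟩
      exact LinearMap.congr_fun hgf x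
    · refine (injective_iff_map_eq_zero f).mpr fun x hx => ?_
      obtain ⟨x, rfl⟩ := Submodule.mkQ_surjective _ x
      obtain ⟨y, hy⟩ := (Submodule.Quotient.mk_eq_zero _).mp hx
      obtain ⟨u, v, rfl⟩ : ∃ u v, y = Sum.elim u v :=
        ⟨y ∘ Sum.inl, y ∘ Sum.inr, (Sum.elim_comp_inl_inr y).symm⟩
      have hy' := (hD' u v).symm.trans hy
      have hv : v = 0 := mulVec_injective_of_det_mem hB
        ((congrArg (· ∘ Sum.inr) hy').trans (Matrix.mulVec_zero B).symm)
      subst hv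
      refine (Submodule.Quotient.mk_eq_zero _).mpr ⟨u, ?_⟩
      have : A *ᵥ u = i x ∘ Sum.inl := by simpa using congrArg (· ∘ Sum.inl) hy'
      exact this
    · intro x
      obtain ⟨x, rfl⟩ := Submodule.mkQ_surjective _ x
      exact ⟨Submodule.mkQ _ (Sum.elim 0 x), rfl⟩
  exact ExactK0.of_eq_add hS (catP_matrixCoker hι hA) (catP_matrixCoker hι hD)
    (catP_matrixCoker hι hB)

theorem matrixClass_reindex (e : n ≃ m) {A : Matrix n n R} (hA : A.det ∈ nonZeroDivisors R)
    (hA' : (reindex e e A).det ∈ nonZeroDivisors R) :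
    matrixClass hι (reindex e e A) hA' = matrixClass hι A hA := by
  refine (matrixClass_eq_of_equiv hι _ _ (Submodule.Quotient.equiv _ _
    (LinearEquiv.funCongrLeft R R e.symm) ?_)).symm
  ext y
  constructor
  · rintro ⟨_, ⟨x, rfl⟩, rfl⟩
    refine ⟨x ∘ e.symm, ?_⟩
    simp [Matrix.submatrix_mulVec_equiv, Function.comp_assoc]
    rfl
  · rintro ⟨x, rfl⟩
    refine ⟨A *ᵥ (x ∘ e), ⟨x ∘ e, rfl⟩, ?_⟩
    simp [Matrix.submatrix_mulVec_equiv]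
    rfl

end MatrixModules

/-! ### The class of the cokernel of a matrix depends only on the determinant -/

section ScalarClass

open Matrix

variable {S R : Type u} [CommRing S] [CommRing R] {ι : S →+* R} (hι : TorsionCompatible ι)

theorem det_smul_one_mem {n : Type} [Fintype n] [DecidableEq n] {a : R}
    (ha : a ∈ nonZeroDivisors R) : (a • (1 : Matrix n n R)).det ∈ nonZeroDivisors R := by
  rw [Matrix.det_smul, Matrix.det_one, mul_one]
  exact pow_mem ha _

theorem det_one_mem {n : Type} [Fintype n] [DecidableEq n] :
    (1 : Matrix n n R).det ∈ nonZeroDivisors R := by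
  rw [Matrix.det_one]
  exact one_mem _

/-- The class of `R / a`. -/
noncomputable def scalarClass (a : R) (ha : a ∈ nonZeroDivisors R) : ExactK0 (catP ι) :=
  matrixClass hι (a • (1 : Matrix Unit Unit R)) (det_smul_one_mem ha)

theorem scalarClass_congr {a b : R} (h : a = b) (ha : a ∈ nonZeroDivisors R)
    (hb : b ∈ nonZeroDivisors R) : scalarClass hι a ha = scalarClass hι b hb := by
  subst h
  rfl

theorem scalarClass_mul {a b : R} (ha : a ∈ nonZeroDivisors R) (hb : b ∈ nonZeroDivisors R)
    (hab : a * b ∈ nonZeroDivisors R) :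
    scalarClass hι (a * b) hab = scalarClass hι a ha + scalarClass hι b hb := by
  have h : (a * b) • (1 : Matrix Unit Unit R) = (a • 1) * (b • 1) := by
    rw [smul_mul_smul_comm, one_mul]
  have h' := det_smul_one_mem (n := Unit) hab
  unfold scalarClass
  rw [matrixClass_congr hι h h' (h ▸ h'), matrixClass_mul]

theorem scalarClass_one : scalarClass hι 1 (one_mem _) = 0 := by
  have := scalarClass_mul hι (one_mem _) (one_mem _)
    (mul_mem (one_mem (nonZeroDivisors R)) (one_mem _))
  rw [scalarClass_congr hι (mul_one 1) _ (one_mem _)] at this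
  exact left_eq_add.mp this

theorem scalarClass_of_isUnit {a : R} (ha : IsUnit a) :
    scalarClass hι a ha.mem_nonZeroDivisors = 0 := by
  have h1 : (1 : Matrix Empty Empty R).det ∈ nonZeroDivisors R := det_one_mem
  have hs : Subsingleton (matrixCoker (a • (1 : Matrix Unit Unit R))) := by
    refine Submodule.Quotient.subsingleton_iff.mpr (LinearMap.range_eq_top.mpr ?_)
    intro x
    exact ⟨(ha.unit⁻¹ : Rˣ) • x, by simp [Units.smul_def, smul_smul]⟩
  have e : matrixClass hι _ (det_smul_one_mem ha.mem_nonZeroDivisors) =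
      matrixClass hι (1 : Matrix Empty Empty R) h1 :=
    matrixClass_eq_of_equiv hι _ _ (0 : matrixCoker (a • (1 : Matrix Unit Unit R)) ≃ₗ[R]
      matrixCoker (1 : Matrix Empty Empty R))
  have e1 := matrixClass_mul hι h1 h1 (by rwa [one_mul])
  rw [matrixClass_congr hι (one_mul 1) _ h1] at e1
  exact e.trans (left_eq_add.mp e1)

theorem matrixClass_one {n : Type} [Fintype n] [DecidableEq n]
    (h : (1 : Matrix n n R).det ∈ nonZeroDivisors R) : matrixClass hι (1 : Matrix n n R) h = 0 := by
  have e1 := matrixClass_mul hι h h (by rwa [one_mul])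
  rw [matrixClass_congr hι (one_mul 1) _ h] at e1
  exact left_eq_add.mp e1

theorem matrixClass_fromBlocks_zero₁₂ {n m : Type} [Fintype n] [DecidableEq n] [Fintype m]
    [DecidableEq m] {A : Matrix n n R} {B : Matrix m m R} (X : Matrix m n R)
    (hA : A.det ∈ nonZeroDivisors R) (hB : B.det ∈ nonZeroDivisors R)
    (hD : (fromBlocks A 0 X B).det ∈ nonZeroDivisors R) :
    matrixClass hι (fromBlocks A 0 X B) hD = matrixClass hι A hA + matrixClass hι B hB := by
  have h : reindex (Equiv.sumComm n m) (Equiv.sumComm n m) (fromBlocks A 0 X B) =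
      fromBlocks B X 0 A := by
    ext (i | i) (j | j) <;> rfl
  have hD' : (reindex (Equiv.sumComm n m) (Equiv.sumComm n m) (fromBlocks A 0 X B)).det ∈
      nonZeroDivisors R := by rwa [Matrix.det_reindex_self]
  rw [← matrixClass_reindex hι (Equiv.sumComm n m) hD hD', matrixClass_congr hι h hD' (h ▸ hD'),
    matrixClass_fromBlocks_zero₂₁ hι X hB hA, add_comm]

theorem mem_nonZeroDivisors_of_isUnit_algebraMap {K : Type*} [CommRing K] [Algebra R K]
    [IsFractionRing R K] {a : R} (h : IsUnit (algebraMap R K a)) : a ∈ nonZeroDivisors R := by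
  rw [mem_nonZeroDivisors_iff_right]
  intro x hx
  apply IsFractionRing.injective R K
  rw [map_zero, ← h.mul_left_eq_zero, ← map_mul, hx, map_zero]

/-- In a ring with semilocal total ring of fractions, the first column of a matrix whose
determinant is a nonzerodivisor can be made to start with a nonzerodivisor. -/
theorem exists_combination_mem_nonZeroDivisors {K : Type*} [CommRing K] [Algebra R K]
    [IsFractionRing R K] [Finite (MaximalSpectrum K)] {k : ℕ} (P : Matrix Unit Unit R)
    (Q : Matrix Unit (Fin k) R) (V : Matrix (Fin k) Unit R) (T : Matrix (Fin k) (Fin k) R)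
    (h : (fromBlocks P Q V T).det ∈ nonZeroDivisors R) :
    ∃ s ∈ nonZeroDivisors R, ∃ τ : Fin k → R,
      s * P () () + ∑ i, τ i * V i () ∈ nonZeroDivisors R := by
  -- The determinant is a unit of `K`, so the first column cannot vanish modulo a maximal ideal of
  -- `K`.
  obtain ⟨t, ht⟩ := exists_isUnit_add_sum (algebraMap R K (P () ()))
    (fun i => algebraMap R K (V i ())) (fun m hm => by
      by_contra! hcon
      have hu : IsUnit (algebraMap R K (fromBlocks P Q V T).det) :=
        IsLocalization.map_units K ⟨_, h⟩
      refine hm.ne_top (Ideal.eq_top_of_isUnit_mem _ ?_ hu)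
      rw [← Ideal.Quotient.eq_zero_iff_mem, ← RingHom.comp_apply, RingHom.map_det]
      refine Matrix.det_eq_zero_of_column_eq_zero (Sum.inl ()) ?_
      rintro (⟨⟩ | i)
      · exact Ideal.Quotient.eq_zero_iff_mem.mpr hcon.1
      · exact Ideal.Quotient.eq_zero_iff_mem.mpr (hcon.2 i))
  -- The coefficients lie in `K`; a common denominator `s` brings them back to `R`.
  obtain ⟨s, hs⟩ := IsLocalization.exist_integer_multiples_of_finite (nonZeroDivisors R) t
  choose τ hτ using hs
  refine ⟨s, s.2, τ, mem_nonZeroDivisors_of_isUnit_algebraMap (K := K) ?_⟩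
  have : algebraMap R K (s * P () () + ∑ i, τ i * V i ()) = algebraMap R K s *
      (algebraMap R K (P () ()) + ∑ i, t i * algebraMap R K (V i ())) := by
    rw [map_add, map_mul, map_sum, mul_add, Finset.mul_sum]
    congr 1
    refine Finset.sum_congr rfl fun i _ => ?_
    rw [map_mul, hτ, ← mul_assoc]
    congr 1
    exact Algebra.smul_def _ _
  rw [this]
  exact (IsLocalization.map_units K s).mul ht

/-- The class of the cokernel of a matrix is the class of the cokernel of its determinant. -/
theorem matrixClass_eq_scalarClass [Finite (MaximalSpectrum (FractionRing R))] {k : ℕ}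
    (A : Matrix (Fin k) (Fin k) R) (hA : A.det ∈ nonZeroDivisors R) :
    matrixClass hι A hA = scalarClass hι A.det hA := by
  induction k with
  | zero =>
    rw [matrixClass_congr hι (Subsingleton.elim A 1) hA det_one_mem, matrixClass_one,
      scalarClass_congr hι (by simp) hA (one_mem _), scalarClass_one]
  | succ k ih =>
    let e : Fin (k + 1) ≃ Unit ⊕ Fin k := Fintype.equivOfCardEq (by simp [add_comm])
    have hA' : (reindex e e A).det ∈ nonZeroDivisors R := by rwa [Matrix.det_reindex_self]
    rw [← matrixClass_reindex hι e hA hA',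
      scalarClass_congr hι (Matrix.det_reindex_self e A).symm hA hA']
    generalize reindex e e A = B at hA'
    obtain ⟨P, Q, V, T, rfl⟩ : ∃ P Q V T, B = fromBlocks P Q V T :=
      ⟨_, _, _, _, (fromBlocks_toBlocks B).symm⟩
    obtain ⟨s, hs, τ, hb⟩ :=
      exists_combination_mem_nonZeroDivisors (K := FractionRing R) P Q V T hA'
    set b := s * P () () + ∑ i, τ i * V i ()
    -- Multiplication by `L` puts the nonzerodivisor `b` in the corner, and `L'` scales the lower
    -- rows by `b` and clears the column below it. Both are block triangular with scalar blocks, so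
    -- their classes are known, and `W` is smaller by one.
    let L : Matrix (Unit ⊕ Fin k) (Unit ⊕ Fin k) R := fromBlocks (s • 1) (replicateRow Unit τ) 0 1
    let L' : Matrix (Unit ⊕ Fin k) (Unit ⊕ Fin k) R := fromBlocks 1 0 (-V) (b • 1)
    let Q' := s • Q + replicateRow Unit τ * T
    let W := -V * Q' + b • T
    have hL : L.det = s := by simp [L]
    have hL' : L'.det = b ^ k := by simp [L', Matrix.det_fromBlocks_zero₁₂]
    have hprod : L' * (L * fromBlocks P Q V T) = fromBlocks (b • 1) Q' 0 W := by
      have h1 : s • P + replicateRow Unit τ * V = b • (1 : Matrix Unit Unit R) := by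
        ext ⟨⟩ ⟨⟩
        simp [b, Matrix.mul_apply]
      simp only [L, L', fromBlocks_multiply, Matrix.smul_mul, Matrix.one_mul, Matrix.zero_mul,
        add_zero, zero_add, h1]
      congr 1
      simp
    have hdet : b ^ k * (s * (fromBlocks P Q V T).det) = b * W.det := by
      have := congrArg Matrix.det hprod
      rw [Matrix.det_mul, Matrix.det_mul, hL, hL', Matrix.det_fromBlocks_zero₂₁] at this
      simpa using this
    have hbk : b ^ k ∈ nonZeroDivisors R := pow_mem hb k
    have hsA := mul_mem hs hA'
    have hbW : b * W.det ∈ nonZeroDivisors R := hdet ▸ mul_mem hbk hsA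
    have hW : W.det ∈ nonZeroDivisors R := (mul_mem_nonZeroDivisors.mp hbW).2
    have hLm : L.det ∈ nonZeroDivisors R := hL ▸ hs
    have hLm' : L'.det ∈ nonZeroDivisors R := hL' ▸ hbk
    have hLB : (L * fromBlocks P Q V T).det ∈ nonZeroDivisors R := by
      rw [Matrix.det_mul, hL]
      exact hsA
    have hLLB : (L' * (L * fromBlocks P Q V T)).det ∈ nonZeroDivisors R := by
      rw [Matrix.det_mul]
      exact mul_mem hLm' hLB
    have e1 := matrixClass_mul hι hLm' hLB hLLB
    have e0 : matrixClass hι (b • (1 : Matrix (Fin k) (Fin k) R)) (det_smul_one_mem hb) =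
        scalarClass hι (b ^ k) hbk :=
      (ih _ _).trans (scalarClass_congr hι (by simp) _ _)
    rw [matrixClass_mul hι hLm hA' hLB, matrixClass_congr hι hprod hLLB (hprod ▸ hLLB),
      matrixClass_fromBlocks_zero₂₁ hι _ (det_smul_one_mem hb) hW, ih W hW,
      matrixClass_fromBlocks_zero₂₁ hι _ (det_smul_one_mem hs) det_one_mem,
      matrixClass_fromBlocks_zero₁₂ hι _ det_one_mem (det_smul_one_mem hb),
      e0, matrixClass_one, matrixClass_one, zero_add, add_zero] at e1
    change scalarClass hι b hb + _ = _ + (scalarClass hι s hs + _) at e1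
    -- The same relation holds between the classes of the matrices and between those of their
    -- determinants; cancelling `[b ^ k]` and `[s]` isolates the given matrix.
    have e2 := scalarClass_congr hι hdet (mul_mem hbk hsA) hbW
    rw [scalarClass_mul hι hbk hsA, scalarClass_mul hι hs hA', scalarClass_mul hι hb hW, e1] at e2
    exact (add_left_cancel (add_left_cancel e2)).symm

end ScalarClass

/-! ### Fitting ideals -/

section Fitting

open Matrix

variable {R : Type*} [CommRing R] {M : Type*} [AddCommGroup M] [Module R M]

theorem exists_matrix_sum_smul_eq {k : ℕ} {v : Fin k → M}
    (hv : Submodule.span R (Set.range v) = ⊤) {n : Type*} (e : n → M) :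
    ∃ X : Matrix n (Fin k) R, ∀ i, e i = ∑ j, X i j • v j := by
  have h : ∀ i, ∃ x : Fin k → R, ∑ j, x j • v j = e i := fun i =>
    (Submodule.mem_span_range_iff_exists_fun R).mp (hv ▸ Submodule.mem_top)
  choose X hX using h
  exact ⟨X, fun i => (hX i).symm⟩

/-- The Fitting ideal of a module presented by a square matrix. -/
theorem fittingIdeal_eq_span_det {k : ℕ} (A : Matrix (Fin k) (Fin k) R) (π : (Fin k → R) →ₗ[R] M)
    (hπ : Function.Surjective π) (hker : LinearMap.ker π = LinearMap.range A.mulVecLin) :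
    fittingIdeal R M = Ideal.span {A.det} := by
  let e : Fin k → M := fun i => π (Pi.single i 1)
  have hπe : ∀ x, π x = ∑ i, x i • e i := fun x => by
    conv_lhs => rw [pi_eq_sum_univ' x, map_sum]
    exact Finset.sum_congr rfl fun i _ => map_smul π _ _
  have he : Submodule.span R (Set.range e) = ⊤ := by
    refine eq_top_iff.mpr fun y _ => ?_
    obtain ⟨x, rfl⟩ := hπ y
    rw [hπe]
    exact Submodule.sum_mem _ fun i _ => Submodule.smul_mem _ _ (Submodule.subset_span ⟨i, rfl⟩)
  have hrel : ∀ x : Fin k → R, ∑ i, x i • e i = 0 → ∃ y, A *ᵥ y = x := fun x hx => by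
    have : x ∈ LinearMap.ker π := (hπe x).trans hx
    rwa [hker] at this
  refine le_antisymm (Ideal.span_le.mpr ?_) (Ideal.span_mono ?_)
  · rintro _ ⟨l, v, B, hv, hB, rfl⟩
    -- The two generating families are expressed in each other. Then the rows of `B Y` and of `1 - X
    -- Y` are relations between the `e i`, hence lie in the image of `A`.
    obtain ⟨X, hX⟩ := exists_matrix_sum_smul_eq hv e
    obtain ⟨Y, hY⟩ := exists_matrix_sum_smul_eq he v
    have hC : ∀ i, ∃ y, A *ᵥ y = (B * Y) i := fun i => hrel _ (by
      rw [← hB i]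
      simp_rw [hY, Finset.smul_sum, smul_smul, Matrix.mul_apply, Finset.sum_smul]
      exact Finset.sum_comm)
    have hC' : ∀ i, ∃ y, A *ᵥ y = (1 - X * Y : Matrix (Fin k) (Fin k) R) i := fun i => hrel _ (by
      simp_rw [Matrix.sub_apply, sub_smul, Finset.sum_sub_distrib, Matrix.mul_apply,
        Finset.sum_smul, Matrix.one_apply, ite_smul, one_smul, zero_smul,
        Finset.sum_ite_eq, Finset.mem_univ, if_true, sub_eq_zero]
      rw [Finset.sum_comm]
      simp_rw [← smul_smul, ← Finset.smul_sum, ← hY]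
      exact hX i)
    choose C hC using hC
    choose C' hC' using hC'
    have h1 : (Matrix.of C : Matrix (Fin l) (Fin k) R) * Aᵀ = B * Y := by
      ext i j
      rw [← hC, Matrix.mul_apply]
      exact Finset.sum_congr rfl fun _ _ => mul_comm _ _
    have h2 : (Matrix.of C' : Matrix (Fin k) (Fin k) R) * Aᵀ = 1 - X * Y := by
      ext i j
      rw [← hC', Matrix.mul_apply]
      exact Finset.sum_congr rfl fun _ _ => mul_comm _ _
    -- The left side has determinant `det B`, and the last factor has determinant `det A`. So `det
    -- A` divides `det B`, whatever the number `l` of generators.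
    have h3 : fromBlocks B 0 (-X) (1 : Matrix (Fin k) (Fin k) R) =
        fromBlocks B (Matrix.of C) (-X) (Matrix.of C') * fromBlocks 1 (-Y) 0 Aᵀ := by
      rw [fromBlocks_multiply, h1, h2]
      simp
    have h4 := congrArg Matrix.det h3
    rw [Matrix.det_mul, Matrix.det_fromBlocks_zero₁₂, Matrix.det_fromBlocks_zero₂₁,
      Matrix.det_one, Matrix.det_one, mul_one, one_mul, Matrix.det_transpose] at h4
    exact h4 ▸ Ideal.mul_mem_left _ _ (Ideal.subset_span rfl)
  · rintro _ rfl
    refine ⟨k, e, Aᵀ, he, fun i => ?_, Matrix.det_transpose _⟩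
    have : π (A *ᵥ Pi.single i 1) = 0 := by
      change _ ∈ LinearMap.ker π
      rw [hker]
      exact ⟨_, rfl⟩
    rw [hπe] at this
    simpa using this

end Fitting

/-! ### Presentations by square matrices -/

section Presentation

open Matrix

variable {S R : Type u} [CommRing S] [CommRing R] {ι : S →+* R} (hι : TorsionCompatible ι)

/-- A finitely generated torsion module of projective dimension at most one over a semilocal
ring is the cokernel of a square matrix. -/
theorem exists_linearEquiv_matrixCoker [IsNoetherianRing R] [Finite (MaximalSpectrum R)]
    (hι : TorsionCompatible ι) {P : ModuleCat.{u} R} (hP : catP ι P) :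
    ∃ (k : ℕ) (A : Matrix (Fin k) (Fin k) R) (_ : A.det ∈ nonZeroDivisors R),
      Nonempty (matrixCoker A ≃ₗ[R] P) := by
  obtain ⟨h1, h2, h3⟩ := hP
  obtain ⟨s, hs, hs0, m, g, -, hg, -, -⟩ :=
    exists_quotient_range_smul_surjective ((hι P).mp h2)
  have hS := LinearMap.shortExact_shortComplexKer hg
  have hpd : HasProjectiveDimensionLT (ModuleCat.of R (LinearMap.ker g)) 1 :=
    hS.hasProjectiveDimensionLT_X₁ 1
      (inferInstanceAs (HasProjectiveDimensionLT (ModuleCat.of R (Fin m → R)) 1)) h3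
  have hproj : Projective (ModuleCat.of R (LinearMap.ker g)) :=
    projective_iff_hasProjectiveDimensionLT_one.mpr hpd
  have : Module.Projective R (LinearMap.ker g) :=
    (IsProjective.iff_projective (R := R) (LinearMap.ker g)).mpr hproj
  have hmem : ∀ x, s • x ∈ LinearMap.ker g := fun x => by
    rw [LinearMap.mem_ker, map_smul, hs0]
  -- As `s` kills `P`, the inclusion of the kernel becomes an isomorphism over `Frac(R)`. The
  -- projective kernel thus has the rank of `Rᵐ`, so it is isomorphic to `Rᵐ`.
  let u := (LinearMap.ker g).subtype.baseChange (FractionRing R)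
  have hu : Function.Bijective u := by
    refine ⟨Module.Flat.lTensor_preserves_injective_linearMap _ Subtype.val_injective, fun x => ?_⟩
    induction x using TensorProduct.induction_on with
    | zero => exact ⟨0, map_zero _⟩
    | tmul a x =>
      obtain ⟨b, hb⟩ := IsLocalization.map_units (FractionRing R) ⟨s, hs⟩
      refine ⟨(a * ↑b⁻¹) ⊗ₜ ⟨s • x, hmem x⟩, ?_⟩
      change (a * ↑b⁻¹) ⊗ₜ[R] (s • x) = _
      rw [TensorProduct.tmul_smul, TensorProduct.smul_tmul', Algebra.smul_def]
      change (algebraMap R (FractionRing R) s * _) ⊗ₜ[R] x = _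
      rw [← hb, mul_left_comm, Units.mul_inv, mul_one]
    | add x y hx hy =>
      obtain ⟨x, rfl⟩ := hx
      obtain ⟨y, rfl⟩ := hy
      exact ⟨x + y, map_add _ _ _⟩
  obtain ⟨e⟩ := nonempty_linearEquiv_of_rankAtStalk_eq (R := R) (Fin m → R) (LinearMap.ker g)
    fun 𝔭 => (rankAtStalk_eq_of_isBaseChange_fractionRing
      (TensorProduct.isBaseChange R (LinearMap.ker g) (FractionRing R))
      (TensorProduct.isBaseChange R (Fin m → R) (FractionRing R))
      (LinearEquiv.ofBijective u hu) 𝔭).symm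
  let f : (Fin m → R) →ₗ[R] (Fin m → R) := (LinearMap.ker g).subtype ∘ₗ e.toLinearMap
  let A := LinearMap.toMatrix' f
  have hA : A.mulVecLin = f := Matrix.toLin'_toMatrix' f
  have hrange : LinearMap.range A.mulVecLin = LinearMap.ker g := by
    rw [hA, LinearMap.range_comp, LinearEquiv.range, Submodule.map_top, Submodule.range_subtype]
  -- Since `s Rᵐ` lies in the image of `A`, there is a matrix with `A B = s`; hence `det A` divides
  -- `s ^ m` and is a nonzerodivisor.
  have hB : ∀ j, ∃ y, A *ᵥ y = s • Pi.single j 1 := fun j => by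
    have := hmem (Pi.single j 1)
    rwa [← hrange] at this
  choose B hB using hB
  have hAB : A * (Matrix.of B)ᵀ = s • 1 := by
    ext i j
    have := congrFun (hB j) i
    rw [Matrix.mul_apply]
    refine this.trans ?_
    rw [Pi.smul_apply, Matrix.smul_apply, Matrix.one_apply, Pi.single_apply]
  have hdet : A.det * (Matrix.of B)ᵀ.det ∈ nonZeroDivisors R := by
    rw [← Matrix.det_mul, hAB]
    exact det_smul_one_mem hs
  exact ⟨m, A, (mul_mem_nonZeroDivisors.mp hdet).1,
    ⟨(Submodule.quotEquivOfEq _ _ hrange).trans (g.quotKerEquivOfSurjective hg)⟩⟩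

end Presentation

/-! ### The determinant of a cyclic module and the main theorem for semilocal rings -/

section Cyclic

open DerivedCategory Pretriangulated
open CochainComplex (mappingCone)
open CochainComplex.mappingCone (inl inr fst snd)

variable {S R : Type u} [CommRing S] [CommRing R] {ι : S →+* R}

/-- The term of degree `-1` of the mapping cone of a map between complexes in degree zero. -/
noncomputable def mappingConeXNegOneIso {C : Type*} [Category C] [Abelian C]
    {F G : CochainComplex C ℤ} (f : F ⟶ G) (hG : Limits.IsZero (G.X (-1))) :
    F.X 0 ≅ (mappingCone f).X (-1) where
  hom := (inl f).v 0 (-1) rfl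
  inv := (fst f).1.v (-1) 0 rfl
  hom_inv_id := CochainComplex.mappingCone.inl_v_fst_v f 0 (-1) rfl
  inv_hom_id := by
    have := CochainComplex.mappingCone.id_X f (-1) 0 rfl
    rwa [hG.eq_of_tgt ((snd f).v (-1) (-1) (add_zero _)) 0, Limits.zero_comp, add_zero] at this

/-- The term of degree `0` of the mapping cone of a map between complexes in degree zero. -/
noncomputable def mappingConeXZeroIso {C : Type*} [Category C] [Abelian C]
    {F G : CochainComplex C ℤ} (f : F ⟶ G) (hF : Limits.IsZero (F.X 1)) :
    G.X 0 ≅ (mappingCone f).X 0 where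
  hom := (inr f).f 0
  inv := (snd f).v 0 0 (add_zero 0)
  hom_inv_id := CochainComplex.mappingCone.inr_f_snd_v f 0
  inv_hom_id := by
    have := CochainComplex.mappingCone.id_X f 0 1 rfl
    rwa [hF.eq_of_tgt ((fst f).1.v 0 1 rfl) 0, Limits.zero_comp, zero_add] at this

theorem mappingConeXNegOneIso_hom_d {C : Type*} [Category C] [Abelian C]
    {F G : CochainComplex C ℤ} (f : F ⟶ G) (hG : Limits.IsZero (G.X (-1)))
    (hF : Limits.IsZero (F.X 1)) : (mappingConeXNegOneIso f hG).hom ≫ (mappingCone f).d (-1) 0 =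
      f.f 0 ≫ (mappingConeXZeroIso f hF).hom := by
  have := CochainComplex.mappingCone.inl_v_d f 0 (-1) 1 rfl rfl
  rwa [hF.eq_of_tgt (F.d 0 1) 0, Limits.zero_comp, sub_zero] at this

variable (a : R)

/-- The complex `R → R` given by the multiplication by `a`. -/
noncomputable abbrev cyclicComplex : CochainComplex (ModuleCat.{u} R) ℤ :=
  mappingCone ((HomologicalComplex.single (ModuleCat.{u} R) (ComplexShape.up ℤ) 0).map
    (matrixCokerComplex (a • (1 : Matrix Unit Unit R))).f)

theorem isPerfectComplex_cyclicComplex : IsPerfectComplex (cyclicComplex a) :=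
  (isPerfectComplex_single (ModuleCat.of R (Unit → R))).mappingCone
    (isPerfectComplex_single (ModuleCat.of R (Unit → R))) _

theorem hasDet_cyclicComplex (c : FracContraction (cyclicComplex a)) :
    HasDet (cyclicComplex a) (algebraMap R (FractionRing R) a) := by
  set f := (HomologicalComplex.single (ModuleCat.{u} R) (ComplexShape.up ℤ) 0).map
    (matrixCokerComplex (a • (1 : Matrix Unit Unit R))).f with hf
  let G := (HomologicalComplex.single (ModuleCat.{u} R) (ComplexShape.up ℤ) 0).obj
    (ModuleCat.of R (Unit → R))
  have hz : ∀ i : ℤ, i ≠ 0 → Limits.IsZero (G.X i) := fun i hi =>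
    HomologicalComplex.isZero_single_obj_X _ _ _ _ hi
  let e : R ≃ₗ[R] G.X 0 := (LinearEquiv.funUnique Unit R R).symm.trans
    (HomologicalComplex.singleObjXSelf (ComplexShape.up ℤ) 0
      (ModuleCat.of R (Unit → R))).symm.toLinearEquiv
  have he : ∀ r, (f.f 0).hom (e r) = e (a * r) := fun r => by
    rw [hf, HomologicalComplex.single_map_f_self]
    simp only [ModuleCat.hom_comp, LinearMap.comp_apply]
    have h1 : (matrixCokerComplex (a • (1 : Matrix Unit Unit R))).f.hom
        ((HomologicalComplex.singleObjXSelf (ComplexShape.up ℤ) 0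
          (ModuleCat.of R (Unit → R))).hom.hom (e r)) = fun _ => a * r := by
      have : (HomologicalComplex.singleObjXSelf (ComplexShape.up ℤ) 0
        (ModuleCat.of R (Unit → R))).hom.hom (e r) = fun _ => r :=
        (HomologicalComplex.singleObjXSelf
          (ComplexShape.up ℤ) 0 _).symm.toLinearEquiv.symm_apply_apply _
      refine (congrArg _ this).trans ?_
      ext
      simp
    exact congrArg _ h1
  refine HasDet.of_twoTerm (isPerfectComplex_cyclicComplex a) c (fun i h0 h1 => ?_)
    (e.trans (mappingConeXNegOneIso f (hz _ (by decide))).toLinearEquiv)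
    (e.trans (mappingConeXZeroIso f (hz _ (by decide))).toLinearEquiv) a fun r => ?_
  · exact isZero_mappingCone_X f i (hz _ (by omega)) (hz _ h0)
  · have := ConcreteCategory.congr_hom (mappingConeXNegOneIso_hom_d f (hz _ (by decide))
      (hz _ (by decide))) (e r)
    refine this.trans ?_
    exact congrArg (mappingConeXZeroIso f (hz _ (by decide))).hom.hom (he r)

/-- Invertible fractional ideals over a semilocal ring are principal. A generator is a unit because
its product with a generator of the inverse ideal generates the unit ideal. -/
theorem exists_principalUnit_eq [Finite (MaximalSpectrum R)] (J : InvertibleIdeals R) :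
    ∃ x, principalUnit R x = J := by
  have hfin : {I : Ideal R | I.IsMaximal}.Finite := by
    refine (Set.finite_range fun m : MaximalSpectrum R => m.asIdeal).subset ?_
    exact fun I hI => ⟨⟨I, hI⟩, rfl⟩
  have key : ∀ J : InvertibleIdeals R, ∃ x : FractionRing R,
      (J : FractionalIdeal (nonZeroDivisors R) (FractionRing R)) =
        FractionalIdeal.spanSingleton _ x := fun J => by
    obtain ⟨x, hx⟩ := FractionalIdeal.isPrincipal.of_finite_maximals_of_inv le_rfl hfin
      (J : FractionalIdeal (nonZeroDivisors R) (FractionRing R)) _ J.mul_inv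
    exact ⟨x, FractionalIdeal.coeToSubmodule_injective (by
      exact hx.trans (FractionalIdeal.coe_spanSingleton _ _).symm)⟩
  obtain ⟨x, hx⟩ := key J
  obtain ⟨y, hy⟩ := key J⁻¹
  have hxy : FractionalIdeal.spanSingleton (nonZeroDivisors R) (x * y) = 1 := by
    rw [← FractionalIdeal.spanSingleton_mul_spanSingleton, ← hx, ← hy, Units.mul_inv]
  have h1 : (1 : FractionRing R) ∈ FractionalIdeal.spanSingleton (nonZeroDivisors R) (x * y) := by
    rw [hxy]
    exact FractionalIdeal.one_mem_one _
  obtain ⟨r, hr⟩ := (FractionalIdeal.mem_spanSingleton _).mp h1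
  have hxu : IsUnit x := IsUnit.of_mul_eq_one (r • y) (by rw [mul_smul_comm, hr])
  exact ⟨hxu.unit, Units.ext hx.symm⟩

/-- The element `a` as a unit of the ring of fractions. -/
noncomputable def fractionUnit {a : R} (ha : a ∈ nonZeroDivisors R) : (FractionRing R)ˣ :=
  (IsLocalization.map_units (FractionRing R) ⟨a, ha⟩).unit

theorem nonempty_cyclicComplex_iso [HasDerivedCategory.{w} (ModuleCat.{u} R)] {a : R}
    (ha : a ∈ nonZeroDivisors R) :
    Nonempty (Q.obj (cyclicComplex a) ≅ (singleFunctor (ModuleCat.{u} R) 0).obj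
      (matrixCoker (a • (1 : Matrix Unit Unit R)))) := by
  have hT := (shortExact_matrixCokerComplex
    (det_smul_one_mem (n := Unit) ha)).singleTriangle_distinguished
  exact ⟨Triangle.π₃.mapIso (isoTriangleOfIso₁₂ _ _ (mappingCone_triangle_distinguished
    ((HomologicalComplex.single (ModuleCat.{u} R) (ComplexShape.up ℤ) 0).map
    (matrixCokerComplex (a • (1 : Matrix Unit Unit R))).f)) hT (Iso.refl _) (Iso.refl _)
    ((Category.comp_id _).trans (Category.id_comp _).symm))⟩

variable [IsNoetherianRing R] [Finite (MaximalSpectrum R)] (hι : TorsionCompatible ι)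

/-- One and the same element, the determinant of a square presentation, governs the class in `K₀`
and the Fitting ideal. -/
theorem exists_of_eq_scalarClass (P : ModuleCat.{u} R) (hP : catP ι P) :
    ∃ (a : R) (ha : a ∈ nonZeroDivisors R), ExactK0.of _ P hP = scalarClass hι a ha ∧
      fittingIdeal R P = Ideal.span {a} := by
  obtain ⟨k, A, hA, ⟨e⟩⟩ := exists_linearEquiv_matrixCoker hι hP
  refine ⟨A.det, hA, ?_, ?_⟩
  · rw [← matrixClass_eq_scalarClass hι A hA]
    have h1 : (1 : Matrix Empty Empty R).det ∈ nonZeroDivisors R := det_one_mem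
    exact ExactK0.of_eq_of_iso (ModuleCat.isZero_of_subsingleton (matrixCoker 1))
      (catP_matrixCoker hι h1) e.symm.toModuleIso _ _
  · refine fittingIdeal_eq_span_det A (e.toLinearMap ∘ₗ Submodule.mkQ _)
      (e.surjective.comp (Submodule.mkQ_surjective _)) ?_
    rw [LinearEquiv.ker_comp, Submodule.ker_mkQ]

theorem exists_eq_scalarClass_sub (x : ExactK0 (catP ι)) :
    ∃ (a b : R) (ha : a ∈ nonZeroDivisors R) (hb : b ∈ nonZeroDivisors R),
      x = scalarClass hι a ha - scalarClass hι b hb := by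
  let H : AddSubgroup (ExactK0 (catP ι)) :=
    { carrier := {x | ∃ (a b : R) (ha : a ∈ nonZeroDivisors R) (hb : b ∈ nonZeroDivisors R),
        x = scalarClass hι a ha - scalarClass hι b hb}
      zero_mem' := ⟨1, 1, one_mem _, one_mem _, (sub_self _).symm⟩
      add_mem' := by
        rintro _ _ ⟨a, b, ha, hb, rfl⟩ ⟨a', b', ha', hb', rfl⟩
        refine ⟨a * a', b * b', mul_mem ha ha', mul_mem hb hb', ?_⟩
        rw [scalarClass_mul hι ha ha', scalarClass_mul hι hb hb']
        abel
      neg_mem' := by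
        rintro _ ⟨a, b, ha, hb, rfl⟩
        exact ⟨b, a, hb, ha, neg_sub _ _⟩ }
  refine ExactK0.mem_of_forall_of_mem (H := H) (fun P hP => ?_) x
  obtain ⟨a, ha, h, -⟩ := exists_of_eq_scalarClass hι P hP
  exact ⟨a, 1, ha, one_mem _, by rw [h, scalarClass_one, sub_zero]⟩

variable [HasDerivedCategory.{w} (ModuleCat.{u} R)]

/-- The complex `R → R` given by `a` represents `R / a`, and its `d + h` has determinant `a`. The
sign comes from the inverse in the definition of `detClass`. -/
theorem detHom_resolutionHom_scalarClass {a : R} (ha : a ∈ nonZeroDivisors R) :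
    detHom.{w} hι (resolutionHom.{w} hι (ExactK0.incl (catP_le_catQ ι) (scalarClass hι a ha))) =
      -Additive.ofMul (principalUnit R (fractionUnit ha)) := by
  have hM := catP_le_catQ ι _ (catP_matrixCoker hι (det_smul_one_mem (n := Unit) ha))
  obtain ⟨e⟩ := nonempty_cyclicComplex_iso.{w} ha
  have hD := derivedPerfTor_of_perfect hι (isPerfectComplex_cyclicComplex a) (Iso.refl _) fun i =>
    (isTorsion_homologyFunctor_single.{w} ((hι _).mp hM.2.1) i).of_linearEquiv
      ((homologyFunctor (ModuleCat.{u} R) i).mapIso e.symm).toLinearEquiv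
  have hF : IsPerfectTorsion ι (cyclicComplex a) := ⟨isPerfectComplex_cyclicComplex a, fun i =>
    (hι _).mpr ((isTorsion_homologyFunctor hι hD i).of_linearEquiv
      ((homologyFunctorFactors (ModuleCat.{u} R) i).app (cyclicComplex a)).toLinearEquiv)⟩
  obtain ⟨c⟩ := hF.1.nonempty_fracContraction (hF.isTorsion hι)
  have h1 : resolutionHom.{w} hι (ExactK0.incl (catP_le_catQ ι) (scalarClass hι a ha)) =
      complexClass.{w} ι (cyclicComplex a) hF :=
    (resolutionHom_of hι hM).trans (TriangulatedK0.of_eq_of_iso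
      (derivedPerfTor_of_isZero hι (Limits.isZero_zero _)) e.symm _ _)
  rw [h1, detHom_complexClass, HasDet.detClass_eq (x := fractionUnit ha) hF.1
    (hasDet_cyclicComplex a c), ofMul_inv]

/-- The homomorphism `Fitt`. -/
noncomputable def fittingHom : ExactK0 (catP ι) →+ Additive (InvertibleIdeals R) :=
  -- With this definition additivity and the anticommutativity of the diagram are automatic; the
  -- content is moved to `fittingHom_of`, the computation by Fitting ideals.
  -((detHom.{w} hι).comp (resolutionHom.{w} hι)).comp (ExactK0.incl (catP_le_catQ ι))

theorem fittingHom_scalarClass {a : R} (ha : a ∈ nonZeroDivisors R) :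
    fittingHom.{w} hι (scalarClass hι a ha) =
      Additive.ofMul (principalUnit R (fractionUnit ha)) := by
  rw [fittingHom, AddMonoidHom.neg_apply, AddMonoidHom.comp_apply, AddMonoidHom.comp_apply,
    detHom_resolutionHom_scalarClass, neg_neg]

theorem fittingHom_of (P : ModuleCat.{u} R) (hP : catP ι P) :
    ((fittingHom.{w} hι (ExactK0.of _ P hP)).toMul :
      FractionalIdeal (nonZeroDivisors R) (FractionRing R)) = ↑(fittingIdeal R P) := by
  obtain ⟨a, ha, h1, h2⟩ := exists_of_eq_scalarClass hι P hP
  rw [h1, fittingHom_scalarClass, h2, FractionalIdeal.coeIdeal_span_singleton]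
  rfl

/-- Two nonzerodivisors generating the same ideal differ by a unit, and the class of a unit is zero.
-/
theorem fittingHom_injective : Function.Injective (fittingHom.{w} hι) := by
  rw [injective_iff_map_eq_zero]
  intro x hx
  obtain ⟨a, b, ha, hb, rfl⟩ := exists_eq_scalarClass_sub hι x
  rw [map_sub, fittingHom_scalarClass, fittingHom_scalarClass, sub_eq_zero] at hx
  have h : Ideal.span {a} = Ideal.span {b} := by
    apply FractionalIdeal.coeIdeal_injective' (P := FractionRing R) (le_refl (nonZeroDivisors R))
    simp only [FractionalIdeal.coeIdeal_span_singleton]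
    exact congrArg Units.val (Additive.ofMul.injective hx)
  obtain ⟨c, hc⟩ := Ideal.mem_span_singleton'.mp (h ▸ Ideal.mem_span_singleton_self a)
  obtain ⟨d, hd⟩ := Ideal.mem_span_singleton'.mp (h.symm ▸ Ideal.mem_span_singleton_self b)
  have hcu : IsUnit c := by
    refine IsUnit.of_mul_eq_one d ?_
    have : (c * d - 1) * a = 0 := by rw [sub_mul, one_mul, mul_assoc, hd, hc, sub_self]
    exact sub_eq_zero.mp ((mul_right_mem_nonZeroDivisors_eq_zero_iff ha).mp this)
  rw [scalarClass_congr hι hc.symm ha (mul_mem hcu.mem_nonZeroDivisors hb),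
    scalarClass_mul hι hcu.mem_nonZeroDivisors hb, scalarClass_of_isUnit hι hcu, zero_add, sub_self]

/-- An invertible ideal has a generator `a / b`, and comes from `[R/a] - [R/b]`. -/
theorem fittingHom_surjective : Function.Surjective (fittingHom.{w} hι) := by
  intro J
  obtain ⟨x, hx⟩ := exists_principalUnit_eq J.toMul
  obtain ⟨⟨a, b, hb⟩, hab⟩ := IsLocalization.surj (nonZeroDivisors R) (x : FractionRing R)
  have e : (x * fractionUnit hb : (FractionRing R)ˣ) = algebraMap R (FractionRing R) a := hab
  have ha : a ∈ nonZeroDivisors R :=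
    mem_nonZeroDivisors_of_isUnit_algebraMap (K := FractionRing R) (e ▸ Units.isUnit _)
  have e' : fractionUnit ha = x * fractionUnit hb := Units.ext e.symm
  refine ⟨scalarClass hι a ha - scalarClass hι b hb, ?_⟩
  rw [map_sub, fittingHom_scalarClass, fittingHom_scalarClass, e', map_mul, ofMul_mul,
    add_sub_cancel_right, hx]
  rfl

end Cyclic

/-! ### The four isomorphisms over a noetherian semilocal ring -/

section SemilocalTheorem

variable {S R : Type u} [CommRing S] [CommRing R] {ι : S →+* R}
  [Finite (MaximalSpectrum R)] (hι : TorsionCompatible ι) [HasDerivedCategory.{w} (ModuleCat.{u} R)]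

theorem det_detHom_complexClass (F : CochainComplex (ModuleCat.{u} R) ℤ)
    (hF : IsPerfectTorsion ι F) : Nonempty (FracContraction F) ∧ ∀ c : FracContraction F,
      (((detHom.{w} hι (complexClass.{w} ι F hF)).toMul :
        FractionalIdeal (nonZeroDivisors R) (FractionRing R)) :
          Submodule R (FractionRing R)) = c.det := by
  refine ⟨hF.1.nonempty_fracContraction (hF.isTorsion hι), fun c => ?_⟩
  rw [detHom_complexClass]
  exact coe_detClass hF.1 (hF.isTorsion hι) c

variable [IsNoetherianRing R]

theorem fittingHom_bijective : Function.Bijective (fittingHom.{w} hι) :=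
  ⟨fittingHom_injective hι, fittingHom_surjective hι⟩

theorem comp_eq_neg_fittingHom :
    ((detHom.{w} hι).comp (resolutionHom.{w} hι)).comp (ExactK0.incl (catP_le_catQ ι)) =
      -fittingHom.{w} hι :=
  AddMonoidHom.ext fun x => (neg_neg (detHom.{w} hι (resolutionHom.{w} hι (ExactK0.incl _ x)))).symm

theorem comp_bijective : Function.Bijective
    (detHom.{w} hι ∘ resolutionHom.{w} hι ∘ ExactK0.incl (catP_le_catQ ι)) := by
  have h := (neg_involutive (G := Additive (InvertibleIdeals R))).bijective.comp
    (fittingHom_bijective.{w} hι)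
  convert h using 1
  exact congrArg DFunLike.coe (comp_eq_neg_fittingHom.{w} hι)

/-- The composite of the three maps is injective and `ι` is surjective, so `φ` is injective. The
same cancellation gives `Det` below. -/
theorem resolutionHom_bijective : Function.Bijective (resolutionHom.{w} hι) :=
  ⟨(Function.Injective.of_comp (f := detHom.{w} hι) (comp_bijective.{w} hι).1).of_comp_right
    (incl_surjective hι), resolutionHom_surjective hι⟩

theorem detHom_bijective : Function.Bijective (detHom.{w} hι) :=
  ⟨(comp_bijective.{w} hι).1.of_comp_right
    ((resolutionHom_surjective hι).comp (incl_surjective hι)), (comp_bijective.{w} hι).2.of_comp⟩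

end SemilocalTheorem

theorem incl_injective {S R : Type u} [CommRing S] [CommRing R] {ι : S →+* R} [IsNoetherianRing R]
    [Finite (MaximalSpectrum R)] (hι : TorsionCompatible ι) :
    Function.Injective (ExactK0.incl (catP_le_catQ ι)) := by
  let := HasDerivedCategory.standard (ModuleCat.{u} R)
  have h := (comp_bijective hι).1
  rw [← Function.comp_assoc] at h
  exact h.of_comp

/-! ### Compact topological rings -/

section CompactRing

open Filter Topology

variable {A : Type*} [CommRing A] [TopologicalSpace A] [IsTopologicalRing A] [CompactSpace A]

/-- The sequence `b` need not converge, but by compactness it does along every ultrafilter. -/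
theorem Filter.Tendsto.zero_mul_of_compactSpace {f : ℕ → A} (hf : Tendsto f atTop (𝓝 0))
    (b : ℕ → A) : Tendsto (fun n => f n * b n) atTop (𝓝 0) := by
  rw [tendsto_iff_ultrafilter]
  intro g hg
  have h := (g.map b).le_nhds_lim
  have := Tendsto.mul (hf.mono_left hg) (show Tendsto b g _ from h)
  rwa [zero_mul] at this

theorem IsTopologicallyNilpotent.tendsto_pow_mul {x : A} (hx : IsTopologicallyNilpotent x)
    (b : ℕ → A) : Tendsto (fun n => x ^ n * b n) atTop (𝓝 0) :=
  Filter.Tendsto.zero_mul_of_compactSpace hx b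

/-- Division with remainder by `N` writes `x ^ n` as `π ^ (n / N)` times another factor, about which
nothing is needed. -/
theorem IsTopologicallyNilpotent.of_pow_eq_mul {π x z : A} (hπ : IsTopologicallyNilpotent π)
    {N : ℕ} (hN : N ≠ 0) (h : x ^ N = π * z) : IsTopologicallyNilpotent x := by
  have := Filter.Tendsto.zero_mul_of_compactSpace
    (hπ.comp (Nat.tendsto_div_const_atTop hN)) fun n => z ^ (n / N) * x ^ (n % N)
  refine this.congr fun n => ?_
  rw [Function.comp_apply, ← mul_assoc, ← mul_pow, ← h, ← pow_mul, ← pow_add, Nat.div_add_mod]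

variable [T2Space A]

/-- The principal ideal of `1 - x y` is closed by compactness and contains `1 - (x y) ^ n` by the
geometric sum, hence contains the limit `1`. -/
theorem IsTopologicallyNilpotent.isUnit_one_sub_mul {x : A} (hx : IsTopologicallyNilpotent x)
    (y : A) : IsUnit (1 - x * y) := by
  have hcl : IsClosed (Set.range fun z => (1 - x * y) * z) :=
    (isCompact_range (continuous_const.mul continuous_id)).isClosed
  have ht : Tendsto (fun n => 1 - (x * y) ^ n) atTop (𝓝 (1 - 0)) := by
    refine tendsto_const_nhds.sub ?_
    exact (hx.tendsto_pow_mul fun n => y ^ n).congr fun n => (mul_pow x y n).symm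
  rw [sub_zero] at ht
  obtain ⟨z, hz⟩ := hcl.mem_of_tendsto ht (Eventually.of_forall fun n => ⟨_, mul_neg_geom_sum _ n⟩)
  exact IsUnit.of_mul_eq_one z hz

theorem IsTopologicallyNilpotent.mem_jacobson_bot {x : A} (hx : IsTopologicallyNilpotent x) :
    x ∈ Ideal.jacobson (⊥ : Ideal A) := by
  rw [Ideal.mem_jacobson_bot]
  intro y
  have := hx.isUnit_one_sub_mul (-y)
  rwa [mul_neg, sub_neg_eq_add, add_comm] at this

/-- Such an ideal is a continuous image of the compact space `Aⁿ`. -/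
theorem Ideal.FG.isClosed {J : Ideal A} (hJ : J.FG) : IsClosed (J : Set A) := by
  obtain ⟨n, v, rfl⟩ := Submodule.fg_iff_exists_fin_generating_family.mp hJ
  rw [← Fintype.range_linearCombination, LinearMap.coe_range]
  exact (isCompact_range (LinearMap.continuous_on_pi _)).isClosed

theorem Ideal.exists_fg_le_sup {B : Type*} [CommRing B] (J P : Ideal B)
    [IsNoetherianRing (B ⧸ J)] : ∃ F : Ideal B, F ≤ P ∧ F.FG ∧ P ≤ F ⊔ J := by
  classical
  have h : (P.map (Ideal.Quotient.mk J)).FG := IsNoetherian.noetherian _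
  obtain ⟨t, ht, e⟩ := (Submodule.fg_span_iff_fg_span_finset_subset _).mp h
  obtain ⟨t, ht', rfl⟩ := Finset.subset_set_image_iff.mp ht
  refine ⟨Ideal.span t, Ideal.span_le.mpr ht', ⟨t, rfl⟩, ?_⟩
  have e' : P.map (Ideal.Quotient.mk J) = (Ideal.span (t : Set B)).map (Ideal.Quotient.mk J) := by
    rw [Ideal.map_span, ← Finset.coe_image]
    exact e
  refine (Ideal.le_comap_map (f := Ideal.Quotient.mk J)).trans ?_
  rw [e', Ideal.comap_map_of_surjective _ Ideal.Quotient.mk_surjective]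
  refine sup_le_sup_left ?_ _
  change RingHom.ker (Ideal.Quotient.mk J) ≤ J
  rw [Ideal.mk_ker]

theorem Ideal.FG.fg_of_le {B : Type*} [CommRing B] {J P : Ideal B} (hJ : J.FG)
    [IsNoetherianRing (B ⧸ J)] (h : J ≤ P) : P.FG := by
  obtain ⟨F, hFP, hF, hPF⟩ := Ideal.exists_fg_le_sup J P
  rw [le_antisymm hPF (sup_le hFP h)]
  exact Submodule.FG.sup hF hJ

theorem isNoetherianRing_quotient_of_forall_prime {B : Type*} [CommRing B] {J : Ideal B}
    (h : ∀ P : Ideal B, P.IsPrime → J ≤ P → P.FG) : IsNoetherianRing (B ⧸ J) := by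
  refine IsNoetherianRing.of_prime fun P hP => ?_
  rw [← Ideal.map_comap_of_surjective _ Ideal.Quotient.mk_surjective P]
  refine (h _ (hP.comap _) ?_).map _
  exact (Ideal.mk_ker (I := J)).symm.le.trans (Ideal.ker_le_comap _)

/-- If `x` is topologically nilpotent in a compact ring, then noetherianity modulo `x` implies
noetherianity. -/
theorem IsTopologicallyNilpotent.isNoetherianRing_quotient {x : A}
    (hx : IsTopologicallyNilpotent x) {J : Ideal A} (hJ : J.FG)
    [IsNoetherianRing (A ⧸ (J ⊔ Ideal.span {x}))] : IsNoetherianRing (A ⧸ J) := by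
  have hJx : (J ⊔ Ideal.span {x}).FG := Submodule.FG.sup hJ ⟨{x}, by simp⟩
  -- Cohen's theorem: only prime ideals have to be checked.
  refine isNoetherianRing_quotient_of_forall_prime fun P hP hJP => ?_
  by_cases hxP : x ∈ P
  · exact hJx.fg_of_le (sup_le hJP ((Ideal.span_singleton_le_iff_mem _).mpr hxP))
  obtain ⟨F, hF, hFP, hJF, hPF⟩ : ∃ F : Ideal A, F.FG ∧ F ≤ P ∧ J ≤ F ∧ P ≤ F ⊔ Ideal.span {x} := by
    obtain ⟨F, hFP, hF, hF'⟩ := Ideal.exists_fg_le_sup (J ⊔ Ideal.span {x}) P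
    exact ⟨F ⊔ J, Submodule.FG.sup hF hJ, sup_le hFP hJP, le_sup_right,
      hF'.trans (sup_assoc _ _ _).symm.le⟩
  -- Successive approximation: as `P` is prime and `x ∉ P`, the cofactor `b` stays in `P`, and the
  -- step can be repeated.
  have hstep : ∀ a ∈ P, ∃ b ∈ P, a - x * b ∈ F := fun a ha => by
    obtain ⟨f, hf, c, hc, rfl⟩ := Submodule.mem_sup.mp (hPF ha)
    obtain ⟨b, rfl⟩ := Ideal.mem_span_singleton.mp hc
    refine ⟨b, ?_, by rwa [add_sub_cancel_right]⟩
    exact (hP.mem_or_mem ((Ideal.add_mem_iff_right _ (hFP hf)).mp ha)).resolve_left hxP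
  have hpow : ∀ n, ∀ a ∈ P, ∃ b ∈ P, a - x ^ n * b ∈ F := by
    intro n
    induction n with
    | zero => exact fun a ha => ⟨a, ha, by simp⟩
    | succ n ih =>
      intro a ha
      obtain ⟨b, hb, hab⟩ := ih a ha
      obtain ⟨c, hc, hbc⟩ := hstep b hb
      refine ⟨c, hc, ?_⟩
      have := F.add_mem hab (F.mul_mem_left (x ^ n) hbc)
      rwa [show a - x ^ n * b + x ^ n * (b - x * c) = a - x ^ (n + 1) * c by ring] at this
  -- Now `a - x ^ n * b_n ∈ F` for all `n`. These elements tend to `a`, and `F` is closed.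
  have hPF' : P = F := le_antisymm (fun a ha => by
    choose b _ hb using fun n => hpow n a ha
    have := (tendsto_const_nhds (x := a)).sub (hx.tendsto_pow_mul b)
    rw [sub_zero] at this
    exact hF.isClosed.mem_of_tendsto this (Eventually.of_forall hb)) hFP
  exact hPF' ▸ hF

/-- A compact ring is noetherian if it is so modulo finitely many topologically nilpotent
elements. -/
theorem isNoetherianRing_of_quotient_span (s : Finset A)
    (hs : ∀ x ∈ s, IsTopologicallyNilpotent x) (h : IsNoetherianRing (A ⧸ Ideal.span (s : Set A))) :
    IsNoetherianRing A := by
  classical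
  induction s using Finset.induction_on with
  | empty =>
    rw [Finset.coe_empty, Ideal.span_empty] at h
    exact isNoetherianRing_of_ringEquiv _ (RingEquiv.quotientBot A)
  | insert x s _ ih =>
    rw [Finset.coe_insert, Ideal.span_insert, sup_comm] at h
    have := (hs x (Finset.mem_insert_self x s)).isNoetherianRing_quotient
      (J := Ideal.span s) ⟨s, rfl⟩
    exact ih (fun y hy => hs y (Finset.mem_insert_of_mem hy)) this

theorem finite_maximalSpectrum_of_finite_quotient {B : Type*} [CommRing B] {I : Ideal B}
    (hI : I ≤ Ideal.jacobson ⊥) [Finite (B ⧸ I)] : Finite (MaximalSpectrum B) := by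
  refine Finite.of_injective (fun m : MaximalSpectrum B =>
    (m.asIdeal.map (Ideal.Quotient.mk I))) fun m m' h => ?_
  have key : ∀ m : MaximalSpectrum B,
      (m.asIdeal.map (Ideal.Quotient.mk I)).comap (Ideal.Quotient.mk I) = m.asIdeal := fun m => by
    rw [Ideal.comap_map_of_surjective _ Ideal.Quotient.mk_surjective, sup_eq_left]
    change RingHom.ker _ ≤ _
    rw [Ideal.mk_ker]
    exact hI.trans (sInf_le ⟨bot_le, m.isMaximal⟩)
  exact MaximalSpectrum.ext ((key m).symm.trans ((congrArg _ h).trans (key m')))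

end CompactRing

/-! ### The topology on group rings and completed group rings -/

section GroupRingTopology

variable {k X Y : Type*}

/-- The topology of coefficientwise convergence on a monoid algebra. -/
instance MonoidAlgebra.instTopologicalSpaceCoeff [Semiring k] [TopologicalSpace k] :
    TopologicalSpace (MonoidAlgebra k X) :=
  TopologicalSpace.induced (fun x => (x.coeff : X → k)) inferInstance

theorem MonoidAlgebra.isInducing_coeff [Semiring k] [TopologicalSpace k] :
    Topology.IsInducing (fun x : MonoidAlgebra k X => (x.coeff : X → k)) :=
  ⟨rfl⟩

theorem MonoidAlgebra.continuous_iff_coeff [Semiring k] [TopologicalSpace k] {Z : Type*}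
    [TopologicalSpace Z] {f : Z → MonoidAlgebra k X} :
    Continuous f ↔ ∀ a, Continuous fun z => (f z).coeff a := by
  rw [MonoidAlgebra.isInducing_coeff.continuous_iff, continuous_pi_iff]
  rfl

theorem MonoidAlgebra.continuous_coeff [Semiring k] [TopologicalSpace k] (a : X) :
    Continuous fun x : MonoidAlgebra k X => x.coeff a :=
  MonoidAlgebra.continuous_iff_coeff.mp continuous_id a

theorem MonoidAlgebra.continuous_single [Semiring k] [TopologicalSpace k] (a : X) :
    Continuous (MonoidAlgebra.single a : k → MonoidAlgebra k X) := by
  classical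
  refine MonoidAlgebra.continuous_iff_coeff.mpr fun b => ?_
  simp only [MonoidAlgebra.coeff_single, Finsupp.single_apply]
  split_ifs
  · exact continuous_id
  · exact continuous_const

instance MonoidAlgebra.instContinuousAddCoeff [Semiring k] [TopologicalSpace k] [ContinuousAdd k] :
    ContinuousAdd (MonoidAlgebra k X) :=
  ⟨MonoidAlgebra.continuous_iff_coeff.mpr fun a =>
    ((MonoidAlgebra.continuous_coeff a).comp continuous_fst).add
      ((MonoidAlgebra.continuous_coeff a).comp continuous_snd)⟩

instance MonoidAlgebra.instT2SpaceCoeff [Semiring k] [TopologicalSpace k] [T2Space k] :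
    T2Space (MonoidAlgebra k X) :=
  T2Space.of_injective_continuous
    (DFunLike.coe_injective.comp MonoidAlgebra.coeff_injective)
    MonoidAlgebra.isInducing_coeff.continuous

theorem MonoidAlgebra.eq_sum_single [Semiring k] [Fintype X] (x : MonoidAlgebra k X) :
    x = ∑ a, MonoidAlgebra.single a (x.coeff a) := by
  conv_lhs => rw [← MonoidAlgebra.sum_coeff_single x]
  exact Finsupp.sum_fintype _ _ fun _ => MonoidAlgebra.single_zero _

instance MonoidAlgebra.instCompactSpaceCoeff [Semiring k] [TopologicalSpace k] [CompactSpace k]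
    [Finite X] : CompactSpace (MonoidAlgebra k X) := by
  have := Topology.IsClosedEmbedding.mk
    ⟨MonoidAlgebra.isInducing_coeff, (DFunLike.coe_injective.comp
      MonoidAlgebra.coeff_injective : Function.Injective fun x : MonoidAlgebra k X => ⇑x.coeff)⟩
    (by
      convert isClosed_univ
      exact Set.range_eq_univ.mpr fun f =>
        ⟨MonoidAlgebra.ofCoeff (Finsupp.equivFunOnFinite.symm f), rfl⟩)
  exact this.compactSpace

instance MonoidAlgebra.instIsTopologicalRingCoeff [Ring k] [TopologicalSpace k]
    [IsTopologicalRing k] [Group X] [Finite X] : IsTopologicalRing (MonoidAlgebra k X) where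
  continuous_mul := MonoidAlgebra.continuous_iff_coeff.mpr fun a => by
    have := Fintype.ofFinite X
    simp only [MonoidAlgebra.coeff_mul_apply_left]
    simp only [Finsupp.sum_fintype, zero_mul, implies_true]
    exact continuous_finsetSum _ fun b _ =>
      ((MonoidAlgebra.continuous_coeff b).comp continuous_fst).mul
        ((MonoidAlgebra.continuous_coeff _).comp continuous_snd)
  continuous_neg := MonoidAlgebra.continuous_iff_coeff.mpr fun a =>
    (MonoidAlgebra.continuous_coeff a).neg

theorem MonoidAlgebra.continuous_mapDomain [Semiring k] [TopologicalSpace k] [ContinuousAdd k]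
    [Finite X] (f : X → Y) :
    Continuous (MonoidAlgebra.mapDomain f : MonoidAlgebra k X → MonoidAlgebra k Y) := by
  have := Fintype.ofFinite X
  have h : (MonoidAlgebra.mapDomain f : MonoidAlgebra k X → MonoidAlgebra k Y) =
      fun x => ∑ a, MonoidAlgebra.single (f a) (x.coeff a) := by
    funext x
    let F : MonoidAlgebra k X →+ MonoidAlgebra k Y :=
      ⟨⟨MonoidAlgebra.mapDomain f, MonoidAlgebra.mapDomain_zero f⟩, MonoidAlgebra.mapDomain_add f⟩
    conv_lhs => rw [MonoidAlgebra.eq_sum_single x]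
    refine (map_sum F _ _).trans (Finset.sum_congr rfl fun a _ => ?_)
    exact MonoidAlgebra.mapDomain_single
  rw [h]
  exact continuous_finsetSum _ fun a _ =>
    (MonoidAlgebra.continuous_single _).comp (MonoidAlgebra.continuous_coeff a)

end GroupRingTopology

/-! ### The profinite topology of the completed group ring -/

section CompletedGroupRingTopology

variable (p : ℕ) [Fact p.Prime] {G : Type u} [CommGroup G] [TopologicalSpace G]

theorem isClosed_completedGroupSubring [IsTopologicalGroup G] [CompactSpace G] :
    IsClosed (completedGroupSubring p G : Set
      (∀ U : OpenSubgroup G, MonoidAlgebra ℤ_[p] (G ⧸ (U : Subgroup G)))) := by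
  have h : (completedGroupSubring p G : Set
      (∀ U : OpenSubgroup G, MonoidAlgebra ℤ_[p] (G ⧸ (U : Subgroup G)))) =
      ⋂ (U : OpenSubgroup G) (V : OpenSubgroup G) (h : U ≤ V),
        {x | groupRingTransition p G h (x U) = x V} := by
    ext x
    simp only [Set.mem_iInter]
    rfl
  rw [h]
  refine isClosed_iInter fun U => isClosed_iInter fun V => isClosed_iInter fun h => ?_
  exact isClosed_eq ((MonoidAlgebra.continuous_mapDomain _).comp (continuous_apply U))
    (continuous_apply V)

instance [IsTopologicalGroup G] [CompactSpace G] : CompactSpace (CompletedGroupRing p G) :=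
  isCompact_iff_compactSpace.mp (isClosed_completedGroupSubring p).isCompact

theorem CompletedGroupRing.continuous_map {H : Type u} [CommGroup H] [TopologicalSpace H]
    [IsTopologicalGroup H] [CompactSpace H] (f : H →* G) (hf : Continuous f) :
    Continuous (CompletedGroupRing.map p f hf) := by
  refine Continuous.subtype_mk (continuous_pi fun U => ?_) _
  exact (MonoidAlgebra.continuous_mapDomain _).comp
    ((continuous_apply _).comp continuous_subtype_val)

/-- The element `a • [g]` of the completed group ring. -/
noncomputable def CompletedGroupRing.single (g : G) (a : ℤ_[p]) : CompletedGroupRing p G :=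
  ⟨fun _ => MonoidAlgebra.single (QuotientGroup.mk g) a,
    fun _ _ _ => MonoidAlgebra.mapDomain_single⟩

/-- The canonical homomorphism from `G` to the completed group ring. -/
noncomputable def CompletedGroupRing.of : G →* CompletedGroupRing p G where
  toFun g := CompletedGroupRing.single p g 1
  map_one' := rfl
  map_mul' g h := Subtype.ext <| funext fun U => by
    refine Eq.trans ?_ (MonoidAlgebra.single_mul_single (R := ℤ_[p])
      (g : G ⧸ (U : Subgroup G)) (h : G ⧸ (U : Subgroup G)) 1 1).symm
    rw [mul_one]
    rfl

/-- The projection `ℤ_p[[G]] → ℤ_p[G/U]`. -/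
noncomputable def CompletedGroupRing.proj (U : OpenSubgroup G) :
    CompletedGroupRing p G →+* MonoidAlgebra ℤ_[p] (G ⧸ (U : Subgroup G)) :=
  (Pi.evalRingHom _ U).comp (completedGroupSubring p G).subtype

theorem CompletedGroupRing.continuous_single (g : G) :
    Continuous (CompletedGroupRing.single p g) :=
  Continuous.subtype_mk (continuous_pi fun _ => MonoidAlgebra.continuous_single _) _

theorem CompletedGroupRing.continuous_of [IsTopologicalGroup G] :
    Continuous (CompletedGroupRing.of p : G →* CompletedGroupRing p G) := by
  refine Continuous.subtype_mk (continuous_pi fun U => ?_) _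
  exact (continuous_of_discreteTopology (f := fun q : G ⧸ (U : Subgroup G) =>
    (MonoidAlgebra.single q 1 : MonoidAlgebra ℤ_[p] _))).comp QuotientGroup.continuous_mk

theorem CompletedGroupRing.single_intCast (g : G) (n : ℤ) :
    CompletedGroupRing.single p g n = n • CompletedGroupRing.of p g := by
  refine Subtype.ext <| funext fun U => ?_
  refine Eq.trans ?_ (MonoidAlgebra.smul_single n (g : G ⧸ (U : Subgroup G)) (1 : ℤ_[p])).symm
  rw [zsmul_one]
  rfl

theorem CompletedGroupRing.single_mem {N : AddSubgroup (CompletedGroupRing p G)}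
    (hN : IsClosed (N : Set (CompletedGroupRing p G)))
    (h : ∀ g, CompletedGroupRing.of p g ∈ N) (g : G) (a : ℤ_[p]) :
    CompletedGroupRing.single p g a ∈ N := by
  have := (hN.preimage (CompletedGroupRing.continuous_single p g)).closure_subset_iff
    (s := Set.range ((↑) : ℤ → ℤ_[p]))
  rw [PadicInt.denseRange_intCast.closure_range] at this
  refine this.mpr ?_ (Set.mem_univ a)
  rintro _ ⟨n, rfl⟩
  rw [Set.mem_preimage, CompletedGroupRing.single_intCast]
  exact N.zsmul_mem (h g) n

/-- A closed additive subgroup of the completed group ring containing the group elements is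
everything. -/
theorem CompletedGroupRing.eq_top_of_isClosed [IsTopologicalGroup G] [CompactSpace G]
    {N : AddSubgroup (CompletedGroupRing p G)}
    (hN : IsClosed (N : Set (CompletedGroupRing p G)))
    (h : ∀ g, CompletedGroupRing.of p g ∈ N) : N = ⊤ := by
  refine AddSubgroup.eq_top_iff' _ |>.mpr fun x => ?_
  have (U : OpenSubgroup G) : Fintype (G ⧸ (U : Subgroup G)) := Fintype.ofFinite _
  -- The lift `y U` of the component of `x` at `U` agrees with `x` at every level containing `U`. So
  -- `y U` tends to `x` as `U` shrinks.
  let y (U : OpenSubgroup G) : CompletedGroupRing p G :=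
    ∑ q : G ⧸ (U : Subgroup G), CompletedGroupRing.single p q.out ((x.1 U).coeff q)
  have hy (U V : OpenSubgroup G) (hUV : U ≤ V) : CompletedGroupRing.proj p V (y U) = x.1 V := by
    rw [← x.2 U V hUV]
    conv_rhs => rw [MonoidAlgebra.eq_sum_single (x.1 U), map_sum]
    rw [map_sum]
    refine Finset.sum_congr rfl fun q _ => ?_
    refine Eq.trans ?_ MonoidAlgebra.mapDomain_single.symm
    obtain ⟨g, hg⟩ : ∃ g : G, q.out = g := ⟨_, rfl⟩
    have hq : q = QuotientGroup.mk g := by rw [← hg, QuotientGroup.out_eq']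
    rw [hg]
    generalize (x.1 U).coeff q = a
    subst hq
    rfl
  refine hN.mem_of_tendsto (f := y) (b := Filter.atBot) ?_ (Filter.Eventually.of_forall fun U =>
    N.sum_mem fun q _ => CompletedGroupRing.single_mem p hN h _ _)
  rw [tendsto_subtype_rng, tendsto_pi_nhds]
  intro V
  refine tendsto_const_nhds.congr' ?_
  filter_upwards [Filter.eventually_le_atBot V] with U hU
  exact (hy _ _ hU).symm

end CompletedGroupRingTopology

/-! ### The completed group ring is noetherian and semilocal -/

section CompletedGroupRingNoetherian

open Filter Topology

variable (p : ℕ) [Fact p.Prime] {G : Type u} [CommGroup G] [TopologicalSpace G]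

theorem PadicInt.tendsto_natCast_prime_pow :
    Tendsto (fun n => (p : ℤ_[p]) ^ n) atTop (𝓝 0) := by
  refine tendsto_pow_atTop_nhds_zero_of_norm_lt_one ?_
  rw [PadicInt.norm_p]
  exact inv_lt_one_of_one_lt₀ (Nat.one_lt_cast.mpr (Fact.out : p.Prime).one_lt)

theorem CompletedGroupRing.continuous_proj (U : OpenSubgroup G) :
    Continuous (CompletedGroupRing.proj p U) :=
  (continuous_apply U).comp continuous_subtype_val

theorem CompletedGroupRing.isTopologicallyNilpotent_natCast :
    IsTopologicallyNilpotent (p : CompletedGroupRing p G) := by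
  have h := PadicInt.tendsto_natCast_prime_pow p
  have h' := ((CompletedGroupRing.continuous_single p (1 : G)).tendsto 0).comp h
  have h0 : CompletedGroupRing.single p (1 : G) 0 = 0 := by
    simpa using CompletedGroupRing.single_intCast p (1 : G) 0
  rw [h0] at h'
  refine h'.congr fun n => ?_
  have := CompletedGroupRing.single_intCast p (1 : G) ((p : ℤ) ^ n)
  rw [map_one, zsmul_one] at this
  simpa using this

/-- At the level `U` some `γ ^ p ^ k` is trivial. With `x = γ - 1` this reads `(x + 1) ^ p ^ k = 1`,
so `x ^ p ^ k` is a multiple of `p`, which is topologically nilpotent. -/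
theorem CompletedGroupRing.isTopologicallyNilpotent_of_sub_one [IsTopologicalGroup G]
    [CompactSpace G] {γ : G} (hγ : Tendsto (fun n => γ ^ p ^ n) atTop (𝓝 1)) :
    IsTopologicallyNilpotent (CompletedGroupRing.of p γ - 1) := by
  have h (U : OpenSubgroup G) :
      IsTopologicallyNilpotent (CompletedGroupRing.proj p U (CompletedGroupRing.of p γ - 1)) := by
    obtain ⟨k, hk⟩ := (hγ.eventually_mem U.mem_nhds_one).exists
    set x := CompletedGroupRing.proj p U (CompletedGroupRing.of p γ - 1) with hx
    obtain ⟨r, hr⟩ := exists_add_pow_prime_pow_eq (Fact.out : p.Prime) x 1 k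
    have h1 : (x + 1) ^ p ^ k = 1 := by
      rw [hx, map_sub, map_one, sub_add_cancel, ← map_pow, ← map_pow]
      change MonoidAlgebra.single (QuotientGroup.mk (γ ^ p ^ k)) 1 = MonoidAlgebra.single 1 1
      rw [(QuotientGroup.eq_one_iff _).mpr hk]
    have hp := (CompletedGroupRing.isTopologicallyNilpotent_natCast p (G := G)).map
      (CompletedGroupRing.continuous_proj p U)
    rw [map_natCast] at hp
    refine hp.of_pow_eq_mul (N := p ^ k) (z := - (x * r))
      (pow_ne_zero _ (Fact.out : p.Prime).ne_zero) ?_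
    rw [h1, one_pow] at hr
    linear_combination -hr
  rw [IsTopologicallyNilpotent, tendsto_subtype_rng, tendsto_pi_nhds]
  exact h

theorem tendsto_pow_prime_pow_nhds_one {H : Type*} [CommGroup H] [TopologicalSpace H] {d : ℕ}
    (e : H ≃ₜ* Multiplicative (Fin d → ℤ_[p])) (γ : H) :
    Tendsto (fun n => γ ^ p ^ n) atTop (𝓝 1) := by
  have h := PadicInt.tendsto_natCast_prime_pow p
  have h1 : Tendsto (fun n => Multiplicative.ofAdd ((p : ℤ_[p]) ^ n • (e γ).toAdd)) atTop
      (𝓝 (Multiplicative.ofAdd 0)) := by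
    have := h.smul_const (e γ).toAdd
    rw [zero_smul] at this
    exact this
  have h2 := (e.symm.continuous.tendsto _).comp h1
  have h3 : e.symm.toHomeomorph (Multiplicative.ofAdd 0) = 1 := map_one e.symm
  rw [h3] at h2
  refine h2.congr fun n => ?_
  have : Multiplicative.ofAdd ((p : ℤ_[p]) ^ n • (e γ).toAdd) = e γ ^ p ^ n := by
    rw [← Nat.cast_pow, Nat.cast_smul_eq_nsmul]
    rfl
  rw [Function.comp_apply, this, ← map_pow]
  exact e.symm_apply_apply _

theorem PadicInt.eq_top_of_isClosed {d : ℕ} {K : AddSubgroup (Fin d → ℤ_[p])}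
    (hK : IsClosed (K : Set (Fin d → ℤ_[p]))) (h : ∀ i, Pi.single i 1 ∈ K) : K = ⊤ := by
  refine AddSubgroup.eq_top_iff' _ |>.mpr fun v => ?_
  rw [← Finset.univ_sum_single v]
  refine K.sum_mem fun i _ => ?_
  have := (hK.preimage (continuous_single (A := fun _ => ℤ_[p]) i))
    |>.closure_subset_iff (s := Set.range ((↑) : ℤ → ℤ_[p]))
  rw [PadicInt.denseRange_intCast.closure_range] at this
  refine this.mpr ?_ (Set.mem_univ _)
  rintro _ ⟨n, rfl⟩
  have e : (Pi.single i (n : ℤ_[p]) : Fin d → ℤ_[p]) = n • Pi.single i 1 := by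
    rw [← Pi.single_smul, zsmul_one]
  change Pi.single i (n : ℤ_[p]) ∈ K
  rw [e]
  exact K.zsmul_mem (h i) n

variable [IsTopologicalGroup G] [CompactSpace G]

/-- The elements of `G` have finitely many images, because `G'` has finite index and acts trivially.
They generate a finite group killed by `p`. Its preimage is closed and contains `G`, hence is
everything. -/
theorem CompletedGroupRing.finite_quotient {I : Ideal (CompletedGroupRing p G)}
    (hI : IsClosed (I : Set (CompletedGroupRing p G))) (hp : (p : CompletedGroupRing p G) ∈ I)
    {G' : Subgroup G} (hopen : IsOpen (G' : Set G))
    (h : ∀ g ∈ G', CompletedGroupRing.of p g - 1 ∈ I) :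
    Finite (CompletedGroupRing p G ⧸ I) := by
  let f : G →* CompletedGroupRing p G ⧸ I :=
    (Ideal.Quotient.mk I : _ →* _).comp (CompletedGroupRing.of p)
  have hf : G' ≤ f.ker := fun g hg => by
    have := Ideal.Quotient.eq_zero_iff_mem.mpr (h g hg)
    rwa [map_sub, map_one, sub_eq_zero] at this
  have := G'.quotient_finite_of_isOpen hopen
  have hfin : (Set.range f).Finite := by
    refine (Set.finite_range (QuotientGroup.lift G' f hf)).subset ?_
    rintro _ ⟨g, rfl⟩
    exact ⟨g, rfl⟩
  let A := AddSubgroup.closure (Set.range f)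
  have hA : Finite A := by
    have : AddGroup.FG A :=
      (AddGroup.fg_iff_addSubgroup_fg A).mpr ⟨hfin.toFinset, by rw [hfin.coe_toFinset]⟩
    refine AddCommGroup.finite_of_fg_isAddTorsion _ fun a => ?_
    refine isOfFinAddOrder_iff_nsmul_eq_zero.mpr ⟨p, (Fact.out : p.Prime).pos, Subtype.ext ?_⟩
    change p • (a : CompletedGroupRing p G ⧸ I) = 0
    have : (p : CompletedGroupRing p G ⧸ I) = 0 := by
      rw [← map_natCast (Ideal.Quotient.mk I)]
      exact Ideal.Quotient.eq_zero_iff_mem.mpr hp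
    rw [nsmul_eq_mul, this, zero_mul]
  let N := A.comap (Ideal.Quotient.mk I).toAddMonoidHom
  have hN : N = ⊤ := by
    refine CompletedGroupRing.eq_top_of_isClosed p ?_ fun g => AddSubgroup.subset_closure ⟨g, rfl⟩
    have : (N : Set (CompletedGroupRing p G)) =
        ⋃ a : A, {x | Ideal.Quotient.mk I x = a} := by
      ext x
      simp only [Set.mem_iUnion]
      exact ⟨fun hx => ⟨⟨_, hx⟩, rfl⟩, fun ⟨a, ha⟩ => by
        change Ideal.Quotient.mk I x ∈ A
        rw [show Ideal.Quotient.mk I x = a from ha]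
        exact a.2⟩
    rw [this]
    refine isClosed_iUnion_of_finite fun a => ?_
    obtain ⟨r, hr⟩ := Ideal.Quotient.mk_surjective (a : CompletedGroupRing p G ⧸ I)
    have : {x | Ideal.Quotient.mk I x = a} = (fun x => x - r) ⁻¹' I := by
      ext x
      rw [← hr]
      exact Ideal.Quotient.eq
    rw [this]
    exact hI.preimage (continuous_id.sub continuous_const)
  refine Finite.of_surjective (fun a : A => (a : CompletedGroupRing p G ⧸ I)) fun q => ?_
  obtain ⟨r, rfl⟩ := Ideal.Quotient.mk_surjective q
  exact ⟨⟨_, (hN ▸ AddSubgroup.mem_top r : r ∈ N)⟩, rfl⟩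

/-- The elements are `p` and `γ_i - 1` for a basis `γ_i` of `G'`. Their ideal is closed, so the `v ∈
ℤ_p^d` with `γ v ≡ 1` form a closed subgroup containing the basis, which is all of `ℤ_p^d`;
`finite_quotient` applies. -/
theorem CompletedGroupRing.exists_finset (d : ℕ) (G' : Subgroup G) (hopen : IsOpen (G' : Set G))
    (hG' : Nonempty (G' ≃ₜ* Multiplicative (Fin d → ℤ_[p]))) :
    ∃ s : Finset (CompletedGroupRing p G), (∀ x ∈ s, IsTopologicallyNilpotent x) ∧
      Finite (CompletedGroupRing p G ⧸ Ideal.span (s : Set (CompletedGroupRing p G))) := by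
  classical
  obtain ⟨e⟩ := hG'
  let γ (v : Fin d → ℤ_[p]) : G := (e.symm (Multiplicative.ofAdd v) : G')
  have hγ : Continuous γ := continuous_subtype_val.comp (e.symm.continuous.comp continuous_ofAdd)
  let s : Finset (CompletedGroupRing p G) :=
    insert (p : CompletedGroupRing p G)
      (Finset.univ.image fun i => CompletedGroupRing.of p (γ (Pi.single i 1)) - 1)
  have hI := (show (Ideal.span (s : Set (CompletedGroupRing p G))).FG from ⟨s, rfl⟩).isClosed
  refine ⟨s, fun x hx => ?_, CompletedGroupRing.finite_quotient p hI
    (Ideal.subset_span (Finset.mem_insert_self _ _)) hopen ?_⟩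
  · rcases Finset.mem_insert.mp hx with rfl | hx
    · exact CompletedGroupRing.isTopologicallyNilpotent_natCast p
    · obtain ⟨i, -, rfl⟩ := Finset.mem_image.mp hx
      refine CompletedGroupRing.isTopologicallyNilpotent_of_sub_one p ?_
      exact (continuous_subtype_val.tendsto 1).comp (tendsto_pow_prime_pow_nhds_one p e _)
  · let f : G →* CompletedGroupRing p G ⧸ Ideal.span (s : Set (CompletedGroupRing p G)) :=
      (Ideal.Quotient.mk (Ideal.span (s : Set (CompletedGroupRing p G))) : _ →* _).comp
        (CompletedGroupRing.of p)
    have hf (g : G) : CompletedGroupRing.of p g - 1 ∈ Ideal.span (s : Set _) ↔ g ∈ f.ker := by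
      rw [MonoidHom.mem_ker, ← Ideal.Quotient.eq_zero_iff_mem, map_sub, map_one, sub_eq_zero]
      rfl
    let K : AddSubgroup (Fin d → ℤ_[p]) :=
      { carrier := {v | γ v ∈ f.ker}
        zero_mem' := by
          have : γ 0 = 1 := congrArg Subtype.val (map_one e.symm)
          change γ 0 ∈ f.ker
          rw [this]
          exact f.ker.one_mem
        add_mem' := fun {v w} hv hw => by
          have : γ (v + w) = γ v * γ w := congrArg Subtype.val (map_mul e.symm _ _)
          change γ (v + w) ∈ f.ker
          rw [this]
          exact f.ker.mul_mem hv hw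
        neg_mem' := fun {v} hv => by
          have : γ (-v) = (γ v)⁻¹ := congrArg Subtype.val (map_inv e.symm _)
          change γ (-v) ∈ f.ker
          rw [this]
          exact f.ker.inv_mem hv }
    have hK : K = ⊤ := by
      refine PadicInt.eq_top_of_isClosed p ?_ fun i => ?_
      · have : (K : Set (Fin d → ℤ_[p])) = (fun v => CompletedGroupRing.of p (γ v) - 1) ⁻¹'
            (Ideal.span (s : Set (CompletedGroupRing p G)) : Set _) := by
          ext v
          exact (hf _).symm
        rw [this]
        exact hI.preimage (((CompletedGroupRing.continuous_of p).comp hγ).sub continuous_const)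
      · refine (hf _).mp (Ideal.subset_span ?_)
        exact Finset.mem_insert_of_mem (Finset.mem_image_of_mem _ (Finset.mem_univ i))
    intro g hg
    rw [hf]
    have : (e ⟨g, hg⟩).toAdd ∈ K := hK ▸ AddSubgroup.mem_top _
    have h' : γ (e ⟨g, hg⟩).toAdd = g := congrArg Subtype.val (e.symm_apply_apply ⟨g, hg⟩)
    rw [← h']
    exact this

theorem isNoetherianRing_completedGroupRing (d : ℕ) (G' : Subgroup G)
    (hopen : IsOpen (G' : Set G)) (hG' : Nonempty (G' ≃ₜ* Multiplicative (Fin d → ℤ_[p]))) :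
    IsNoetherianRing (CompletedGroupRing p G) := by
  obtain ⟨s, hs, hfin⟩ := CompletedGroupRing.exists_finset p d G' hopen hG'
  exact isNoetherianRing_of_quotient_span s hs (isNoetherian_of_finite _ _)

theorem finite_maximalSpectrum_completedGroupRing (d : ℕ) (G' : Subgroup G)
    (hopen : IsOpen (G' : Set G)) (hG' : Nonempty (G' ≃ₜ* Multiplicative (Fin d → ℤ_[p]))) :
    Finite (MaximalSpectrum (CompletedGroupRing p G)) := by
  obtain ⟨s, hs, hfin⟩ := CompletedGroupRing.exists_finset p d G' hopen hG'
  exact finite_maximalSpectrum_of_finite_quotient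
    (Ideal.span_le.mpr fun x hx => (hs x hx).mem_jacobson_bot)

end CompletedGroupRingNoetherian

/-! ### Torsion over the completed group ring of an open subgroup -/

section FreeExtension

open scoped nonZeroDivisors

variable {S R : Type u} [CommRing S] [CommRing R] [Algebra S R] {n : Type*}

theorem Module.Basis.algebraMap_mem_nonZeroDivisors (b : Module.Basis n S R) {s : S}
    (hs : s ∈ S⁰) : algebraMap S R s ∈ R⁰ := by
  refine mem_nonZeroDivisors_iff_left.mpr fun x hx => b.ext_elem fun i => ?_
  rw [← Algebra.smul_def] at hx
  have := congrArg (fun y => b.repr y i) hx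
  simp only [map_smul, Finsupp.smul_apply, smul_eq_mul, map_zero, Finsupp.coe_zero,
    Pi.zero_apply] at this
  simpa using (mem_nonZeroDivisors_iff_left.mp hs) _ this

variable [Fintype n]

/-- Take for `s` the norm of `r`, the determinant of multiplication by `r`; the adjugate matrix
provides the cofactor. -/
theorem Module.Basis.exists_dvd_algebraMap (b : Module.Basis n S R) {r : R} (hr : r ∈ R⁰) :
    ∃ s ∈ S⁰, r ∣ algebraMap S R s := by
  classical
  let A := Algebra.leftMulMatrix b r
  have hA (v : n → S) : A.mulVec v = b.equivFun (r * b.equivFun.symm v) := by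
    conv_lhs => rw [← b.equivFun.apply_symm_apply v]
    exact Algebra.leftMulMatrix_mulVec_repr b r _
  refine ⟨A.det, ?_, b.equivFun.symm (A.adjugate.mulVec (b.equivFun 1)), ?_⟩
  · rw [← Matrix.nonsingular_iff_det_mem_nonZeroDivisors]
    refine .of_linearIndependent_col (Matrix.mulVec_injective_iff.mp fun v w h => ?_)
    rw [hA, hA] at h
    have := b.equivFun.injective h
    rw [mul_cancel_left_mem_nonZeroDivisors hr] at this
    exact b.equivFun.symm.injective this
  · refine b.equivFun.injective ?_
    rw [← hA, Matrix.mulVec_mulVec, Matrix.mul_adjugate, Matrix.smul_mulVec, Matrix.one_mulVec,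
      ← map_smul, Algebra.algebraMap_eq_smul_one]

theorem Module.Basis.torsionCompatible (b : Module.Basis n S R) :
    TorsionCompatible (algebraMap S R) := by
  intro M _ _
  constructor
  · intro h x
    obtain ⟨s, hs⟩ := @h x
    exact ⟨⟨_, b.algebraMap_mem_nonZeroDivisors s.2⟩, hs⟩
  · intro h x
    obtain ⟨r, hr⟩ := @h x
    obtain ⟨s, hs, t, ht⟩ := b.exists_dvd_algebraMap r.2
    refine ⟨⟨s, hs⟩, ?_⟩
    change algebraMap S R s • x = 0
    rw [ht, mul_comm, mul_smul]
    exact (congrArg (t • ·) hr).trans (smul_zero t)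

end FreeExtension

/-! ### Freeness over the completed group ring of an open subgroup -/

section OpenSubgroup

variable (p : ℕ) [Fact p.Prime] {G : Type u} [CommGroup G] [TopologicalSpace G]

theorem CompletedGroupRing.ofSubgroup_of (G' : Subgroup G) (h : G') :
    CompletedGroupRing.ofSubgroup p G' (CompletedGroupRing.of p h) =
      CompletedGroupRing.of p (h : G) :=
  Subtype.ext <| funext fun _ => MonoidAlgebra.mapDomain_single

theorem CompletedGroupRing.coeff_ofSubgroup_mul_of (G' : Subgroup G)
    (s : CompletedGroupRing p G') (U : OpenSubgroup G) (g : G) (q : G ⧸ (U : Subgroup G)) :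
    ((CompletedGroupRing.ofSubgroup p G' s * CompletedGroupRing.of p g).1 U).coeff q =
      Finsupp.mapDomain (QuotientGroup.map
        ((U.comap G'.subtype continuous_subtype_val : OpenSubgroup G') : Subgroup G')
        (U : Subgroup G) G'.subtype (fun _ ha => ha))
        (s.1 (U.comap G'.subtype continuous_subtype_val)).coeff
          (q * (g : G ⧸ (U : Subgroup G))⁻¹) :=
  (MonoidAlgebra.coeff_mul_single_apply _ _ _ _).trans (mul_one _)

/-- The map `⊕_c ℤ_p[[G']] → ℤ_p[[G]]` given by representatives of the cosets of `G'`. -/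
noncomputable def CompletedGroupRing.cosetSum (G' : Subgroup G) [Fintype (G ⧸ G')] :
    (G ⧸ G' → CompletedGroupRing p G') →+ CompletedGroupRing p G where
  toFun s := ∑ c, CompletedGroupRing.ofSubgroup p G' (s c) * CompletedGroupRing.of p c.out
  map_zero' := by simp
  map_add' s t := by simp [add_mul, Finset.sum_add_distrib]

theorem CompletedGroupRing.cosetSum_single (G' : Subgroup G) [Fintype (G ⧸ G')]
    [DecidableEq (G ⧸ G')] (c : G ⧸ G') (s : CompletedGroupRing p G') :
    CompletedGroupRing.cosetSum p G' (Pi.single c s) =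
      CompletedGroupRing.ofSubgroup p G' s * CompletedGroupRing.of p c.out := by
  refine (Finset.sum_eq_single c (fun c' _ hc => ?_) fun h => absurd (Finset.mem_univ c) h).trans ?_
  · rw [Pi.single_eq_of_ne hc, map_zero, zero_mul]
  · rw [Pi.single_eq_same]

/-- For `U ≤ G'` the group `G ⧸ U` is the disjoint union of the cosets of the image of `G'`, and the
coefficients on the coset `c` involve only `s c`. -/
theorem CompletedGroupRing.cosetSum_injective {G' : Subgroup G} (hopen : IsOpen (G' : Set G))
    [Fintype (G ⧸ G')] : Function.Injective (CompletedGroupRing.cosetSum p G') := by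
  refine (injective_iff_map_eq_zero _).mpr fun s hs => ?_
  have key (U : OpenSubgroup G) (hU : (U : Subgroup G) ≤ G') (c : G ⧸ G') :
      (s c).1 (U.comap G'.subtype continuous_subtype_val) = 0 := by
    set j := QuotientGroup.map
      ((U.comap G'.subtype continuous_subtype_val : OpenSubgroup G') : Subgroup G')
      (U : Subgroup G) G'.subtype (fun _ ha => ha) with hj
    have hjinj : Function.Injective j := by
      refine (injective_iff_map_eq_one j).mpr fun a ha => ?_
      obtain ⟨a, rfl⟩ := QuotientGroup.mk_surjective a
      exact (QuotientGroup.eq_one_iff _).mpr ((QuotientGroup.eq_one_iff (a : G)).mp ha)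
    let π : G ⧸ (U : Subgroup G) →* G ⧸ G' := QuotientGroup.map _ _ (MonoidHom.id G) hU
    have hπj (a) : π (j a) = 1 := by
      obtain ⟨a, rfl⟩ := QuotientGroup.mk_surjective a
      exact (QuotientGroup.eq_one_iff (a : G)).mpr a.2
    have hπ (c : G ⧸ G') : π (c.out : G) = c := c.out_eq'
    refine MonoidAlgebra.coeff_injective (Finsupp.ext fun a => ?_)
    have h0 : ((CompletedGroupRing.proj p U (CompletedGroupRing.cosetSum p G' s))).coeff
        (j a * (c.out : G)) = 0 := by rw [hs]; rfl
    change ((CompletedGroupRing.proj p U (∑ c, _)).coeff _) = 0 at h0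
    rw [map_sum, MonoidAlgebra.coeff_sum, Finsupp.finsetSum_apply, Finset.sum_eq_single c] at h0
    · have := (CompletedGroupRing.coeff_ofSubgroup_mul_of p G' (s c) U c.out _).symm.trans h0
      rw [mul_inv_cancel_right, Finsupp.mapDomain_apply hjinj] at this
      exact this
    · intro c' _ hc'
      refine (CompletedGroupRing.coeff_ofSubgroup_mul_of p G' (s c') U c'.out _).trans ?_
      refine Finsupp.mapDomain_of_notMem_range _ _ ?_
      rintro ⟨a', ha'⟩
      have := congrArg π ha'
      rw [hπj, map_mul, map_inv, map_mul, hπj, hπ, hπ, one_mul, eq_comm, mul_inv_eq_one] at this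
      exact hc' this.symm
    · exact fun h => absurd (Finset.mem_univ c) h
  refine funext fun c => Subtype.ext <| funext fun V => ?_
  -- An open subgroup of `G'` is open in `G`, so the levels treated in `key` determine `s c`.
  let U : OpenSubgroup G :=
    ⟨(V : Subgroup G').map G'.subtype, hopen.isOpenMap_subtype_val _ V.isOpen⟩
  have hUV : U.comap G'.subtype continuous_subtype_val ≤ V := by
    rintro x ⟨y, hy, hxy⟩
    rwa [← Subtype.ext hxy]
  rw [← (s c).2 _ _ hUV, key U (Subgroup.map_subtype_le _) c, map_zero]
  rfl

variable [IsTopologicalGroup G] [CompactSpace G]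

/-- The image is compact, hence closed, and contains the elements of `G`. -/
theorem CompletedGroupRing.cosetSum_surjective {G' : Subgroup G} (hopen : IsOpen (G' : Set G))
    [Fintype (G ⧸ G')] : Function.Surjective (CompletedGroupRing.cosetSum p G') := by
  classical
  have : CompactSpace G' := isCompact_iff_compactSpace.mp (G'.isClosed_of_isOpen hopen).isCompact
  have hcont : Continuous (CompletedGroupRing.cosetSum p G') :=
    continuous_finsetSum _ fun c _ =>
      ((CompletedGroupRing.continuous_map p G'.subtype continuous_subtype_val).comp
        (continuous_apply c)).mul continuous_const
  have hN := CompletedGroupRing.eq_top_of_isClosed p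
    (N := (CompletedGroupRing.cosetSum p G').range) (isCompact_range hcont).isClosed fun g => by
      obtain ⟨h, hh⟩ := QuotientGroup.mk_out_eq_mul G' g
      refine ⟨Pi.single (g : G ⧸ G') (CompletedGroupRing.of p h⁻¹), ?_⟩
      rw [CompletedGroupRing.cosetSum_single, CompletedGroupRing.ofSubgroup_of, ← map_mul, hh,
        Subgroup.coe_inv, mul_comm g, inv_mul_cancel_left]
  exact AddMonoidHom.range_eq_top.mp hN

theorem torsionCompatible_ofSubgroup (G' : Subgroup G) (hopen : IsOpen (G' : Set G)) :
    TorsionCompatible (CompletedGroupRing.ofSubgroup p G') := by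
  have := G'.quotient_finite_of_isOpen hopen
  have := Fintype.ofFinite (G ⧸ G')
  let _ : Algebra (CompletedGroupRing p G') (CompletedGroupRing p G) :=
    (CompletedGroupRing.ofSubgroup p G').toAlgebra
  let f : (G ⧸ G' → CompletedGroupRing p G') →ₗ[CompletedGroupRing p G'] CompletedGroupRing p G :=
    { CompletedGroupRing.cosetSum p G' with
      map_smul' := fun a s => by
        refine Eq.trans ?_ (Finset.mul_sum _ _ (CompletedGroupRing.ofSubgroup p G' a)).symm
        refine Finset.sum_congr rfl fun c _ => ?_
        rw [Pi.smul_apply, smul_eq_mul, map_mul, mul_assoc] }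
  let e := LinearEquiv.ofBijective f
    ⟨CompletedGroupRing.cosetSum_injective p hopen, CompletedGroupRing.cosetSum_surjective p hopen⟩
  exact (Module.Basis.ofEquivFun e.symm).torsionCompatible

end OpenSubgroup

theorem mainTheorem6 (p : ℕ) [Fact p.Prime] (d : ℕ)
    (G : Type u) [CommGroup G] [TopologicalSpace G] [IsTopologicalGroup G]
    [CompactSpace G] [T2Space G] [TotallyDisconnectedSpace G]
    (G' : Subgroup G) (hopen : IsOpen (G' : Set G))
    (hG' : Nonempty (G' ≃ₜ* Multiplicative (Fin d → ℤ_[p])))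
    [HasDerivedCategory.{w} (ModuleCat.{u} (CompletedGroupRing p G))] :
    let R := CompletedGroupRing p G
    let ι : CompletedGroupRing p G' →+* R := CompletedGroupRing.ofSubgroup p G'
    ∃ (Fitt : ExactK0 (catP ι) →+ Additive (InvertibleIdeals R))
      (φ : ExactK0 (catQ ι) →+ TriangulatedK0 (derivedPerfTor.{w} ι))
      (Det : TriangulatedK0 (derivedPerfTor.{w} ι) →+ Additive (InvertibleIdeals R)),
      -- `Fitt` is given by the Fitting ideals
      (∀ (P : ModuleCat.{u} R) (hP : catP ι P),
        ((Fitt (ExactK0.of _ P hP)).toMul :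
          FractionalIdeal (nonZeroDivisors R) (FractionRing R)) = ↑(fittingIdeal R P)) ∧
      -- `φ` is given by projective resolutions, which exist
      (∀ Q : ModuleCat.{u} R, catQ ι Q →
        ∃ F : CochainComplex (ModuleCat.{u} R) ℤ, IsPerfectResolution ι F Q) ∧
      (∀ (Q : ModuleCat.{u} R) (hQ : catQ ι Q) (F : CochainComplex (ModuleCat.{u} R) ℤ)
        (hF : IsPerfectResolution ι F Q),
        φ (ExactK0.of _ Q hQ) = complexClass.{w} ι F hF.1) ∧
      -- `Det` is given by the determinants of perfect complexes with torsion cohomology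
      (∀ (F : CochainComplex (ModuleCat.{u} R) ℤ) (hF : IsPerfectTorsion ι F),
        Nonempty (FracContraction F) ∧
        ∀ c : FracContraction F,
          (((Det (complexClass.{w} ι F hF)).toMul :
            FractionalIdeal (nonZeroDivisors R) (FractionRing R)) :
              Submodule R (FractionRing R)) = c.det) ∧
      -- all maps are isomorphisms
      Function.Bijective (ExactK0.incl (catP_le_catQ ι)) ∧
      Function.Bijective φ ∧
      Function.Bijective Det ∧
      Function.Bijective Fitt ∧
      -- the diagram is anti-commutative
      (Det.comp φ).comp (ExactK0.incl (catP_le_catQ ι)) = -Fitt := by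
  -- From here on, only these three properties of `R` enter.
  have := isNoetherianRing_completedGroupRing p d G' hopen hG'
  have := finite_maximalSpectrum_completedGroupRing p d G' hopen hG'
  have hι := torsionCompatible_ofSubgroup p G' hopen
  exact ⟨fittingHom.{w} hι, resolutionHom.{w} hι, detHom.{w} hι, fittingHom_of hι,
    exists_isPerfectResolution hι, fun Q hQ F hF => resolutionHom_of_eq_complexClass hι hQ hF,
    det_detHom_complexClass hι, ⟨incl_injective hι, incl_surjective hι⟩, resolutionHom_bijective hι,
    detHom_bijective hι, fittingHom_bijective hι, comp_eq_neg_fittingHom hι⟩
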